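/- Let $\lambda\neq 0$ be real. For $u:\mathbb{R}^2\to\mathbb{C}$ write $(\mathcal{F}_0u)(p_0,x_1)=\int e^{-ip_0y_0}u(y_0,x_1)\,dy_0$. Let $\mathcal{S}_c$ be the space of Schwartz functions on $\mathbb{R}^2$ supported in $K\times\mathbb{R}$ for some compact $K\subset\mathbb{R}$, and let $\mathcal{A}=\mathcal{F}(\mathcal{S}_c)$, where $\mathcal{F}$ is the Fourier transform on $\mathbb{R}^2$. Equip $\mathcal{A}$ with the product and involution $$(f\star g)(x)=\int e^{ip_0x_0}(\mathcal{F}_0f)(p_0,x_1)\,g(x_0,e^{-\lambda p_0}x_1)\frac{dp_0}{2\pi},\qquad f^*(x)=\int e^{ip_0x_0}(\mathcal{F}_0\overline f)(p_0,e^{-\lambda p_0}x_1)\frac{dp_0}{2\pi}.$$ Let $\mathcal{H}_r$ be the completion of $\mathcal{A}$ for the inner product $(f,g)=\int (f^*\star g)(x)\,d^2x$, and let $\mathcal{H}=\mathcal{H}_r\otimes\mathbb{C}^2$. For $f\in\mathcal{A}$ let $\pi(f)$ be the bounded operator on $\mathcal{H}_r$ extending $\psi\mapsto f\star\psi$, and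 also its extension acting on both components of $\mathcal{H}$; write $f\geq0$ if $\pi(f)$ is a positive operator. Let $\mathcal{D}$ be the self-adjoint closure of the operator $\Gamma^0\lambda^{-1}(1-\mathcal{E})+\Gamma^1P_1$ with domain $\mathcal{A}\otimes\mathbb{C}^2$, where $P_1=-i\partial_1$, $(\mathcal{E}\psi)(x)=\psi(x_0+i\lambda,x_1)$ (analytic continuation in the first variable), $\Gamma^0=\begin{pmatrix}0&1\\1&0\end{pmatrix}$ and $\Gamma^1=\begin{pmatrix}0&-i\\i&0\end{pmatrix}$. For $f\in\mathcal{A}$ and $s>0$ put $$(Uf)(x)=\int e^{ip_0x_0}(\mathcal{F}_0f)(p_0,e^{\lambda p_0}x_1)\frac{dp_0}{2\pi},\qquad G_s(p)=\left(\lambda^{-2}(1-e^{-\lambda p_0})^2+p_1^2+1\right)^{-s/4}.$$ 1. Let $h\in\mathcal{A}$ with $h=f\star f$, where $f\in\mathcal{A}$, $f\geq0$ and $f\neq0$. Then $\pi(h)(\mathcal{D}^2+1)^{-s/2}$ is not trace class for any $s>0$. 2. For all $f\in\mathcal{A}$ and $s>0$, the Hilbert–Schmidt norm satisfies $$\left\|\pi(f)(\mathcal{D}^2+1)^{-s/4}\right\|_{HS}^2=\frac{2}{(2\pi)^2}\,\|Uf\|_{L^2(\mathbb{R}^2)}^2\,\|G_s\|_{L^2(\mathbb{R}^2)}^2$$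 in $[0,\infty]$ (with $0\cdot\infty=0$), and $\|G_s\|_{L^2(\mathbb{R}^2)}=\infty$. 3. There is no $s>0$ such that $\pi(a)(\mathcal{D}^2+1)^{-s/2}$ is trace class for all $a\in\mathcal{A}$ with $a\geq0$; that is, the triple $(\mathcal{A},\mathcal{H},\mathcal{D})$ is not finitely summable. -/

import Mathlib

open MeasureTheory Complex SchwartzMap
open scoped ComplexConjugate ENNReal ContDiff LineDeriv
noncomputable section
namespace KMinkowski

/-- The Fourier transform in the first variable, `(𝓕₀ u)(p₀, x₁) = ∫ e^{-i p₀ y₀} u(y₀, x₁) dy₀`. -/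
def partialFourier (u : ℝ × ℝ → ℂ) (p₀ x₁ : ℝ) : ℂ :=
  ∫ y₀ : ℝ, exp (-I * p₀ * y₀) * u (y₀, x₁)

lemma schwartz_bound (u : 𝓢(ℝ × ℝ, ℂ)) :
    ∃ C : ℝ, 0 ≤ C ∧ ∀ x : ℝ × ℝ, ‖u x‖ ≤ C * ((1 + x.1 ^ 2)⁻¹ * (1 + x.2 ^ 2)⁻¹) := by
  obtain ⟨C0, h0⟩ := u.decay 0 0
  obtain ⟨C2, h2⟩ := u.decay 2 0
  obtain ⟨C4, h4⟩ := u.decay 4 0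
  refine ⟨C0 + 2 * C2 + C4, ?_, fun x => ?_⟩
  · have a0 := h0.1; have a2 := h2.1; have a4 := h4.1
    positivity
  · have b0 := h0.2 x
    have b2 := h2.2 x
    have b4 := h4.2 x
    simp only [norm_iteratedFDeriv_zero, pow_zero, one_mul] at b0 b2 b4
    have hx1 : x.1 ^ 2 ≤ ‖x‖ ^ 2 := by
      rw [← sq_abs x.1]; exact pow_le_pow_left₀ (abs_nonneg _) (norm_fst_le x) 2
    have hx2 : x.2 ^ 2 ≤ ‖x‖ ^ 2 := by
      rw [← sq_abs x.2]; exact pow_le_pow_left₀ (abs_nonneg _) (norm_snd_le x) 2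
    rw [← mul_inv, ← div_eq_mul_inv, le_div_iff₀ (by positivity)]
    have hm : (1 + x.1 ^ 2) * (1 + x.2 ^ 2) ≤ (1 + ‖x‖ ^ 2) * (1 + ‖x‖ ^ 2) := by gcongr
    calc ‖u x‖ * ((1 + x.1 ^ 2) * (1 + x.2 ^ 2))
        ≤ ‖u x‖ * ((1 + ‖x‖ ^ 2) * (1 + ‖x‖ ^ 2)) := by gcongr
      _ = ‖u x‖ + 2 * (‖x‖ ^ 2 * ‖u x‖) + ‖x‖ ^ 4 * ‖u x‖ := by ring
      _ ≤ _ := by linarith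

lemma norm_phase (a b : ℝ) : ‖exp (-I * a * b)‖ = 1 := by
  rw [show (-I * a * b : ℂ) = ((-(a * b) : ℝ) : ℂ) * I by push_cast; ring]
  exact norm_exp_ofReal_mul_I _

lemma norm_phase' (a b : ℝ) : ‖exp (I * a * b)‖ = 1 := by
  rw [show (I * a * b : ℂ) = ((a * b : ℝ) : ℂ) * I by push_cast; ring]
  exact norm_exp_ofReal_mul_I _

lemma slice_bound (u : 𝓢(ℝ × ℝ, ℂ)) :
    ∃ C : ℝ, 0 ≤ C ∧ ∀ y x : ℝ, ‖u (y, x)‖ ≤ C * (1 + y ^ 2)⁻¹ := by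
  obtain ⟨C, hC, h⟩ := schwartz_bound u
  refine ⟨C, hC, fun y x => (h (y, x)).trans ?_⟩
  have : (1 + x ^ 2)⁻¹ ≤ 1 := inv_le_one_of_one_le₀ (by nlinarith [sq_nonneg x])
  have h2 : 0 ≤ (1 + y ^ 2)⁻¹ := by positivity
  exact mul_le_mul_of_nonneg_left (mul_le_of_le_one_right h2 this) hC

lemma integrable_phase_slice (u : 𝓢(ℝ × ℝ, ℂ)) (p x : ℝ) :
    Integrable (fun y : ℝ => exp (-I * p * y) * u (y, x)) := by
  obtain ⟨C, hC, h⟩ := slice_bound u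
  refine (integrable_inv_one_add_sq.const_mul C).mono' ?_ (ae_of_all _ fun y => ?_)
  · have := u.continuous
    exact Continuous.aestronglyMeasurable (by fun_prop)
  · rw [norm_mul, norm_phase, one_mul]; exact h y x

lemma contDiff_partialFourier (n : ℕ) : ∀ u : 𝓢(ℝ × ℝ, ℂ),
    ContDiff ℝ n (fun q : ℝ × ℝ => partialFourier u q.1 q.2) := by
  have key : ∀ u : 𝓢(ℝ × ℝ, ℂ), ∃ v w : 𝓢(ℝ × ℝ, ℂ), ∀ q : ℝ × ℝ,
      HasFDerivAt (fun q : ℝ × ℝ => partialFourier u q.1 q.2)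
        ((ContinuousLinearMap.fst ℝ ℝ ℝ).smulRight (partialFourier v q.1 q.2) +
          (ContinuousLinearMap.snd ℝ ℝ ℝ).smulRight (partialFourier w q.1 q.2)) q := by
    intro u
    have tg : (fun x : ℝ × ℝ => (-I * (x.1 : ℂ))).HasTemperateGrowth := by
      have h := (ContinuousLinearMap.smulRightL ℝ (ℝ × ℝ) ℂ
        (ContinuousLinearMap.fst ℝ ℝ ℝ) (-I)).hasTemperateGrowth
      convert h using 2 with x
      simp [mul_comm]
    let v : 𝓢(ℝ × ℝ, ℂ) := SchwartzMap.smulLeftCLM ℂ (fun x : ℝ × ℝ => (-I * (x.1 : ℂ))) u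
    have hv : ∀ x, v x = -I * x.1 * u x := fun x => by
      simp only [v, SchwartzMap.smulLeftCLM_apply_apply tg, smul_eq_mul]
    let w : 𝓢(ℝ × ℝ, ℂ) := ∂_{((0, 1) : ℝ × ℝ)} u
    have hw : ∀ x, w x = fderiv ℝ u x (0, 1) := fun x => by
      simp only [w, SchwartzMap.lineDerivOp_apply_eq_fderiv]
    refine ⟨v, w, fun q => ?_⟩
    let A1 : ℂ →L[ℝ] (ℝ × ℝ →L[ℝ] ℂ) :=
      ContinuousLinearMap.smulRightL ℝ (ℝ × ℝ) ℂ (ContinuousLinearMap.fst ℝ ℝ ℝ)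
    let A2 : ℂ →L[ℝ] (ℝ × ℝ →L[ℝ] ℂ) :=
      ContinuousLinearMap.smulRightL ℝ (ℝ × ℝ) ℂ (ContinuousLinearMap.snd ℝ ℝ ℝ)
    let G' : ℝ × ℝ → ℝ → (ℝ × ℝ →L[ℝ] ℂ) := fun q y =>
      A1 (exp (-I * q.1 * y) * v (y, q.2)) + A2 (exp (-I * q.1 * y) * w (y, q.2))
    have hG' : ∫ y, G' q y = (ContinuousLinearMap.fst ℝ ℝ ℝ).smulRight (partialFourier v q.1 q.2) +
          (ContinuousLinearMap.snd ℝ ℝ ℝ).smulRight (partialFourier w q.1 q.2) := by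
      simp only [G']
      rw [integral_add (A1.integrable_comp (integrable_phase_slice v _ _))
        (A2.integrable_comp (integrable_phase_slice w _ _)),
        A1.integral_comp_comm (integrable_phase_slice v _ _),
        A2.integral_comp_comm (integrable_phase_slice w _ _)]
      rfl
    rw [← hG']
    obtain ⟨Cv, hCv, bv⟩ := slice_bound v
    obtain ⟨Cw, hCw, bw⟩ := slice_bound w
    have cu := u.continuous
    have cv := v.continuous
    have cw := w.continuous
    refine hasFDerivAt_integral_of_dominated_of_fderiv_le (s := Set.univ)
      (F := fun (q : ℝ × ℝ) (y : ℝ) => exp (-I * q.1 * y) * u (y, q.2)) (F' := G')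
      (bound := fun y => ‖A1‖ * (Cv * (1 + y ^ 2)⁻¹) + ‖A2‖ * (Cw * (1 + y ^ 2)⁻¹))
      Filter.univ_mem (Filter.Eventually.of_forall fun q => ?_) (integrable_phase_slice u _ _) ?_
      (ae_of_all _ fun y q _ => ?_) ?_ (ae_of_all _ fun y q _ => ?_)
    · exact (integrable_phase_slice u _ _).aestronglyMeasurable
    · exact ((A1.integrable_comp (integrable_phase_slice v _ _)).add
        (A2.integrable_comp (integrable_phase_slice w _ _))).aestronglyMeasurable
    · refine (norm_add_le _ _).trans (add_le_add ?_ ?_)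
      · refine (A1.le_opNorm _).trans ?_
        gcongr
        rw [norm_mul, norm_phase, one_mul]; exact bv _ _
      · refine (A2.le_opNorm _).trans ?_
        gcongr
        rw [norm_mul, norm_phase, one_mul]; exact bw _ _
    · exact ((integrable_inv_one_add_sq.const_mul _).const_mul _).add
        ((integrable_inv_one_add_sq.const_mul _).const_mul _)
    · have h1 : HasFDerivAt (fun q : ℝ × ℝ => -I * (q.1 : ℂ) * (y : ℂ))
          (A1 (-I * y)) q := by
        have : (fun q : ℝ × ℝ => -I * (q.1 : ℂ) * (y : ℂ)) = A1 (-I * y) := by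
          funext q
          simp [A1]; ring
        rw [this]; exact (A1 (-I * y)).hasFDerivAt
      have h2 : HasFDerivAt (fun q : ℝ × ℝ => u (y, q.2))
          (A2 (w (y, q.2))) q := by
        have hd := (u.differentiable (y, q.2)).hasFDerivAt
        have hl : HasFDerivAt (fun q : ℝ × ℝ => (y, q.2))
            ((0 : ℝ × ℝ →L[ℝ] ℝ).prod (ContinuousLinearMap.snd ℝ ℝ ℝ)) q :=
          (hasFDerivAt_const y q).prodMk (ContinuousLinearMap.snd ℝ ℝ ℝ).hasFDerivAt
        refine (hd.comp q hl).congr_fderiv ?_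
        ext
        · have h0 : fderiv ℝ u (y, q.2) (0, 0) = 0 := (fderiv ℝ u (y, q.2)).map_zero
          simp [A2, hw, h0]
        · simp [A2, hw]
      refine (h1.cexp.mul h2).congr_fderiv ?_
      ext
      · simp [G', A1, A2, hv]; ring
      · simp [G', A1, A2, hv]
  induction n with
  | zero =>
    intro u
    obtain ⟨v, w, h⟩ := key u
    rw [Nat.cast_zero, contDiff_zero]
    exact continuous_iff_continuousAt.2 fun q => (h q).continuousAt
  | succ n ih =>
    intro u
    obtain ⟨v, w, h⟩ := key u
    rw [Nat.cast_succ, contDiff_succ_iff_fderiv]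
    refine ⟨fun q => (h q).differentiableAt, by simp, ?_⟩
    rw [funext fun q => (h q).fderiv]
    have hv := ih v
    have hw := ih w
    exact (contDiff_const.smulRight hv).add (contDiff_const.smulRight hw)

/-- The deformed product
`(u ⋆ v)(x) = ∫ e^{i p₀ x₀} (𝓕₀ u)(p₀, x₁) v(x₀, e^{-λ p₀} x₁) dp₀ / 2π`, with `l` standing for `λ`. -/
def starProd (l : ℝ) (u v : ℝ × ℝ → ℂ) (x : ℝ × ℝ) : ℂ :=
  (1 / (2 * Real.pi)) * ∫ p₀ : ℝ,
    exp (I * p₀ * x.1) * partialFourier u p₀ x.2 * v (x.1, Real.exp (-l * p₀) * x.2)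

/-- The involution `u^*(x) = ∫ e^{i p₀ x₀} (𝓕₀ ū)(p₀, e^{-λ p₀} x₁) dp₀ / 2π`. -/
def involution (l : ℝ) (u : ℝ × ℝ → ℂ) (x : ℝ × ℝ) : ℂ :=
  (1 / (2 * Real.pi)) * ∫ p₀ : ℝ,
    exp (I * p₀ * x.1) * partialFourier (fun y => conj (u y)) p₀ (Real.exp (-l * p₀) * x.2)

/-- The weight `ω`, integration against Lebesgue measure. -/
def weight (u : ℝ × ℝ → ℂ) : ℂ := ∫ x : ℝ × ℝ, u x

/-- The Fourier transform on `ℝ²`, unitary convention. -/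
def fourier₂ (φ : ℝ × ℝ → ℂ) (x : ℝ × ℝ) : ℂ :=
  (1 / (2 * Real.pi)) * ∫ p : ℝ × ℝ, exp (-I * (p.1 * x.1 + p.2 * x.2)) * φ p

/-- Schwartz functions on `ℝ²` with support in `K × ℝ` for some compact `K ⊆ ℝ`. -/
def schwartzCompact : Set 𝓢(ℝ × ℝ, ℂ) :=
  {φ | ∃ K : Set ℝ, IsCompact K ∧ tsupport φ ⊆ K ×ˢ Set.univ}

lemma integrable_fourier₂ (φ : 𝓢(ℝ × ℝ, ℂ)) (x : ℝ × ℝ) :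
    Integrable (fun p : ℝ × ℝ => exp (-I * (p.1 * x.1 + p.2 * x.2)) * φ p) := by
  have hc := φ.continuous
  refine φ.integrable.norm.mono' (Continuous.aestronglyMeasurable (by fun_prop))
    (ae_of_all _ fun p => ?_)
  rw [norm_mul, show (-I * (p.1 * x.1 + p.2 * x.2) : ℂ) =
    ((-(p.1 * x.1 + p.2 * x.2) : ℝ) : ℂ) * I by push_cast; ring, norm_exp_ofReal_mul_I, one_mul]

/-- The algebra `𝒜`: the image of `schwartzCompact` under the Fourier transform. Such functions
are themselves Schwartz. -/
def algA : Submodule ℂ 𝓢(ℝ × ℝ, ℂ) where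
  carrier := {f | ∃ φ ∈ schwartzCompact, ∀ x, f x = fourier₂ φ x}
  zero_mem' := ⟨0, ⟨∅, isCompact_empty, by
    have h : ((0 : 𝓢(ℝ × ℝ, ℂ)) : ℝ × ℝ → ℂ) = 0 := by ext; simp
    rw [h, tsupport_eq_empty_iff.2 rfl]; simp⟩, fun x => by simp [fourier₂]⟩
  add_mem' := by
    rintro f g ⟨φ, ⟨K, hK, hφ⟩, hf⟩ ⟨ψ, ⟨L, hL, hψ⟩, hg⟩
    refine ⟨φ + ψ, ⟨K ∪ L, hK.union hL, ?_⟩, fun x => ?_⟩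
    · rw [Set.union_prod]
      exact (tsupport_add φ ψ).trans (Set.union_subset_union hφ hψ)
    · simp only [add_apply, hf, hg, fourier₂]
      rw [← mul_add, ← integral_add (integrable_fourier₂ φ x) (integrable_fourier₂ ψ x)]
      congr 2; funext p; ring
  smul_mem' := by
    rintro c f ⟨φ, ⟨K, hK, hφ⟩, hf⟩
    refine ⟨c • φ, ⟨K, hK, ?_⟩, fun x => ?_⟩
    · exact (closure_mono (Function.support_const_smul_subset c φ)).trans hφ
    · simp only [smul_apply, hf, fourier₂, smul_eq_mul]
      rw [mul_left_comm, ← integral_const_mul]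
      congr 2; funext p; ring

lemma inversion {k : ℝ → ℂ} (hk : ContDiff ℝ ∞ k) (hs : HasCompactSupport k) (p : ℝ) :
    ∫ x : ℝ, exp (-I * p * x) * ∫ q : ℝ, exp (I * q * x) * k q = 2 * Real.pi * k p := by
  let κ : 𝓢(ℝ, ℂ) := hs.toSchwartzMap hk
  have hκ : ∀ x, κ x = k x := fun x => rfl
  have h1 : ∀ x : ℝ, ∫ q : ℝ, exp (I * q * x) * k q =
      FourierTransformInv.fourierInv κ (x / (2 * Real.pi)) := fun x => by
    rw [SchwartzMap.fourierInv_coe, Real.fourierInv_eq']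
    congr 1; funext q
    simp only [hκ, smul_eq_mul]
    congr 2
    have : (Real.pi : ℂ) ≠ 0 := by exact_mod_cast Real.pi_ne_zero
    simp; field_simp
  have h2 : FourierTransform.fourier (FourierTransformInv.fourierInv κ) p = κ p := by simp
  rw [← hκ, ← h2, SchwartzMap.fourier_coe, Real.fourier_eq']
  simp only [h1]
  have hpi : (0 : ℝ) < 2 * Real.pi := by positivity
  have h3 := Measure.integral_comp_div (fun t : ℝ => exp (-I * p * (t * (2 * Real.pi) : ℝ)) *
    FourierTransformInv.fourierInv κ t) (2 * Real.pi)
  rw [abs_of_pos hpi] at h3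
  have h4 : ∀ x : ℝ, x / (2 * Real.pi) * (2 * Real.pi) = x := fun x => by field_simp
  simp only [h4] at h3
  rw [h3, Complex.real_smul]
  push_cast
  congr 2; funext v
  simp only [smul_eq_mul]
  congr 2
  simp; ring

lemma partialFourier_conj (u : ℝ × ℝ → ℂ) (p x : ℝ) :
    partialFourier (fun y => conj (u y)) p x = conj (partialFourier u (-p) x) := by
  rw [partialFourier, partialFourier, ← integral_conj]
  congr 1; funext y
  rw [map_mul, ← exp_conj]
  simp

lemma partialFourier_support (f : algA) :
    ∃ R : ℝ, ∀ p x : ℝ, R < |p| → partialFourier f.1 p x = 0 := by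
  obtain ⟨f, φ, ⟨K, hK, hφ⟩, hf⟩ := f
  obtain ⟨R, hR⟩ := hK.isBounded.exists_norm_le
  refine ⟨R, fun p x hp => ?_⟩
  have hz : ∀ q y : ℝ, R < |q| → φ (q, y) = 0 := fun q y hq => by
    by_contra h
    exact absurd (hR q (hφ (subset_tsupport _ h)).1) (not_le.2 hq)
  let σ : 𝓢(ℝ × ℝ, ℂ) := SchwartzMap.compCLMOfContinuousLinearEquiv ℂ
    (ContinuousLinearEquiv.prodComm ℝ ℝ ℝ) φ
  have hσ : ∀ q, σ q = φ (q.2, q.1) := fun q => rfl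
  let k : ℝ → ℂ := fun q => (1 / (2 * Real.pi)) * partialFourier σ x (-q)
  have hk : ContDiff ℝ ∞ k := by
    have h : ContDiff ℝ ∞ (fun q : ℝ × ℝ => partialFourier σ q.1 q.2) :=
      contDiff_infty.2 fun n => contDiff_partialFourier n σ
    exact contDiff_const.mul (h.comp (contDiff_const.prodMk contDiff_neg))
  have hk0 : ∀ q, R < |q| → k q = 0 := fun q hq => by
    simp only [k, partialFourier, hσ]
    simp [hz _ _ (show R < |-q| by rwa [abs_neg])]
  have hs : HasCompactSupport k := by
    refine HasCompactSupport.of_support_subset_isCompact (isCompact_closedBall (0 : ℝ) R) ?_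
    intro q hq
    rw [mem_closedBall_zero_iff, Real.norm_eq_abs]
    by_contra h
    exact hq (hk0 q (not_le.1 h))
  have hfk : ∀ y : ℝ, f (y, x) = ∫ q : ℝ, exp (I * q * y) * k q := fun y => by
    rw [hf, fourier₂, Measure.volume_eq_prod, integral_prod _ (integrable_fourier₂ φ (y, x)),
      ← integral_const_mul, ← integral_neg_eq_self]
    congr 1; funext q
    simp only [k, partialFourier, hσ]
    rw [mul_left_comm (exp _), ← integral_const_mul (exp _)]
    congr 2; funext t
    rw [← mul_assoc, ← exp_add]
    congr 2
    push_cast; ring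
  have := inversion hk hs p
  simp only [← hfk] at this
  rw [partialFourier, this, hk0 p hp, mul_zero]

lemma partialFourier_involution (l : ℝ) (f : algA) (p x : ℝ) :
    partialFourier (involution l f.1) p x = conj (partialFourier f.1 (-p) (Real.exp (-l * p) * x)) := by
  obtain ⟨R, hR⟩ := partialFourier_support f
  let k : ℝ → ℂ := fun q =>
    (1 / (2 * Real.pi)) * conj (partialFourier f.1 (-q) (Real.exp (-l * q) * x))
  have hk : ContDiff ℝ ∞ k := by
    have h : ContDiff ℝ ∞ (fun q : ℝ × ℝ => partialFourier f.1 q.1 q.2) :=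
      contDiff_infty.2 fun n => contDiff_partialFourier n f.1
    have h' : ContDiff ℝ ∞ (fun q : ℝ => (-q, Real.exp (-l * q) * x)) := by fun_prop
    exact contDiff_const.mul (conjCLE.contDiff.comp (h.comp h'))
  have hs : HasCompactSupport k := by
    refine HasCompactSupport.of_support_subset_isCompact (isCompact_closedBall (0 : ℝ) R) ?_
    intro q hq
    rw [mem_closedBall_zero_iff, Real.norm_eq_abs]
    by_contra h
    exact hq (by simp [k, hR (-q) _ (by rw [abs_neg]; exact not_le.1 h)])
  have hpi : (Real.pi : ℂ) ≠ 0 := by exact_mod_cast Real.pi_ne_zero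
  have h1 : ∀ y : ℝ, involution l f.1 (y, x) = ∫ q : ℝ, exp (I * q * y) * k q := fun y => by
    simp only [involution, k, partialFourier_conj]
    rw [← integral_const_mul]
    congr 1; funext q; ring
  have h2 := inversion hk hs p
  simp only [← h1] at h2
  rw [partialFourier, h2]
  simp only [k]
  field_simp

lemma partialFourier_bounded (f : 𝓢(ℝ × ℝ, ℂ)) :
    ∃ C : ℝ, 0 ≤ C ∧ ∀ p x : ℝ, ‖partialFourier f p x‖ ≤ C := by
  obtain ⟨C, hC, h⟩ := slice_bound f
  refine ⟨∫ y : ℝ, C * (1 + y ^ 2)⁻¹, by positivity, fun p x => ?_⟩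
  refine norm_integral_le_of_norm_le (integrable_inv_one_add_sq.const_mul C) (ae_of_all _ fun y => ?_)
  rw [norm_mul, norm_phase, one_mul]; exact h y x

/-- The integrand of the momentum-space form of the inner product. -/
def innerDensity (l : ℝ) (f g : 𝓢(ℝ × ℝ, ℂ)) (z : ℝ × ℝ) : ℂ :=
  conj (partialFourier f (-z.2) (Real.exp (-l * z.2) * z.1)) *
    partialFourier g (-z.2) (Real.exp (-l * z.2) * z.1)

lemma weight_formula (l : ℝ) (f g : algA) :
    Integrable (innerDensity l f.1 g.1) ∧
    weight (starProd l (involution l f.1) g.1) =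
      (1 / (2 * Real.pi)) * ∫ z : ℝ × ℝ, innerDensity l f.1 g.1 z := by
  obtain ⟨R, hR⟩ := partialFourier_support f
  obtain ⟨Cf, hCf, bf⟩ := partialFourier_bounded f.1
  obtain ⟨Cg, hCg, bg⟩ := schwartz_bound g.1
  have hcf : Continuous (fun q : ℝ × ℝ => partialFourier f.1 q.1 q.2) :=
    (contDiff_partialFourier 0 f.1).continuous
  have hcg := g.1.continuous
  let H : ℝ × (ℝ × ℝ) → ℂ := fun w => exp (I * w.2.2 * w.1) *
    conj (partialFourier f.1 (-w.2.2) (Real.exp (-l * w.2.2) * w.2.1)) *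
    g.1 (w.1, Real.exp (-l * w.2.2) * w.2.1)
  let m : ℝ := Real.exp (-(2 * |l| * |R|))
  have hH : Integrable H := by
    have hb : Integrable (fun w : ℝ × (ℝ × ℝ) => (1 + w.1 ^ 2)⁻¹ *
        ((1 + w.2.1 ^ 2)⁻¹ * (Set.indicator (Set.Icc (-R) R) (fun _ => Cf * Cg * m⁻¹) w.2.2))) :=
      integrable_inv_one_add_sq.mul_prod (integrable_inv_one_add_sq.mul_prod
        ((integrable_indicator_iff measurableSet_Icc).2
          (continuousOn_const.integrableOn_compact isCompact_Icc)))
    refine hb.mono' (Continuous.aestronglyMeasurable ?_) (ae_of_all _ fun w => ?_)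
    · have : Continuous (fun w : ℝ × (ℝ × ℝ) =>
          partialFourier f.1 (-w.2.2) (Real.exp (-l * w.2.2) * w.2.1)) :=
        hcf.comp (f := fun w : ℝ × (ℝ × ℝ) => (-w.2.2, Real.exp (-l * w.2.2) * w.2.1))
          (by fun_prop)
      have := Complex.continuous_conj.comp this
      change Continuous (fun w : ℝ × (ℝ × ℝ) =>
          conj (partialFourier f.1 (-w.2.2) (Real.exp (-l * w.2.2) * w.2.1))) at this
      fun_prop
    · obtain ⟨x, y, p⟩ := w
      simp only [H, norm_mul, norm_phase', one_mul, RCLike.norm_conj]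
      by_cases hp : |p| ≤ R
      · rw [Set.indicator_of_mem (by exact abs_le.1 hp)]
        have h1 := bf (-p) (Real.exp (-l * p) * y)
        have h2 := bg (x, Real.exp (-l * p) * y)
        have h3 : (1 + (Real.exp (-l * p) * y) ^ 2)⁻¹ ≤ m⁻¹ * (1 + y ^ 2)⁻¹ := by
          rw [← mul_inv]
          refine inv_anti₀ (by positivity) ?_
          have hm1 : m ≤ 1 := Real.exp_le_one_iff.2 (by
            have : 0 ≤ 2 * |l| * |R| := by positivity
            linarith)
          have hm2 : m ≤ Real.exp (-l * p) ^ 2 := by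
            rw [← Real.exp_nat_mul]
            refine Real.exp_le_exp.2 ?_
            have : l * p ≤ |l| * |R| := (le_abs_self _).trans (by
              rw [abs_mul]
              exact mul_le_mul_of_nonneg_left (hp.trans (le_abs_self R)) (abs_nonneg l))
            push_cast; linarith
          rw [mul_pow]
          nlinarith [mul_le_mul_of_nonneg_right hm2 (sq_nonneg y)]
        calc _ ≤ Cf * (Cg * ((1 + x ^ 2)⁻¹ * (m⁻¹ * (1 + y ^ 2)⁻¹))) := by
              refine mul_le_mul h1 (h2.trans ?_) (norm_nonneg _) hCf
              gcongr
          _ = _ := by ring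
      · rw [hR (-p) _ (by rw [abs_neg]; exact not_le.1 hp)]
        simp only [norm_zero, zero_mul]
        have : 0 ≤ (Set.Icc (-R) R).indicator (fun _ => Cf * Cg * m⁻¹) p :=
          Set.indicator_nonneg (fun _ _ => by positivity) p
        positivity
  have hslice : ∀ z : ℝ × ℝ, ∫ x : ℝ, H (x, z) = innerDensity l f.1 g.1 z := fun z => by
    simp only [innerDensity, H]
    rw [partialFourier.eq_def g.1, ← integral_const_mul]
    congr 1; funext x
    rw [mul_comm (exp _), mul_assoc]
    congr 3
    push_cast; ring
  refine ⟨?_, ?_⟩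
  · have := hH.integral_prod_right
    exact this.congr (ae_of_all _ hslice)
  · have hmp := volume_preserving_prodAssoc (α₁ := ℝ) (β₁ := ℝ) (γ₁ := ℝ)
    have hH' : Integrable (fun z : (ℝ × ℝ) × ℝ => H (MeasurableEquiv.prodAssoc z)) :=
      (hmp.integrable_comp_emb (MeasurableEquiv.measurableEmbedding _)).2 hH
    have e1 : ∀ x : ℝ × ℝ, starProd l (involution l f.1) g.1 x =
        (1 / (2 * Real.pi)) * ∫ p : ℝ, H (MeasurableEquiv.prodAssoc (x, p)) := fun x => by
      simp only [starProd, partialFourier_involution]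
      rfl
    simp only [weight, e1]
    rw [integral_const_mul]
    congr 1
    calc _ = ∫ z : (ℝ × ℝ) × ℝ, H (MeasurableEquiv.prodAssoc z) :=
          (integral_prod _ hH').symm
      _ = ∫ w, H w := hmp.integral_comp (MeasurableEquiv.measurableEmbedding _) H
      _ = ∫ z : ℝ × ℝ, ∫ x : ℝ, H (x, z) := integral_prod_symm H hH
      _ = _ := by simp only [hslice]

lemma innerDensity_symm (l : ℝ) (f g : 𝓢(ℝ × ℝ, ℂ)) (z : ℝ × ℝ) :
    conj (innerDensity l g f z) = innerDensity l f g z := by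
  simp [innerDensity, mul_comm]

lemma partialFourier_add (f g : 𝓢(ℝ × ℝ, ℂ)) (p x : ℝ) :
    partialFourier (f + g : 𝓢(ℝ × ℝ, ℂ)) p x = partialFourier f p x + partialFourier g p x := by
  simp only [partialFourier, add_apply, mul_add]
  exact integral_add (integrable_phase_slice f p x) (integrable_phase_slice g p x)

lemma partialFourier_smul (c : ℂ) (f : 𝓢(ℝ × ℝ, ℂ)) (p x : ℝ) :
    partialFourier (c • f : 𝓢(ℝ × ℝ, ℂ)) p x = c * partialFourier f p x := by
  simp only [partialFourier, smul_apply, smul_eq_mul, mul_left_comm _ c]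
  exact integral_const_mul _ _


/-- `⟨f, g⟩ = ω(f^* ⋆ g)` is a positive semidefinite sesquilinear form on `𝒜`. -/
@[reducible] def preCore (l : ℝ) : PreInnerProductSpace.Core ℂ algA where
  inner f g := weight (starProd l (involution l f.1) g.1)
  conj_inner_symm f g := by
    change conj (weight (starProd l (involution l g.1) f.1)) =
      weight (starProd l (involution l f.1) g.1)
    rw [(weight_formula l f g).2, (weight_formula l g f).2, map_mul, ← integral_conj]
    simp only [innerDensity_symm]
    congr 1
    simp [map_ofNat]
  re_inner_nonneg f := by
    change 0 ≤ (weight (starProd l (involution l f.1) f.1)).re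
    rw [(weight_formula l f f).2]
    have : ∀ z, innerDensity l f.1 f.1 z =
        ((‖partialFourier f.1 (-z.2) (Real.exp (-l * z.2) * z.1)‖ ^ 2 : ℝ) : ℂ) := by
      intro z
      rw [innerDensity, ← Complex.normSq_eq_conj_mul_self, Complex.normSq_eq_norm_sq]
    simp only [this]
    rw [integral_complex_ofReal, show (1 / (2 * Real.pi) : ℂ) = ((1 / (2 * Real.pi) : ℝ) : ℂ) by
      push_cast; rfl, ← Complex.ofReal_mul, Complex.ofReal_re]
    exact mul_nonneg (by positivity) (integral_nonneg fun z => by positivity)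
  add_left f g h := by
    change weight (starProd l (involution l (f + g).1) h.1) =
      weight (starProd l (involution l f.1) h.1) + weight (starProd l (involution l g.1) h.1)
    rw [(weight_formula l (f + g) h).2, (weight_formula l f h).2, (weight_formula l g h).2,
      ← mul_add, ← integral_add (weight_formula l f h).1 (weight_formula l g h).1]
    congr 2; funext z
    simp only [innerDensity, Submodule.coe_add, partialFourier_add, map_add, add_mul]
  smul_left f g r := by
    change weight (starProd l (involution l (r • f).1) g.1) =
      conj r * weight (starProd l (involution l f.1) g.1)
    rw [(weight_formula l (r • f) g).2, (weight_formula l f g).2, mul_left_comm,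
      ← integral_const_mul (conj r)]
    congr 2; funext z
    simp only [innerDensity, Submodule.coe_smul, partialFourier_smul, map_mul, mul_assoc]

section Trace
variable {H : Type} [NormedAddCommGroup H] [InnerProductSpace ℂ H] [CompleteSpace H]

/-- The power `T^t` of a positive bounded operator, by continuous functional calculus. -/
def opPow (T : H →L[ℂ] H) (t : ℝ) : H →L[ℂ] H := CFC.rpow T t

/-- `T` is trace class: `Tr |T| = ∑ ⟨bᵢ, |T| bᵢ⟩` is finite in a Hilbert basis. -/
def IsTraceClass (T : H →L[ℂ] H) : Prop :=
  ∃ (ι : Type) (b : HilbertBasis ι ℂ H), Summable fun i => (inner ℂ (b i) (CFC.abs T (b i))).re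

/-- The square `∑ ‖T bᵢ‖²` of the Hilbert–Schmidt norm, possibly infinite, in a Hilbert basis `b`. -/
def hilbertSchmidtNormSq {ι : Type} (b : HilbertBasis ι ℂ H) (T : H →L[ℂ] H) : ℝ≥0∞ :=
  ∑' i, ‖T (b i)‖ₑ ^ 2
end Trace

/-- A copy of `𝒜` that carries the inner product `⟨f, g⟩ = ω(f^* ⋆ g)`. -/
def PreHilbert (_l : ℝ) : Type := algA

instance (l : ℝ) : AddCommGroup (PreHilbert l) := inferInstanceAs (AddCommGroup algA)
instance (l : ℝ) : Module ℂ (PreHilbert l) := inferInstanceAs (Module ℂ algA)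

instance (l : ℝ) : SeminormedAddCommGroup (PreHilbert l) :=
  @InnerProductSpace.Core.toSeminormedAddCommGroup ℂ (PreHilbert l) _ _ _ (preCore l)

instance (l : ℝ) : InnerProductSpace ℂ (PreHilbert l) := InnerProductSpace.ofCore (preCore l)

/-- The Hilbert space `ℋ_r` of the weight `ω`: the completion of `𝒜` for `⟨f, g⟩ = ω(f^* ⋆ g)`. -/
abbrev ReducedHilbert (l : ℝ) : Type := UniformSpace.Completion (PreHilbert l)

/-- The Hilbert space of spinors `ℋ = ℋ_r ⊗ ℂ²`. -/
abbrev SpinorHilbert (l : ℝ) : Type := PiLp 2 (fun _ : Fin 2 => ReducedHilbert l)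

/-- The canonical map `𝒜 → ℋ_r`. -/
def toHilbert (l : ℝ) (f : algA) : ReducedHilbert l := 
  UniformSpace.Completion.coe' (α := PreHilbert l) f

lemma inner_toHilbert (l : ℝ) (f g : algA) :
    inner ℂ (toHilbert l f) (toHilbert l g) = weight (starProd l (involution l f.1) g.1) := by
  exact UniformSpace.Completion.inner_coe (E := PreHilbert l) f g

/-- The canonical map `𝒜 ⊗ ℂ² → ℋ`. -/
def toSpinor (l : ℝ) (ψ : Fin 2 → algA) : SpinorHilbert l :=
  WithLp.toLp 2 fun a => toHilbert l (ψ a)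

/-- `T` is the bounded extension of `ψ ↦ f ⋆ ψ`, `ψ ∈ 𝒜`. -/
def IsLeftMul (l : ℝ) (f : algA) (T : ReducedHilbert l →L[ℂ] ReducedHilbert l) : Prop :=
  ∀ ψ : algA, ∃ φ : algA, (∀ x, φ.1 x = starProd l f.1 ψ.1 x) ∧
    T (toHilbert l ψ) = toHilbert l φ

open Classical in
/-- The bounded operator on `ℋ_r` extending `ψ ↦ f ⋆ ψ`; it is unique, as `𝒜` is dense. -/
def leftMul (l : ℝ) (f : algA) : ReducedHilbert l →L[ℂ] ReducedHilbert l :=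
  if h : ∃ T, IsLeftMul l f T then h.choose else 0

/-- The representation `π(f)` on `ℋ = ℋ_r ⊗ ℂ²`, acting on both components. -/
def spinorRep (l : ℝ) (f : algA) : SpinorHilbert l →L[ℂ] SpinorHilbert l :=
  ((PiLp.continuousLinearEquiv 2 ℂ (fun _ : Fin 2 => ReducedHilbert l)).symm :
      (Fin 2 → ReducedHilbert l) →L[ℂ] SpinorHilbert l) ∘L
    ContinuousLinearMap.piMap (fun _ : Fin 2 => leftMul l f) ∘L
    (PiLp.continuousLinearEquiv 2 ℂ (fun _ : Fin 2 => ReducedHilbert l) :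
      SpinorHilbert l →L[ℂ] (Fin 2 → ReducedHilbert l))

lemma spinorRep_apply (l : ℝ) (f : algA) (ψ : SpinorHilbert l) (a : Fin 2) :
    spinorRep l f ψ a = leftMul l f (ψ a) := rfl

/-- `f ≥ 0` in the sense of `*`-algebras: `f` acts as a positive operator. -/
def IsNonneg (l : ℝ) (f : algA) : Prop := (leftMul l f).IsPositive

/-- `v = ℰ ▷ u`, that is `v(x) = u(x₀ + iλ, x₁)`, where `u` is continued analytically in the first
variable. -/
def IsShift (l : ℝ) (u v : ℝ × ℝ → ℂ) : Prop :=
  ∃ F : ℂ → ℝ → ℂ, (∀ x₁ : ℝ, Differentiable ℂ fun z => F z x₁) ∧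
    (∀ x : ℝ × ℝ, F x.1 x.2 = u x) ∧ ∀ x : ℝ × ℝ, v x = F (x.1 + I * l) x.2

/-- The matrix `Γ⁰`. -/
def gamma₀ : Matrix (Fin 2) (Fin 2) ℂ := !![0, 1; 1, 0]

/-- The matrix `Γ¹`. -/
def gamma₁ : Matrix (Fin 2) (Fin 2) ℂ := !![0, -I; I, 0]

/-- `χ = 𝒟 ψ` for `ψ ∈ 𝒜 ⊗ ℂ²`, where `𝒟 = Γ⁰ λ⁻¹ (1 - ℰ) + Γ¹ P₁` and `P₁ = -i ∂₁`. -/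
def IsDiracPair (l : ℝ) (ψ χ : Fin 2 → algA) : Prop :=
  ∃ e : Fin 2 → ℝ × ℝ → ℂ, (∀ b, IsShift l (ψ b).1 (e b)) ∧
    ∀ a x, (χ a).1 x = ∑ b : Fin 2,
      (gamma₀ a b * ((1 / l) * ((ψ b).1 x - e b x)) +
        gamma₁ a b * (-I * deriv (fun t : ℝ => (ψ b).1 (x.1, t)) x.2))

/-- The graph of the Dirac operator `𝒟`, the closure of its restriction to `𝒜 ⊗ ℂ²`. -/
def diracGraph (l : ℝ) : Set (SpinorHilbert l × SpinorHilbert l) :=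
  closure {z | ∃ ψ χ : Fin 2 → algA, IsDiracPair l ψ χ ∧ z = (toSpinor l ψ, toSpinor l χ)}

/-- `R = (𝒟² + 1)⁻¹`: for every `ξ`, the vector `R ξ` lies in the domain of `𝒟²` and
`𝒟 (𝒟 (R ξ)) = ξ - R ξ`. (There is at most one such `R`, since `𝒟` is symmetric.) -/
def IsInvSqAddOne (l : ℝ) (R : SpinorHilbert l →L[ℂ] SpinorHilbert l) : Prop :=
  ∀ ξ, ∃ η, (R ξ, η) ∈ diracGraph l ∧ (η, ξ - R ξ) ∈ diracGraph l

open Classical in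
/-- The bounded positive operator `(𝒟² + 1)⁻¹`. -/
def invSqAddOne (l : ℝ) : SpinorHilbert l →L[ℂ] SpinorHilbert l :=
  if h : ∃ R, IsInvSqAddOne l R then h.choose else 0

/-- The operator `(𝒟² + 1)^{-s/2}`, as the power `s/2` of `(𝒟² + 1)⁻¹`. -/
def diracPow (l s : ℝ) : SpinorHilbert l →L[ℂ] SpinorHilbert l := opPow (invSqAddOne l) (s / 2)

/-- The unitary `(U u)(x) = ∫ e^{i p₀ x₀} (𝓕₀ u)(p₀, e^{λ p₀} x₁) dp₀ / 2π`. -/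
def unitaryU (l : ℝ) (u : ℝ × ℝ → ℂ) (x : ℝ × ℝ) : ℂ :=
  (1 / (2 * Real.pi)) * ∫ p₀ : ℝ,
    exp (I * p₀ * x.1) * partialFourier u p₀ (Real.exp (l * p₀) * x.2)

/-- `G_s(p) = (λ⁻² (1 - e^{-λ p₀})² + p₁² + 1)^{-s/4}`. -/
def resolventSymbol (l s : ℝ) (p : ℝ × ℝ) : ℝ :=
  (l⁻¹ ^ 2 * (1 - Real.exp (-l * p.1)) ^ 2 + p.2 ^ 2 + 1) ^ (-s / 4)

/-- The set of those `s > 0` for which `π(a) (𝒟² + 1)^{-s/2}` has a finite trace for all `a ≥ 0` in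
`𝒜`. -/
def summabilityExponents (l : ℝ) : Set ℝ :=
  {s | 0 < s ∧ ∀ a : algA, IsNonneg l a → IsTraceClass (spinorRep l a ∘L diracPow l s)}

/-- The triple is finitely summable if the infimum of `summabilityExponents` exists; that set is
bounded below by `0`, so this means that it is nonempty. -/
def FinitelySummable (l : ℝ) : Prop := (summabilityExponents l).Nonempty

end KMinkowski

end

open MeasureTheory KMinkowski

open MeasureTheory Complex SchwartzMap
open scoped ComplexConjugate ENNReal ContDiff LineDeriv
noncomputable section
namespace KMinkowski

/-! ### Schwartz functions in several groups of variables. -/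

section SchwartzTools
variable {E D : Type} [NormedAddCommGroup E] [NormedSpace ℝ E]
  [NormedAddCommGroup D] [NormedSpace ℝ D]

/-! Write `f ∈ 𝒜` as the Fourier transform of `φ` (`momentum`). The inner product of `ℋ_r` becomes
`∫ e^{λ p₀} φ̄ ψ` (`inner_toHilbert_eq`), so `f ↦ w_f = e^{λ p₀/2} φ` (`wave`) extends to a unitary
from `ℋ_r` onto `L²(ℝ²)` (`toL2`). There `π(f)` is the integral operator with kernel `K_f(p, k) =
(2π)⁻¹ w_f(p₀ - k₀, p₁ - e^{λ(p₀ - k₀)} k₁)` (`wave_starProd`, `toL2_leftMul`). On spinors `𝒟` is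
multiplication by an off-diagonal hermitian matrix, so `(𝒟² + 1)⁻¹` and its powers are
multiplications by powers of a scalar symbol (`invSqAddOne_eq`, `diracPow_eq`).

For fixed `k` the substitution in `K_f` is a shear followed by a translation, so it preserves
Lebesgue measure, and `∫ |K_f(p, k)|² dp` does not depend on `k` (`lintegral_kernel_sq`). Tonelli
then factorizes the Hilbert–Schmidt norm of `π(f) g(P)` into a constant times `‖w_f‖² ‖g‖²`
(`hilbertSchmidtNormSq_eq`). Here `‖w_f‖ = ‖U f‖` (`eLpNorm_unitaryU`), and `g` is a reflected
`G_s`. Since `1 - e^{-λ p₀}` stays bounded for `λ p₀ ≥ 0`, `G_s` is bounded below on a set of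
infinite measure, and `‖G_s‖ = ∞` for every `s` (`eLpNorm_resolventSymbol`).

A trace class operator is Hilbert–Schmidt, so `π(h) (𝒟² + 1)^{-s/2}` can be trace class only if `w_h
= 0` (`waveLp_eq_zero_of_isTraceClass`). For symmetric `π(f)`, `f ⋆ f = 0` forces `f = 0`
(`eq_zero_of_star₀_self`): one has `0 = ⟨f ⋆ f, v⟩ = ⟨f, f ⋆ v⟩` for all `v`, hence `∫ w̄_f(p)
K_f(p, k) dp = 0` for all `k`, and at `k = 0` this integral is `‖w_f‖² / 2π`. This gives the
statement on squares. Failure of finite summability then needs one nonzero `f` with hermitian kernel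
(`exists_hermitian`): `π(f ⋆ f) = π(f)² ≥ 0`, and `f ⋆ f` is a counterexample for all `s` at once.
-/

lemma norm_iteratedFDeriv_comp_clm_le (f : 𝓢(E, ℂ)) (L : D →L[ℝ] E) (hL : ‖L‖ ≤ 1) (i : ℕ) (z : D) :
    ‖iteratedFDeriv ℝ i (fun z => f (L z)) z‖ ≤ ‖iteratedFDeriv ℝ i f (L z)‖ := by
  have h := L.iteratedFDeriv_comp_right (f := f) (f.smooth ⊤) z (i := i) (by exact_mod_cast le_top)
  change ‖iteratedFDeriv ℝ i (f ∘ L) z‖ ≤ _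
  rw [h]
  refine (ContinuousMultilinearMap.norm_compContinuousLinearMap_le _ _).trans
    (mul_le_of_le_one_right (norm_nonneg _) ?_)
  exact Finset.prod_le_one (fun _ _ => norm_nonneg _) fun _ _ => hL

/-- The tensor product of two Schwartz functions is a Schwartz function. -/
lemma exists_schwartz_tensor (f : 𝓢(E, ℂ)) (g : 𝓢(D, ℂ)) :
    ∃ u : 𝓢(E × D, ℂ), ∀ z, u z = f z.1 * g z.2 := by
  have hf : ContDiff ℝ ∞ (fun z : E × D => f z.1) := (f.smooth ⊤).comp contDiff_fst
  have hg : ContDiff ℝ ∞ (fun z : E × D => g z.2) := (g.smooth ⊤).comp contDiff_snd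
  refine ⟨⟨fun z => f z.1 * g z.2, hf.mul hg, fun k n => ?_⟩, fun z => rfl⟩
  let Cf := 2 ^ k * ((Finset.Iic (k, n)).sup fun m => SchwartzMap.seminorm ℝ m.1 m.2) f
  let Cg := 2 ^ k * ((Finset.Iic (k, n)).sup fun m => SchwartzMap.seminorm ℝ m.1 m.2) g
  have bf : ∀ i ≤ n, ∀ z : E × D,
      (1 + ‖z.1‖) ^ k * ‖iteratedFDeriv ℝ i (fun z : E × D => f z.1) z‖ ≤ Cf := fun i hi z => by
    have h1 := one_add_le_sup_seminorm_apply (𝕜 := ℝ) (m := (k, n)) le_rfl hi f z.1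
    exact le_trans (mul_le_mul_of_nonneg_left (norm_iteratedFDeriv_comp_clm_le f
      (ContinuousLinearMap.fst ℝ E D) (ContinuousLinearMap.norm_fst_le ℝ E D) i z)
      (by positivity)) h1
  have bg : ∀ i ≤ n, ∀ z : E × D,
      (1 + ‖z.2‖) ^ k * ‖iteratedFDeriv ℝ i (fun z : E × D => g z.2) z‖ ≤ Cg := fun i hi z => by
    have h1 := one_add_le_sup_seminorm_apply (𝕜 := ℝ) (m := (k, n)) le_rfl hi g z.2
    exact le_trans (mul_le_mul_of_nonneg_left (norm_iteratedFDeriv_comp_clm_le g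
      (ContinuousLinearMap.snd ℝ E D) (ContinuousLinearMap.norm_snd_le ℝ E D) i z)
      (by positivity)) h1
  refine ⟨∑ i ∈ Finset.range (n + 1), (n.choose i : ℝ) * (Cf * Cg), fun z => ?_⟩
  -- The weight is shared between the factors, so that every term of the Leibniz sum is controlled
  -- by one seminorm bound for `f` and one for `g`.
  have hz : ‖z‖ ^ k ≤ (1 + ‖z.1‖) ^ k * (1 + ‖z.2‖) ^ k := by
    rw [← mul_pow]
    refine pow_le_pow_left₀ (norm_nonneg _) ?_ k
    have h1 := norm_nonneg z.1
    have h2 := norm_nonneg z.2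
    rw [Prod.norm_def]
    refine max_le ?_ ?_ <;> nlinarith [mul_nonneg h1 h2]
  have hm := norm_iteratedFDeriv_mul_le (𝕜 := ℝ) hf hg z (n := n) (by exact_mod_cast le_top)
  refine (mul_le_mul hz hm (norm_nonneg _) (by positivity)).trans ?_
  rw [Finset.mul_sum]
  refine Finset.sum_le_sum fun i hi => ?_
  have hi' : i ≤ n := Nat.lt_succ_iff.1 (Finset.mem_range.1 hi)
  have a := bf i hi' z
  have b := bg (n - i) (Nat.sub_le _ _) z
  calc _ = (n.choose i : ℝ) * (((1 + ‖z.1‖) ^ k *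
        ‖iteratedFDeriv ℝ i (fun z : E × D => f z.1) z‖) * ((1 + ‖z.2‖) ^ k *
        ‖iteratedFDeriv ℝ (n - i) (fun z : E × D => g z.2) z‖)) := by ring
    _ ≤ _ := by
      refine mul_le_mul_of_nonneg_left (mul_le_mul a b (by positivity) ?_) (by positivity)
      exact le_trans (by positivity) a

/-- Decay in `t` that is uniform in `x`: with `N` the integrability exponent of the measure, the
right side dominates under the integral over `t` and at the same time gives decay in `x`. -/
lemma schwartz_prod_decay {F : Type} [NormedAddCommGroup F] [NormedSpace ℝ F]
    (u : 𝓢(E × D, F)) (k N : ℕ) :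
    ∃ C : ℝ, 0 ≤ C ∧ ∀ x t, ‖x‖ ^ k * ‖u (x, t)‖ ≤ C * (1 + ‖t‖) ^ (-(N : ℝ)) := by
  refine ⟨2 ^ (k + N) * ((Finset.Iic (k + N, 0)).sup
    fun m => SchwartzMap.seminorm ℝ m.1 m.2) u, by positivity, fun x t => ?_⟩
  have h := one_add_le_sup_seminorm_apply (𝕜 := ℝ) (m := (k + N, 0)) le_rfl le_rfl u (x, t)
  rw [norm_iteratedFDeriv_zero] at h
  have hp : (0 : ℝ) < 1 + ‖t‖ := by positivity
  rw [Real.rpow_neg hp.le, Real.rpow_natCast, ← div_eq_mul_inv, le_div_iff₀ (by positivity)]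
  refine le_trans ?_ h
  have h1 : ‖x‖ ^ k ≤ (1 + ‖(x, t)‖) ^ k :=
    pow_le_pow_left₀ (norm_nonneg _) ((norm_fst_le (x, t)).trans (by simp)) k
  have h2 : (1 + ‖t‖) ^ N ≤ (1 + ‖(x, t)‖) ^ N :=
    pow_le_pow_left₀ hp.le (add_le_add le_rfl (norm_snd_le (x, t))) N
  calc ‖x‖ ^ k * ‖u (x, t)‖ * (1 + ‖t‖) ^ N = ‖x‖ ^ k * (1 + ‖t‖) ^ N * ‖u (x, t)‖ := by ring
    _ ≤ (1 + ‖(x, t)‖) ^ k * (1 + ‖(x, t)‖) ^ N * ‖u (x, t)‖ := by gcongr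
    _ = _ := by rw [pow_add]

variable [MeasurableSpace D] [BorelSpace D] [SecondCountableTopology D]
  (μ : Measure D) [μ.HasTemperateGrowth]

lemma integrable_schwartz_slice {F : Type} [NormedAddCommGroup F] [NormedSpace ℝ F]
    (u : 𝓢(E × D, F)) (x : E) : Integrable (fun t => u (x, t)) μ := by
  obtain ⟨C, -, h⟩ := schwartz_prod_decay u 0 μ.integrablePower
  refine ((Measure.integrable_pow_neg_integrablePower μ).const_mul C).mono' ?_ (ae_of_all _ fun t => ?_)
  · have := u.continuous
    exact (by fun_prop : Continuous fun t => u (x, t)).aestronglyMeasurable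
  · simpa using h x t

/-- The derivative is again the integral of a Schwartz function, now valued in `E →L[ℝ] F`. For this
reason the codomain is arbitrary: induction on the order of differentiation then closes in
`integral_schwartz_aux`. -/
lemma hasFDerivAt_integral_schwartz {F : Type} [NormedAddCommGroup F] [NormedSpace ℝ F]
    (u : 𝓢(E × D, F)) : ∃ v : 𝓢(E × D, E →L[ℝ] F), ∀ x,
      HasFDerivAt (fun x => ∫ t, u (x, t) ∂μ) (∫ t, v (x, t) ∂μ) x := by
  let A : (E × D →L[ℝ] F) →L[ℝ] (E →L[ℝ] F) :=
    (ContinuousLinearMap.compL ℝ E (E × D) F).flip (ContinuousLinearMap.inl ℝ E D)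
  let v : 𝓢(E × D, E →L[ℝ] F) := postcompCLM A (fderivCLM ℝ (E × D) F u)
  have hv : ∀ z, v z = (fderiv ℝ u z).comp (ContinuousLinearMap.inl ℝ E D) := fun z => rfl
  refine ⟨v, fun x => ?_⟩
  obtain ⟨C, -, h⟩ := schwartz_prod_decay v 0 μ.integrablePower
  refine hasFDerivAt_integral_of_dominated_of_fderiv_le (s := Set.univ)
      (F := fun x t => u (x, t)) (F' := fun x t => v (x, t))
      (bound := fun t => C * (1 + ‖t‖) ^ (-(μ.integrablePower : ℝ)))
      Filter.univ_mem (Filter.Eventually.of_forall fun q => ?_) (integrable_schwartz_slice μ u _)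
      (integrable_schwartz_slice μ v _).aestronglyMeasurable
      (ae_of_all _ fun y q _ => ?_) ((Measure.integrable_pow_neg_integrablePower μ).const_mul C)
      (ae_of_all _ fun y q _ => ?_)
  · exact (integrable_schwartz_slice μ u _).aestronglyMeasurable
  · simpa using h q y
  · have hd := (u.differentiable (q, y)).hasFDerivAt
    have hl : HasFDerivAt (fun q : E => (q, y)) (ContinuousLinearMap.inl ℝ E D) q :=
      hasFDerivAt_prodMk_left q y
    rw [hv]
    exact hd.comp q hl

lemma integral_schwartz_aux (n : ℕ) : ∀ (F : Type) [NormedAddCommGroup F] [NormedSpace ℝ F]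
    (u : 𝓢(E × D, F)), ContDiff ℝ n (fun x => ∫ t, u (x, t) ∂μ) ∧
      ∀ k : ℕ, ∃ C : ℝ, ∀ x, ‖x‖ ^ k * ‖iteratedFDeriv ℝ n (fun x => ∫ t, u (x, t) ∂μ) x‖ ≤ C := by
  induction n with
  | zero =>
    intro F _ _ u
    obtain ⟨v, hv⟩ := hasFDerivAt_integral_schwartz μ u
    refine ⟨?_, fun k => ?_⟩
    · rw [Nat.cast_zero, contDiff_zero]
      exact continuous_iff_continuousAt.2 fun q => (hv q).continuousAt
    · obtain ⟨C, -, h⟩ := schwartz_prod_decay u k μ.integrablePower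
      refine ⟨∫ t, C * (1 + ‖t‖) ^ (-(μ.integrablePower : ℝ)) ∂μ, fun x => ?_⟩
      rw [norm_iteratedFDeriv_zero]
      refine (mul_le_mul_of_nonneg_left (norm_integral_le_integral_norm _) (by positivity)).trans ?_
      rw [← integral_const_mul]
      exact integral_mono ((integrable_schwartz_slice μ u x).norm.const_mul _)
        ((Measure.integrable_pow_neg_integrablePower μ).const_mul C) fun t => h x t
  | succ n ih =>
    intro F _ _ u
    obtain ⟨v, hv⟩ := hasFDerivAt_integral_schwartz μ u
    have hfd : fderiv ℝ (fun x => ∫ t, u (x, t) ∂μ) = fun x => ∫ t, v (x, t) ∂μ :=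
      funext fun x => (hv x).fderiv
    obtain ⟨h1, h2⟩ := ih _ v
    refine ⟨?_, fun k => ?_⟩
    · rw [Nat.cast_succ, contDiff_succ_iff_fderiv]
      exact ⟨fun q => (hv q).differentiableAt, by simp, by rwa [hfd]⟩
    · obtain ⟨C, hC⟩ := h2 k
      refine ⟨C, fun x => ?_⟩
      rw [← norm_iteratedFDeriv_fderiv, hfd]
      exact hC x

/-- Integrating a Schwartz function over some of its variables gives a Schwartz function. -/
lemma exists_schwartz_integral (u : 𝓢(E × D, ℂ)) :
    ∃ v : 𝓢(E, ℂ), ∀ x, v x = ∫ t, u (x, t) ∂μ :=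
  ⟨⟨fun x => ∫ t, u (x, t) ∂μ,
    contDiff_infty.2 fun n => (integral_schwartz_aux μ n ℂ u).1,
    fun k n => (integral_schwartz_aux μ n ℂ u).2 k⟩, fun _ => rfl⟩
end SchwartzTools

/-! ### The Fourier transform between `𝒜` and momentum space. -/

/-- The plane with the Euclidean norm, as a copy of `ℝ × ℝ`. -/
def planeEquiv : WithLp 2 (ℝ × ℝ) ≃L[ℝ] ℝ × ℝ := WithLp.prodContinuousLinearEquiv 2 ℝ ℝ ℝ

/-- Dilation by `(2π)⁻¹`, from `ℝ × ℝ` to the Euclidean plane. -/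
def dilatedEquiv : (ℝ × ℝ) ≃L[ℝ] WithLp 2 (ℝ × ℝ) :=
  (ContinuousLinearEquiv.smulLeft
    (Units.mk0 ((2 * Real.pi)⁻¹ : ℝ) (by positivity))).trans planeEquiv.symm

/-- The unitary Fourier transform as an operator on Schwartz functions. -/
def fourierSchwartz : 𝓢(ℝ × ℝ, ℂ) →L[ℂ] 𝓢(ℝ × ℝ, ℂ) :=
  (1 / (2 * Real.pi) : ℂ) • (compCLMOfContinuousLinearEquiv ℂ dilatedEquiv ∘L
    FourierTransform.fourierCLM ℂ 𝓢(WithLp 2 (ℝ × ℝ), ℂ) ∘L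
      compCLMOfContinuousLinearEquiv ℂ planeEquiv)

/-- The inverse of `fourierSchwartz`. -/
def momentum : 𝓢(ℝ × ℝ, ℂ) →L[ℂ] 𝓢(ℝ × ℝ, ℂ) :=
  (2 * Real.pi : ℂ) • (compCLMOfContinuousLinearEquiv ℂ planeEquiv.symm ∘L
    FourierTransform.fourierInvCLM ℂ 𝓢(WithLp 2 (ℝ × ℝ), ℂ) ∘L
      compCLMOfContinuousLinearEquiv ℂ dilatedEquiv.symm)

lemma two_pi_ne_zero' : (2 * Real.pi : ℂ) ≠ 0 := by
  exact_mod_cast (by positivity : (2 * Real.pi : ℝ) ≠ 0)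

lemma momentum_fourierSchwartz (φ : 𝓢(ℝ × ℝ, ℂ)) : momentum (fourierSchwartz φ) = φ := by
  have h1 : ∀ u, compCLMOfContinuousLinearEquiv ℂ (F := ℂ) dilatedEquiv.symm
      (compCLMOfContinuousLinearEquiv ℂ dilatedEquiv u) = u := fun u => by ext x; simp
  have h2 : ∀ u, compCLMOfContinuousLinearEquiv ℂ (F := ℂ) planeEquiv.symm
      (compCLMOfContinuousLinearEquiv ℂ planeEquiv u) = u := fun u => by ext x; simp
  have := two_pi_ne_zero'
  simp only [momentum, fourierSchwartz, _root_.smul_apply, ContinuousLinearMap.comp_apply,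
    FourierTransform.fourierCLM_apply, FourierTransform.fourierInvCLM_apply, map_smul, h1, h2,
    FourierTransform.fourierInv_fourier_eq, smul_smul]
  rw [one_div_mul_cancel this, one_smul]

lemma fourierSchwartz_momentum (φ : 𝓢(ℝ × ℝ, ℂ)) : fourierSchwartz (momentum φ) = φ := by
  have h1 : ∀ u, compCLMOfContinuousLinearEquiv ℂ (F := ℂ) dilatedEquiv
      (compCLMOfContinuousLinearEquiv ℂ dilatedEquiv.symm u) = u := fun u => by ext x; simp
  have h2 : ∀ u, compCLMOfContinuousLinearEquiv ℂ (F := ℂ) planeEquiv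
      (compCLMOfContinuousLinearEquiv ℂ planeEquiv.symm u) = u := fun u => by ext x; simp
  have := two_pi_ne_zero'
  simp only [momentum, fourierSchwartz, _root_.smul_apply, ContinuousLinearMap.comp_apply,
    FourierTransform.fourierCLM_apply, FourierTransform.fourierInvCLM_apply, map_smul, h1, h2,
    FourierTransform.fourier_fourierInv_eq, smul_smul]
  rw [mul_one_div_cancel this, one_smul]

/-- The abstract transform has phase `e^{-2πi⟨v, w⟩}` on an inner product space. Passing to the
Euclidean plane supplies the inner product without changing the measure, and the dilation by
`(2π)⁻¹` removes the `2π`. -/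
lemma fourierSchwartz_apply (φ : 𝓢(ℝ × ℝ, ℂ)) (x : ℝ × ℝ) :
    fourierSchwartz φ x = fourier₂ φ x := by
  have hmp := WithLp.volume_preserving_symm_measurableEquiv_toLp_prod ℝ ℝ
  simp only [fourierSchwartz, _root_.smul_apply, smul_eq_mul, fourier₂,
    ContinuousLinearMap.comp_apply, FourierTransform.fourierCLM_apply,
    compCLMOfContinuousLinearEquiv_apply, Function.comp_apply, SchwartzMap.fourier_coe]
  rw [Real.fourier_eq', ← hmp.integral_comp (MeasurableEquiv.measurableEmbedding _)]
  congr 2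
  funext p
  simp only [smul_eq_mul]
  congr 2
  have hd : dilatedEquiv x = WithLp.toLp 2 ((2 * Real.pi)⁻¹ • x) := rfl
  have hq : (MeasurableEquiv.toLp 2 (ℝ × ℝ)).symm p = planeEquiv p := rfl
  have h : (Real.pi : ℂ) ≠ 0 := by exact_mod_cast Real.pi_ne_zero
  rw [hd, hq]
  simp [planeEquiv, WithLp.prod_inner_apply]
  field_simp

lemma algA_apply (f : algA) (x : ℝ × ℝ) : f.1 x = fourier₂ (momentum f.1) x := by
  rw [← fourierSchwartz_apply, fourierSchwartz_momentum]

lemma momentum_mem (f : algA) : momentum f.1 ∈ schwartzCompact := by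
  obtain ⟨f, φ, hφ, h⟩ := f
  have : f = fourierSchwartz φ := by ext x; rw [h, fourierSchwartz_apply]
  change momentum f ∈ schwartzCompact
  rwa [this, momentum_fourierSchwartz]

/-- The element of `𝒜` with a given momentum space function. -/
def ofMomentum (φ : 𝓢(ℝ × ℝ, ℂ)) (h : φ ∈ schwartzCompact) : algA :=
  ⟨fourierSchwartz φ, φ, h, fourierSchwartz_apply φ⟩

@[simp] lemma momentum_ofMomentum (φ : 𝓢(ℝ × ℝ, ℂ)) (h : φ ∈ schwartzCompact) :
    momentum (ofMomentum φ h).1 = φ := momentum_fourierSchwartz φ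

lemma mem_schwartzCompact_iff (φ : 𝓢(ℝ × ℝ, ℂ)) :
    φ ∈ schwartzCompact ↔ ∃ R : ℝ, 0 ≤ R ∧ ∀ p : ℝ × ℝ, R < |p.1| → φ p = 0 := by
  constructor
  · rintro ⟨K, hK, h⟩
    obtain ⟨R, hR⟩ := hK.isBounded.exists_norm_le
    refine ⟨max R 0, le_max_right _ _, fun p hp => ?_⟩
    by_contra h0
    exact absurd (hR p.1 (h (subset_tsupport _ h0)).1)
      (not_le.2 ((le_max_left _ _).trans_lt hp))
  · rintro ⟨R, -, hR⟩
    refine ⟨Metric.closedBall 0 R, isCompact_closedBall _ _, ?_⟩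
    refine closure_minimal (fun p hp => ⟨?_, trivial⟩)
      (Metric.isClosed_closedBall.prod isClosed_univ)
    rw [mem_closedBall_zero_iff, Real.norm_eq_abs]
    by_contra h
    exact hp (hR p (not_le.1 h))

/-- Multiplication by a smooth function of the first variable preserves `schwartzCompact`. -/
lemma exists_mul_fst {m : ℝ → ℂ} (hm : ContDiff ℝ ∞ m) {φ : 𝓢(ℝ × ℝ, ℂ)}
    (hφ : φ ∈ schwartzCompact) :
    ∃ ψ ∈ schwartzCompact, ∀ p, ψ p = m p.1 * φ p := by
  obtain ⟨R, hR0, hR⟩ := (mem_schwartzCompact_iff φ).1 hφ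
  -- The multipliers of interest are exponentials, which are not of temperate growth. Cutting off
  -- outside the strip that carries `φ` does not change the product; `R + 1` keeps the inner radius
  -- positive when `R = 0`.
  let χ : ContDiffBump (0 : ℝ) := ⟨R + 1, R + 2, by linarith, by linarith⟩
  have h1 : HasCompactSupport fun p : ℝ => (χ p : ℂ) * m p :=
    HasCompactSupport.mul_right (χ.hasCompactSupport.comp_left (g := ((↑) : ℝ → ℂ)) rfl)
  have h2 : ContDiff ℝ ∞ fun p : ℝ => (χ p : ℂ) * m p :=
    (ofRealCLM.contDiff.comp χ.contDiff).mul hm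
  have h3 : (fun p : ℝ × ℝ => (χ p.1 : ℂ) * m p.1).HasTemperateGrowth :=
    (h1.hasTemperateGrowth h2).comp (ContinuousLinearMap.fst ℝ ℝ ℝ).hasTemperateGrowth
  have h4 : ∀ p, smulLeftCLM ℂ (fun p : ℝ × ℝ => (χ p.1 : ℂ) * m p.1) φ p = m p.1 * φ p := by
    intro p
    rw [smulLeftCLM_apply_apply h3, smul_eq_mul]
    by_cases hp : R < |p.1|
    · rw [hR p hp, mul_zero, mul_zero]
    · rw [χ.one_of_mem_closedBall]
      · simp
      · rw [mem_closedBall_zero_iff, Real.norm_eq_abs]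
        change |p.1| ≤ R + 1
        linarith
  refine ⟨_, (mem_schwartzCompact_iff _).2 ⟨R, hR0, fun p hp => ?_⟩, h4⟩
  rw [h4, hR p hp, mul_zero]

lemma exists_slice (φ : 𝓢(ℝ × ℝ, ℂ)) (p : ℝ) : ∃ u : 𝓢(ℝ, ℂ), ∀ y, u y = φ (p, y) := by
  have h1 : (fun y : ℝ => (p, y)).HasTemperateGrowth := by
    have h : (fun y : ℝ => (p, y)) =
        fun y => ((p, 0) : ℝ × ℝ) + ContinuousLinearMap.inr ℝ ℝ ℝ y := by ext <;> simp
    rw [h]; fun_prop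
  have h2 : AntilipschitzWith 1 (fun y : ℝ => (p, y)) :=
    AntilipschitzWith.of_le_mul_dist fun x y => by simp [Prod.dist_eq]
  exact ⟨compCLMOfAntilipschitz ℂ h1 h2 φ, fun y => rfl⟩

/-- Transforming in the first variable undoes half of the plane transform and leaves the
one-dimensional transform in the second. The sign in `-p` appears because both transforms use the
phase `e^{-i…}`. -/
lemma partialFourier_eq (f : algA) (p x : ℝ) :
    partialFourier f.1 p x = ∫ y : ℝ, exp (-I * x * y) * momentum f.1 (-p, y) := by
  set φ := momentum f.1 with hφ
  obtain ⟨R, -, hz⟩ := (mem_schwartzCompact_iff φ).1 (momentum_mem f)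
  let σ : 𝓢(ℝ × ℝ, ℂ) := SchwartzMap.compCLMOfContinuousLinearEquiv ℂ
    (ContinuousLinearEquiv.prodComm ℝ ℝ ℝ) φ
  have hσ : ∀ q, σ q = φ (q.2, q.1) := fun q => rfl
  let k : ℝ → ℂ := fun q => (1 / (2 * Real.pi)) * partialFourier σ x (-q)
  have hk : ContDiff ℝ ∞ k := by
    have h : ContDiff ℝ ∞ (fun q : ℝ × ℝ => partialFourier σ q.1 q.2) :=
      contDiff_infty.2 fun n => contDiff_partialFourier n σ
    exact contDiff_const.mul (h.comp (contDiff_const.prodMk contDiff_neg))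
  have hs : HasCompactSupport k := by
    refine HasCompactSupport.of_support_subset_isCompact (isCompact_closedBall (0 : ℝ) R) ?_
    intro q hq
    rw [mem_closedBall_zero_iff, Real.norm_eq_abs]
    by_contra h
    refine hq ?_
    simp only [k, partialFourier, hσ]
    simp [hz (-q, _) (show R < |-q| by rwa [abs_neg, ← not_le])]
  have hfk : ∀ y : ℝ, f.1 (y, x) = ∫ q : ℝ, exp (I * q * y) * k q := fun y => by
    rw [algA_apply, fourier₂, Measure.volume_eq_prod, integral_prod _ (integrable_fourier₂ φ (y, x)),
      ← integral_const_mul, ← integral_neg_eq_self]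
    congr 1; funext q
    simp only [k, partialFourier, hσ]
    rw [mul_left_comm (exp _), ← integral_const_mul (exp _)]
    congr 2; funext t
    rw [← mul_assoc, ← exp_add]
    congr 2
    push_cast; ring
  have := inversion hk hs p
  simp only [← hfk] at this
  rw [partialFourier, this]
  simp only [k, partialFourier, hσ]
  rw [← mul_assoc, mul_one_div_cancel two_pi_ne_zero', one_mul]

/-- Plancherel's theorem for the Fourier integral without `2π` in the exponent. -/
lemma plancherel (u v : 𝓢(ℝ, ℂ)) :
    ∫ x : ℝ, conj (∫ y : ℝ, exp (-I * x * y) * u y) * ∫ y : ℝ, exp (-I * x * y) * v y =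
      2 * Real.pi * ∫ y : ℝ, conj (u y) * v y := by
  have h1 : ∀ (u : 𝓢(ℝ, ℂ)) (x : ℝ), ∫ y : ℝ, exp (-I * x * y) * u y =
      FourierTransform.fourier u (x / (2 * Real.pi)) := fun u x => by
    rw [SchwartzMap.fourier_coe, Real.fourier_eq']
    congr 1; funext q
    simp only [smul_eq_mul]
    congr 2
    have : (Real.pi : ℂ) ≠ 0 := by exact_mod_cast Real.pi_ne_zero
    simp; field_simp
  simp only [h1]
  have h3 := Measure.integral_comp_div (fun t : ℝ => conj (FourierTransform.fourier u t) *
    FourierTransform.fourier v t) (2 * Real.pi)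
  rw [abs_of_pos (by positivity)] at h3
  rw [h3, Complex.real_smul]
  push_cast
  congr 1
  have := SchwartzMap.integral_inner_fourier_fourier u v
  simp only [RCLike.inner_apply'] at this
  exact this

lemma integrable_conj_mul (u v : 𝓢(ℝ × ℝ, ℂ)) : Integrable fun p => conj (u p) * v p :=
  MemLp.integrable_mul (p := 2) (q := 2) (u.memLp 2 volume).star (v.memLp 2 volume)

/-- The momentum space form of the inner product of `ℋ_r`. -/
lemma inner_toHilbert_eq (l : ℝ) (f g : algA) :
    inner ℂ (toHilbert l f) (toHilbert l g) =
      ∫ p : ℝ × ℝ, exp (l * p.1) * (conj (momentum f.1 p) * momentum g.1 p) := by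
  obtain ⟨hi, hw⟩ := weight_formula l f g
  rw [inner_toHilbert, hw, Measure.volume_eq_prod, integral_prod_symm _ hi]
  have hint : Integrable (fun p : ℝ × ℝ =>
      exp (l * p.1) * (conj (momentum f.1 p) * momentum g.1 p)) := by
    obtain ⟨ψ, -, hψ⟩ := exists_mul_fst (m := fun p => exp (l * p))
      ((contDiff_const.mul ofRealCLM.contDiff).cexp) (momentum_mem f)
    refine (integrable_conj_mul ψ (momentum g.1)).congr (ae_of_all _ fun p => ?_)
    simp only [hψ, map_mul, ← exp_conj, conj_ofReal, mul_assoc]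
  rw [Measure.volume_eq_prod] at hint
  rw [integral_prod _ hint, ← integral_const_mul]
  congr 1; funext p
  -- The Jacobian of `x ↦ e^{-λp} x` is the source of the weight `e^{λp}`; the `2π` of Plancherel
  -- cancels the prefactor.
  have h1 := Measure.integral_comp_mul_left (fun x : ℝ => conj (partialFourier f.1 (-p) x) *
    partialFourier g.1 (-p) x) (Real.exp (-l * p))
  obtain ⟨u, hu⟩ := exists_slice (momentum f.1) p
  obtain ⟨v, hv⟩ := exists_slice (momentum g.1) p
  simp only [innerDensity]
  rw [h1]
  simp only [partialFourier_eq, neg_neg, ← hu, ← hv]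
  rw [plancherel, integral_const_mul, abs_of_pos (by positivity), ← Real.exp_neg, real_smul]
  push_cast
  have := two_pi_ne_zero'
  field_simp

/-! ### The Hilbert space `ℋ_r` as `L²` of momentum space. -/

/-- The space `L²(ℝ²)`. -/
abbrev L2Plane : Type := Lp ℂ 2 (volume : Measure (ℝ × ℝ))

lemma exists_wave (l : ℝ) (f : algA) :
    ∃ ψ ∈ schwartzCompact, ∀ p, ψ p = exp (l * p.1 / 2) * momentum f.1 p :=
  exists_mul_fst (m := fun p => exp (l * p / 2))
    ((contDiff_const.mul ofRealCLM.contDiff).div_const 2).cexp (momentum_mem f)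

/-- The wave function `e^{λ p₀ / 2} φ(p)` of `f = 𝓕 φ`. -/
def waveFun (l : ℝ) (f : algA) : 𝓢(ℝ × ℝ, ℂ) := (exists_wave l f).choose

lemma waveFun_apply (l : ℝ) (f : algA) (p : ℝ × ℝ) :
    waveFun l f p = exp (l * p.1 / 2) * momentum f.1 p := (exists_wave l f).choose_spec.2 p

/-- `waveFun` as a linear map. -/
def wave (l : ℝ) : algA →ₗ[ℂ] 𝓢(ℝ × ℝ, ℂ) where
  toFun := waveFun l
  map_add' f g := by
    ext p
    simp only [_root_.add_apply, waveFun_apply, Submodule.coe_add, map_add, mul_add]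
  map_smul' c f := by
    ext p
    simp only [_root_.smul_apply, waveFun_apply, Submodule.coe_smul, map_smul,
      smul_eq_mul, RingHom.id_apply, mul_left_comm]

lemma wave_apply (l : ℝ) (f : algA) (p : ℝ × ℝ) :
    wave l f p = exp (l * p.1 / 2) * momentum f.1 p := waveFun_apply l f p

lemma wave_mem (l : ℝ) (f : algA) : wave l f ∈ schwartzCompact := (exists_wave l f).choose_spec.1

/-- The factor `e^{λp₀/2}` can be divided out inside `schwartzCompact`. -/
lemma exists_wave_eq (l : ℝ) {φ : 𝓢(ℝ × ℝ, ℂ)} (hφ : φ ∈ schwartzCompact) :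
    ∃ f : algA, wave l f = φ := by
  obtain ⟨ψ, hψ, h⟩ := exists_mul_fst (m := fun p => exp (-(l * p / 2)))
    ((contDiff_const.mul ofRealCLM.contDiff).div_const 2).neg.cexp hφ
  refine ⟨ofMomentum ψ hψ, ?_⟩
  ext p
  rw [wave_apply, momentum_ofMomentum, h, ← mul_assoc, ← exp_add, add_neg_cancel, exp_zero, one_mul]

/-- The wave function as a vector of `L²(ℝ²)`. -/
def waveLp (l : ℝ) : algA →ₗ[ℂ] L2Plane := (toLpCLM ℂ ℂ 2 (volume : Measure (ℝ × ℝ))).toLinearMap ∘ₗ wave l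

lemma coeFn_waveLp (l : ℝ) (f : algA) : waveLp l f =ᵐ[volume] wave l f := (wave l f).coeFn_toLp 2 volume

lemma coe_smul_completion {E : Type} [SeminormedAddCommGroup E] [InnerProductSpace ℂ E] (c : ℂ)
    (f : E) : ((c • f : E) : UniformSpace.Completion E) = c • (f : UniformSpace.Completion E) :=
  UniformSpace.Completion.coe_smul c f

/-- `toHilbert` as a linear map. -/
def toHilbertₗ (l : ℝ) : algA →ₗ[ℂ] ReducedHilbert l where
  toFun := toHilbert l
  map_add' f g := UniformSpace.Completion.coe_add (α := PreHilbert l) f g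
  map_smul' c f := coe_smul_completion (E := PreHilbert l) c f

lemma toHilbertₗ_apply (l : ℝ) (f : algA) : toHilbertₗ l f = toHilbert l f := rfl

/-- The weight `e^{λp₀}` splits into two factors `e^{λp₀/2}`, one absorbed by each wave function. -/
lemma inner_waveLp (l : ℝ) (f g : algA) :
    inner ℂ (waveLp l f) (waveLp l g) = inner ℂ (toHilbert l f) (toHilbert l g) := by
  rw [inner_toHilbert_eq, L2.inner_def]
  refine integral_congr_ae ?_
  filter_upwards [coeFn_waveLp l f, coeFn_waveLp l g] with p h1 h2
  have h3 : (l * p.1 : ℂ) = l * p.1 / 2 + l * p.1 / 2 := by ring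
  rw [h1, h2, RCLike.inner_apply', wave_apply, wave_apply, map_mul, ← exp_conj]
  simp only [map_div₀, map_mul, conj_ofReal, map_ofNat]
  rw [h3, exp_add]
  ring_nf

lemma norm_waveLp (l : ℝ) (f : algA) : ‖waveLp l f‖ = ‖toHilbert l f‖ := by
  rw [@norm_eq_sqrt_re_inner ℂ, @norm_eq_sqrt_re_inner ℂ, inner_waveLp]

lemma denseRange_toHilbert (l : ℝ) : DenseRange (toHilbertₗ l) :=
  UniformSpace.Completion.denseRange_coe (α := PreHilbert l)

/-- The elements of `𝒜` whose momentum space functions have compact support. -/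
def algCompact : Set algA := {f | HasCompactSupport (momentum f.1)}

/-- The source of elements of `𝒜` with prescribed wave function: it serves density, resolvents, test
functions and the hermitian element. -/
lemma exists_waveLp_eq (l : ℝ) {g : ℝ × ℝ → ℂ} (hs : HasCompactSupport g) (hg : ContDiff ℝ ∞ g) :
    ∃ f ∈ algCompact, ∀ p, wave l f p = g p := by
  have hφ : hs.toSchwartzMap hg ∈ schwartzCompact :=
    ⟨Prod.fst '' tsupport g, hs.isCompact.image continuous_fst, fun p hp => ⟨⟨p, hp, rfl⟩, trivial⟩⟩
  obtain ⟨f, hf⟩ := exists_wave_eq l hφ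
  have hf' : ∀ p, wave l f p = g p := fun p => by rw [hf]; rfl
  refine ⟨f, hs.mono fun p hp => ?_, hf'⟩
  rw [Function.mem_support, ← hf', wave_apply]
  exact mul_ne_zero (exp_ne_zero _) hp

lemma dense_waveLp_algCompact (l : ℝ) : Dense (waveLp l '' algCompact) := by
  refine (Lp.dense_hasCompactSupport_contDiff (F := ℂ) (μ := (volume : Measure (ℝ × ℝ)))
    (p := 2) ENNReal.ofNat_ne_top).mono ?_
  rintro u ⟨g, hu, hs, hg⟩
  obtain ⟨f, hf, h⟩ := exists_waveLp_eq l hs hg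
  refine ⟨f, hf, Lp.ext ?_⟩
  filter_upwards [hu, coeFn_waveLp l f] with p h1 h2
  rw [h1, h2, h]

lemma exists_isometryEquiv {A H K : Type} [AddCommGroup A] [Module ℂ A]
    [NormedAddCommGroup H] [NormedSpace ℂ H] [CompleteSpace H]
    [NormedAddCommGroup K] [NormedSpace ℂ K] [CompleteSpace K]
    (e₁ : A →ₗ[ℂ] H) (e₂ : A →ₗ[ℂ] K) (h₁ : DenseRange e₁) (h₂ : DenseRange e₂)
    (h : ∀ a, ‖e₂ a‖ = ‖e₁ a‖) : ∃ V : H ≃ₗᵢ[ℂ] K, ∀ a, V (e₁ a) = e₂ a :=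
  ⟨(LinearEquiv.refl ℂ A).extendOfIsometry e₁ e₂ h₁ h₂ h, fun a =>
    LinearMap.extendOfNorm_eq (f := e₂ ∘ₗ (LinearEquiv.refl ℂ A).toLinearMap) h₁
      ⟨1, fun x => by rw [one_mul]; exact (h x).le⟩ a⟩

lemma exists_toL2 (l : ℝ) :
    ∃ V : ReducedHilbert l ≃ₗᵢ[ℂ] L2Plane, ∀ f, V (toHilbertₗ l f) = waveLp l f :=
  exists_isometryEquiv (toHilbertₗ l) (waveLp l) (denseRange_toHilbert l)
    ((dense_waveLp_algCompact l).mono (Set.image_subset_range _ _)) (norm_waveLp l)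

/-- The unitary from `ℋ_r` onto `L²(ℝ²)`. -/
def toL2 (l : ℝ) : ReducedHilbert l ≃ₗᵢ[ℂ] L2Plane := (exists_toL2 l).choose

lemma toL2_toHilbert (l : ℝ) (f : algA) : toL2 l (toHilbert l f) = waveLp l f :=
  (exists_toL2 l).choose_spec f

lemma dense_toHilbert_algCompact (l : ℝ) : Dense (toHilbert l '' algCompact) := by
  have h := (toL2 l).symm.surjective.denseRange.dense_image (toL2 l).symm.continuous
    (dense_waveLp_algCompact l)
  rw [Set.image_image] at h
  convert h using 2
  exact ((toL2 l).symm_apply_eq.2 (toL2_toHilbert l _).symm).symm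

/-! ### The star product as a twisted convolution, and its kernel. -/

/-- The integrand of the momentum space form of the star product. -/
def twistedIntegrand (l : ℝ) (φ ψ : ℝ × ℝ → ℂ) (p q : ℝ × ℝ) : ℂ :=
  exp (-l * q.1) * φ q * ψ (p.1 - q.1, Real.exp (-l * q.1) * (p.2 - q.2))

/-- The integrand is a tensor product of Schwartz functions composed with a change of variables of
temperate growth. The exponential dilation in it matters only where `φ` lives, so it can be replaced
by a tame function elsewhere. -/
lemma exists_twistedIntegrand (l : ℝ) {φ ψ : 𝓢(ℝ × ℝ, ℂ)} (hφ : φ ∈ schwartzCompact) :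
    ∃ u : 𝓢((ℝ × ℝ) × (ℝ × ℝ), ℂ), ∀ p q, u (p, q) = twistedIntegrand l φ ψ p q := by
  obtain ⟨φ', hφ', hφe⟩ := exists_mul_fst (m := fun p => exp (-l * p))
    ((contDiff_const.mul ofRealCLM.contDiff).cexp) hφ
  obtain ⟨R, hR0, hR⟩ := (mem_schwartzCompact_iff φ).1 hφ
  let χ : ContDiffBump (0 : ℝ) := ⟨R + 1, R + 2, by linarith, by linarith⟩
  -- Cutting off inside the exponent makes `a` equal to `1` far out, with `a` and `a⁻¹` both
  -- bounded; multiplying the exponential by `χ` would lose the bound on `a⁻¹`.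
  let a : ℝ → ℝ := fun q => Real.exp (-l * (q * χ q))
  have ha0 : HasCompactSupport (fun q => a q - 1) := by
    have : HasCompactSupport fun q : ℝ => q * χ q := χ.hasCompactSupport.mul_left
    exact this.comp_left (g := fun t => Real.exp (-l * t) - 1) (by simp)
  have hac : ContDiff ℝ ∞ a := by
    have : ContDiff ℝ ∞ χ := χ.contDiff
    simp only [a]; fun_prop
  have hat : a.HasTemperateGrowth := by
    have h : a = fun q => (a q - 1) + 1 := by funext q; ring
    rw [h]
    exact (ha0.hasTemperateGrowth (hac.sub contDiff_const)).add (.const 1)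
  obtain ⟨M, hM⟩ : ∃ M : ℝ, ∀ q, (a q)⁻¹ ≤ M := by
    have hc : Continuous fun q => (a q)⁻¹ - 1 :=
      (hac.continuous.inv₀ fun q => (Real.exp_pos _).ne').sub continuous_const
    have hs : HasCompactSupport fun q => (a q)⁻¹ - 1 :=
      ha0.mono' (fun q hq => subset_tsupport _ (by
        contrapose! hq
        simp only [Function.mem_support, not_not] at hq ⊢
        rw [sub_eq_zero.1 hq, inv_one, sub_self]))
    obtain ⟨C, hC⟩ := hs.exists_bound_of_continuous hc
    exact ⟨C + 1, fun q => by linarith [(le_abs_self _).trans (hC q)]⟩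
  have ha_eq : ∀ q : ℝ, |q| ≤ R → a q = Real.exp (-l * q) := fun q hq => by
    simp only [a]
    rw [χ.one_of_mem_closedBall, mul_one]
    rw [mem_closedBall_zero_iff, Real.norm_eq_abs]
    change |q| ≤ R + 1
    linarith
  obtain ⟨t, ht⟩ := exists_schwartz_tensor φ' ψ
  let G : (ℝ × ℝ) × (ℝ × ℝ) → (ℝ × ℝ) × (ℝ × ℝ) := fun z =>
    (z.2, (z.1.1 - z.2.1, a z.2.1 * (z.1.2 - z.2.2)))
  have hG : G.HasTemperateGrowth := by
    let P1 := ContinuousLinearMap.fst ℝ ℝ ℝ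
    let P2 := ContinuousLinearMap.snd ℝ ℝ ℝ
    let A := ContinuousLinearMap.fst ℝ (ℝ × ℝ) (ℝ × ℝ)
    let B := ContinuousLinearMap.snd ℝ (ℝ × ℝ) (ℝ × ℝ)
    let L : (ℝ × ℝ) × (ℝ × ℝ) →L[ℝ] (ℝ × ℝ) × (ℝ × ℝ) :=
      B.prod ((P1 ∘L A - P1 ∘L B).prod 0)
    have h : G = fun z => L z + (a ((P1 ∘L B) z) * (P2 ∘L A - P2 ∘L B) z) •
        (((0, 0), (0, 1)) : (ℝ × ℝ) × (ℝ × ℝ)) := by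
      funext z
      simp [G, L, P1, P2, A, B]
    rw [h]
    have h1 : (fun z => a ((P1 ∘L B) z)).HasTemperateGrowth :=
      hat.comp (P1 ∘L B).hasTemperateGrowth
    exact L.hasTemperateGrowth.add
      ((h1.mul (P2 ∘L A - P2 ∘L B).hasTemperateGrowth).smul (.const _))
  -- Decay survives composition with `G` because `z` is recovered from `G z` with linear bounds;
  -- undoing the dilation costs the bound `M` on `a⁻¹`.
  have hGu : ∃ (k : ℕ) (C : ℝ), ∀ z, ‖z‖ ≤ C * (1 + ‖G z‖) ^ k := by
    have hM0 : 0 ≤ M := (inv_nonneg.2 (Real.exp_pos _).le).trans (hM 0)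
    refine ⟨1, 2 + M, fun z => ?_⟩
    set N := ‖G z‖
    have n0 : 0 ≤ N := norm_nonneg _
    have n1 : ‖z.2‖ ≤ N := norm_fst_le (G z)
    have n11 : |z.2.1| ≤ N := (norm_fst_le z.2).trans n1
    have n12 : |z.2.2| ≤ N := (norm_snd_le z.2).trans n1
    have n2 : ‖(z.1.1 - z.2.1, a z.2.1 * (z.1.2 - z.2.2))‖ ≤ N := norm_snd_le (G z)
    have n21 : |z.1.1 - z.2.1| ≤ N := (norm_fst_le (_, _)).trans n2
    have n22 : |a z.2.1 * (z.1.2 - z.2.2)| ≤ N := (norm_snd_le (_, _)).trans n2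
    have hpos : 0 < a z.2.1 := Real.exp_pos _
    have n3 : |z.1.2 - z.2.2| ≤ M * N := by
      rw [abs_mul, abs_of_pos hpos] at n22
      calc |z.1.2 - z.2.2| = (a z.2.1)⁻¹ * (a z.2.1 * |z.1.2 - z.2.2|) := by field_simp
        _ ≤ M * N := mul_le_mul (hM _) n22 (by positivity) hM0
    have m1 : |z.1.1| ≤ 2 * N := by
      have := abs_add_le (z.1.1 - z.2.1) z.2.1
      rw [sub_add_cancel] at this
      linarith
    have m2 : |z.1.2| ≤ (1 + M) * N := by
      have := abs_add_le (z.1.2 - z.2.2) z.2.2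
      rw [sub_add_cancel] at this
      linarith
    have hle : ∀ c, c ≤ 2 + M → c * N ≤ (2 + M) * (1 + N) ^ 1 := fun c hc => by
      rw [pow_one]
      nlinarith
    simp only [Prod.norm_def, Real.norm_eq_abs] at n1 ⊢
    refine max_le (max_le (m1.trans (hle _ (by linarith))) (m2.trans (hle _ (by linarith))))
      (n1.trans ?_)
    simpa using hle 1 (by linarith)
  refine ⟨compCLM ℂ hG hGu t, fun p q => ?_⟩
  rw [compCLM_apply, Function.comp_apply, ht, hφe, twistedIntegrand]
  by_cases hq : |q.1| ≤ R
  · simp only [G]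
    rw [ha_eq _ hq]
  · have : φ q = 0 := hR q (not_le.1 hq)
    simp [G, this]

lemma exists_twistedConv (l : ℝ) {φ ψ : 𝓢(ℝ × ℝ, ℂ)} (hφ : φ ∈ schwartzCompact)
    (hψ : ψ ∈ schwartzCompact) :
    ∃ u ∈ schwartzCompact, ∀ p, u p = (1 / (2 * Real.pi)) * ∫ q, twistedIntegrand l φ ψ p q := by
  obtain ⟨t, ht⟩ := exists_twistedIntegrand l (ψ := ψ) hφ
  obtain ⟨v, hv⟩ := exists_schwartz_integral volume t
  obtain ⟨R, hR0, hR⟩ := (mem_schwartzCompact_iff φ).1 hφ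
  obtain ⟨S, hS0, hS⟩ := (mem_schwartzCompact_iff ψ).1 hψ
  have h : ∀ p, ((1 / (2 * Real.pi) : ℂ) • v) p =
      (1 / (2 * Real.pi)) * ∫ q, twistedIntegrand l φ ψ p q := fun p => by
    simp only [_root_.smul_apply, hv, smul_eq_mul, ht]
  refine ⟨(1 / (2 * Real.pi) : ℂ) • v, (mem_schwartzCompact_iff _).2
    ⟨R + S, by positivity, fun p hp => ?_⟩, h⟩
  rw [h, integral_eq_zero_of_ae, mul_zero]
  refine ae_of_all _ fun q => ?_
  rw [Pi.zero_apply, twistedIntegrand]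
  by_cases hq : R < |q.1|
  · rw [hR q hq, mul_zero, zero_mul]
  · rw [hS (p.1 - q.1, _), mul_zero]
    have := abs_add_le (p.1 - q.1) q.1
    rw [sub_add_cancel] at this
    change S < |p.1 - q.1|
    linarith [not_lt.1 hq]

lemma map_affine (q : ℝ × ℝ) {a : ℝ} (ha : 0 < a) :
    Measure.map (fun p : ℝ × ℝ => (p.1 - q.1, a * (p.2 - q.2))) volume =
      ENNReal.ofReal a⁻¹ • (volume : Measure (ℝ × ℝ)) := by
  have h1 : Measure.map (fun x : ℝ => x - q.1) volume = volume :=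
    (measurePreserving_sub_right volume q.1).map_eq
  have h2 : Measure.map (fun x : ℝ => a * (x - q.2)) volume = ENNReal.ofReal a⁻¹ • volume := by
    have h3 : (fun x : ℝ => a * (x - q.2)) = (fun x => a * x) ∘ fun x => x - q.2 := rfl
    rw [h3, ← Measure.map_map (by fun_prop) (by fun_prop),
      (measurePreserving_sub_right volume q.2).map_eq, Real.map_volume_mul_left ha.ne',
      abs_of_pos (inv_pos.2 ha)]
  have h4 : (fun p : ℝ × ℝ => (p.1 - q.1, a * (p.2 - q.2))) =
      Prod.map (fun x => x - q.1) fun x => a * (x - q.2) := rfl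
  rw [Measure.volume_eq_prod, h4, ← Measure.map_prod_map _ _ (by fun_prop) (by fun_prop), h1, h2,
    Measure.prod_smul_right]

lemma integral_comp_affine (q : ℝ × ℝ) {a : ℝ} (ha : 0 < a) {F : ℝ × ℝ → ℂ} (hF : Continuous F) :
    ∫ p : ℝ × ℝ, F (p.1 - q.1, a * (p.2 - q.2)) = (a⁻¹ : ℝ) * ∫ p, F p := by
  have h := integral_map (μ := volume) (φ := fun p : ℝ × ℝ => (p.1 - q.1, a * (p.2 - q.2)))
    (by fun_prop) hF.aestronglyMeasurable
  rw [← h, map_affine q ha, integral_smul_measure, ENNReal.toReal_ofReal (inv_pos.2 ha).le,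
    real_smul]

lemma integrable_schwartz_phase {E : Type} [NormedAddCommGroup E] [NormedSpace ℝ E]
    [MeasurableSpace E] [BorelSpace E] [SecondCountableTopology E] {μ : Measure E}
    [μ.HasTemperateGrowth] (u : 𝓢(E, ℂ)) {θ : E → ℂ} (hθ : Continuous θ) (h1 : ∀ x, ‖θ x‖ = 1) :
    Integrable (fun x => θ x * u x) μ := by
  refine (u.integrable (μ := μ)).norm.mono'
    (hθ.mul u.continuous).aestronglyMeasurable (ae_of_all _ fun x => ?_)
  rw [norm_mul, h1, one_mul]

instance : (volume : Measure ((ℝ × ℝ) × (ℝ × ℝ))).HasTemperateGrowth := by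
  have : (volume : Measure ((ℝ × ℝ) × (ℝ × ℝ))).IsAddHaarMeasure := by
    rw [Measure.volume_eq_prod]; infer_instance
  infer_instance

lemma norm_plane_phase (p x : ℝ × ℝ) : ‖exp (-I * (p.1 * x.1 + p.2 * x.2))‖ = 1 := by
  rw [show (-I * (p.1 * x.1 + p.2 * x.2) : ℂ) =
    ((-(p.1 * x.1 + p.2 * x.2) : ℝ) : ℂ) * I by push_cast; ring, norm_exp_ofReal_mul_I]

/-- Substitute `k = (p₀ - q₀, e^{-λq₀}(p₁ - q₁))`. The Jacobian is the exponential prefactor of the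
integrand, and the phase `p₁ x₁ = q₁ x₁ + k₁ e^{λq₀} x₁` transfers the dilation to `x₁`. -/
lemma integral_twistedIntegrand (l : ℝ) (φ ψ : 𝓢(ℝ × ℝ, ℂ)) (x q : ℝ × ℝ) :
    ∫ p : ℝ × ℝ, exp (-I * (p.1 * x.1 + p.2 * x.2)) * twistedIntegrand l φ ψ p q =
      exp (-I * (q.1 * x.1 + q.2 * x.2)) * φ q *
        (2 * Real.pi * fourier₂ ψ (x.1, Real.exp (l * q.1) * x.2)) := by
  have hψ := ψ.continuous
  have h := integral_comp_affine q (Real.exp_pos (-l * q.1)) (F := fun k =>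
    exp (-I * (k.1 * x.1 + k.2 * (Real.exp (l * q.1) * x.2 : ℝ))) * ψ k) (by fun_prop)
  rw [fourier₂, ← mul_assoc (2 * Real.pi : ℂ), mul_one_div_cancel two_pi_ne_zero', one_mul]
  have h2 : ∫ k : ℝ × ℝ, exp (-I * (k.1 * x.1 + k.2 * (Real.exp (l * q.1) * x.2 : ℝ))) * ψ k =
      Real.exp (-l * q.1) * ∫ p : ℝ × ℝ, exp (-I * ((p.1 - q.1 : ℝ) * x.1 +
        (Real.exp (-l * q.1) * (p.2 - q.2) : ℝ) * (Real.exp (l * q.1) * x.2 : ℝ))) *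
          ψ (p.1 - q.1, Real.exp (-l * q.1) * (p.2 - q.2)) := by
    rw [h, ← mul_assoc, ← ofReal_mul, mul_inv_cancel₀ (Real.exp_pos _).ne', ofReal_one, one_mul]
  rw [h2, ← integral_const_mul, ← integral_const_mul]
  congr 1; funext p
  have he : (Real.exp (-l * q.1) : ℂ) * Real.exp (l * q.1) = 1 := by
    rw [← ofReal_mul, ← Real.exp_add]; simp
  have h3 : exp (-I * (p.1 * x.1 + p.2 * x.2)) = exp (-I * (q.1 * x.1 + q.2 * x.2)) *
      exp (-I * ((p.1 - q.1 : ℝ) * x.1 +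
        (Real.exp (-l * q.1) * (p.2 - q.2) : ℝ) * (Real.exp (l * q.1) * x.2 : ℝ))) := by
    rw [← exp_add]
    congr 1
    push_cast at he ⊢
    linear_combination I * (p.2 - q.2) * x.2 * he
  rw [h3, twistedIntegrand]
  push_cast
  ring

/-- The star product in momentum space. -/
lemma exists_starProd (l : ℝ) (f g : algA) :
    ∃ h : algA, (∀ x, h.1 x = starProd l f.1 g.1 x) ∧ ∀ p, momentum h.1 p =
      (1 / (2 * Real.pi)) * ∫ q, twistedIntegrand l (momentum f.1) (momentum g.1) p q := by
  set φ := momentum f.1 with hφ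
  set ψ := momentum g.1 with hψ
  obtain ⟨u, hu, hu'⟩ := exists_twistedConv l (momentum_mem f) (momentum_mem g)
  obtain ⟨t, ht⟩ := exists_twistedIntegrand l (ψ := ψ) (momentum_mem f)
  refine ⟨ofMomentum u hu, fun x => ?_, fun p => by rw [momentum_ofMomentum, hu']⟩
  rw [algA_apply, momentum_ofMomentum, fourier₂, starProd]
  congr 1
  have hint : Integrable (Function.uncurry fun p q : ℝ × ℝ =>
      exp (-I * (p.1 * x.1 + p.2 * x.2)) * twistedIntegrand l φ ψ p q) := by
    refine (integrable_schwartz_phase (μ := volume) t (θ := fun z : (ℝ × ℝ) × (ℝ × ℝ) =>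
      exp (-I * (z.1.1 * x.1 + z.1.2 * x.2))) (by fun_prop)
      fun z => norm_plane_phase z.1 x).congr (ae_of_all _ fun z => ?_)
    change _ * t (z.1, z.2) = _
    rw [ht]
    rfl
  have h1 : ∀ p : ℝ × ℝ, exp (-I * (p.1 * x.1 + p.2 * x.2)) * u p = (1 / (2 * Real.pi)) *
      ∫ q, exp (-I * (p.1 * x.1 + p.2 * x.2)) * twistedIntegrand l φ ψ p q := fun p => by
    rw [integral_const_mul, hu']; ring
  simp only [h1]
  rw [integral_const_mul, integral_integral_swap hint]
  have hint2 := hint.integral_prod_right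
  simp only [Function.uncurry, integral_twistedIntegrand] at hint2 ⊢
  -- The variable `p₀` of the star product is `-q₀`, by the sign in `partialFourier_eq`.
  rw [Measure.volume_eq_prod, integral_prod _ hint2, ← integral_neg_eq_self,
    ← integral_const_mul]
  congr 1; funext q
  rw [partialFourier_eq, ← integral_const_mul, ← integral_const_mul, ← integral_mul_const]
  congr 1; funext y
  have he : exp (-I * ((-q : ℝ) * x.1 + y * x.2)) =
      exp (I * q * x.1) * exp (-I * x.2 * y) := by
    rw [← exp_add]; congr 1; push_cast; ring
  rw [he, hψ, ← algA_apply, hφ, show l * (-q, y).1 = -l * q by simp]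
  field_simp [two_pi_ne_zero']

/-- The integral kernel on `L²(ℝ²)` of left multiplication by `f`. -/
def kernel (l : ℝ) (f : algA) (p k : ℝ × ℝ) : ℂ :=
  (1 / (2 * Real.pi)) * wave l f (p.1 - k.1, p.2 - Real.exp (l * (p.1 - k.1)) * k.2)

lemma continuous_kernel (l : ℝ) (f : algA) :
    Continuous fun z : (ℝ × ℝ) × (ℝ × ℝ) => kernel l f z.1 z.2 := by
  have := (wave l f).continuous
  unfold kernel
  fun_prop

/-- The column of the kernel at `k = 0` recovers the wave function; `eq_zero_of_star₀_self` rests on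
this. -/
lemma kernel_zero (l : ℝ) (f : algA) (p : ℝ × ℝ) :
    kernel l f p 0 = (1 / (2 * Real.pi)) * wave l f p := by simp [kernel]

/-- A square integrable weight on the plane. -/
def planeWeight (k : ℝ × ℝ) : ℝ := (1 + k.1 ^ 2)⁻¹ * (1 + k.2 ^ 2)⁻¹

lemma planeWeight_pos (k : ℝ × ℝ) : 0 < planeWeight k := by unfold planeWeight; positivity

lemma planeWeight_le_one (k : ℝ × ℝ) : planeWeight k ≤ 1 := by
  unfold planeWeight
  exact mul_le_one₀ (inv_le_one_of_one_le₀ (by nlinarith [sq_nonneg k.1])) (by positivity)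
    (inv_le_one_of_one_le₀ (by nlinarith [sq_nonneg k.2]))

lemma continuous_planeWeight : Continuous planeWeight := by
  unfold planeWeight
  refine Continuous.mul ?_ ?_ <;> refine Continuous.inv₀ (by fun_prop) fun k => by positivity

lemma integrable_planeWeight : Integrable planeWeight :=
  integrable_inv_one_add_sq.mul_prod integrable_inv_one_add_sq

lemma memLp_planeWeight : MemLp planeWeight 2 := by
  refine (memLp_two_iff_integrable_sq continuous_planeWeight.aestronglyMeasurable).2 ?_
  refine integrable_planeWeight.mono' (continuous_planeWeight.pow 2).aestronglyMeasurable
    (ae_of_all _ fun k => ?_)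
  have h1 := planeWeight_pos k
  have h2 := planeWeight_le_one k
  rw [Real.norm_of_nonneg (by positivity)]
  nlinarith

/-- A Peetre inequality, `1 + k² ≤ 2 (1 + p²)(1 + (p - k)²)`, turns decay of `w_f` into decay in `k`
at the price of polynomial growth in `p`. In the second variable the dilation costs only a constant,
because `|p₀ - k₀| ≤ R` on the support. -/
lemma kernel_bound (l : ℝ) (f : algA) : ∃ C : ℝ, 0 ≤ C ∧ ∀ p k : ℝ × ℝ,
    ‖kernel l f p k‖ ≤ C * ((1 + p.1 ^ 2) * (1 + p.2 ^ 2)) * planeWeight k := by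
  obtain ⟨R, hR0, hR⟩ := (mem_schwartzCompact_iff _).1 (wave_mem l f)
  obtain ⟨C, hC, hb⟩ := schwartz_bound (wave l f)
  let M := Real.exp (|l| * R)
  have hpi : ‖(1 / (2 * Real.pi) : ℂ)‖ ≤ 1 := by
    rw [show (1 / (2 * Real.pi) : ℂ) = ((1 / (2 * Real.pi) : ℝ) : ℂ) by push_cast; rfl, norm_real,
      Real.norm_of_nonneg (by positivity), div_le_one (by positivity)]
    linarith [Real.pi_gt_three]
  refine ⟨C * (2 * (1 + 2 * M ^ 2)), by positivity, fun p k => ?_⟩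
  rw [kernel, norm_mul]
  set P := p.1 - k.1 with hP
  set Q := p.2 - Real.exp (l * P) * k.2 with hQ
  by_cases h : R < |P|
  · rw [hR (P, Q) h, norm_zero, mul_zero]
    have := planeWeight_pos k
    positivity
  have h1 : 1 + k.1 ^ 2 ≤ 2 * ((1 + p.1 ^ 2) * (1 + P ^ 2)) := by
    have : k.1 = p.1 - P := by rw [hP]; ring
    rw [this]
    nlinarith [sq_nonneg (p.1 + P), sq_nonneg (p.1 * P)]
  have hM : Real.exp (-(l * P)) ≤ M := by
    refine Real.exp_le_exp.2 ((neg_le_abs _).trans ?_)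
    rw [abs_mul]
    exact mul_le_mul_of_nonneg_left (not_lt.1 h) (abs_nonneg _)
  have h2 : 1 + k.2 ^ 2 ≤ (1 + 2 * M ^ 2) * ((1 + p.2 ^ 2) * (1 + Q ^ 2)) := by
    have hk : k.2 = Real.exp (-(l * P)) * (p.2 - Q) := by
      rw [hQ, sub_sub_cancel, ← mul_assoc, ← Real.exp_add]; simp
    have h3 : k.2 ^ 2 ≤ M ^ 2 * (p.2 - Q) ^ 2 := by
      rw [hk, mul_pow]
      gcongr
    nlinarith [sq_nonneg (p.2 + Q), sq_nonneg (p.2 * Q), sq_nonneg M, mul_nonneg (sq_nonneg M)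
      (sq_nonneg (p.2 + Q)), mul_nonneg (sq_nonneg M) (sq_nonneg (p.2 * Q))]
  have h4 : (1 + P ^ 2)⁻¹ * (1 + Q ^ 2)⁻¹ ≤
      2 * (1 + 2 * M ^ 2) * ((1 + p.1 ^ 2) * (1 + p.2 ^ 2)) * planeWeight k := by
    unfold planeWeight
    rw [← mul_inv, ← mul_inv, inv_le_iff_one_le_mul₀ (by positivity), ← div_eq_mul_inv,
      mul_comm, mul_div_assoc', le_div_iff₀ (by positivity), one_mul]
    calc (1 + k.1 ^ 2) * (1 + k.2 ^ 2) ≤ 2 * ((1 + p.1 ^ 2) * (1 + P ^ 2)) *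
          ((1 + 2 * M ^ 2) * ((1 + p.2 ^ 2) * (1 + Q ^ 2))) := by gcongr
      _ = _ := by ring
  calc ‖(1 / (2 * Real.pi) : ℂ)‖ * ‖wave l f (P, Q)‖
      ≤ 1 * (C * ((1 + P ^ 2)⁻¹ * (1 + Q ^ 2)⁻¹)) :=
        mul_le_mul hpi (hb (P, Q)) (norm_nonneg _) zero_le_one
    _ ≤ 1 * (C * (2 * (1 + 2 * M ^ 2) * ((1 + p.1 ^ 2) * (1 + p.2 ^ 2)) * planeWeight k)) := by
        gcongr
    _ = _ := by ring

lemma memLp_kernel (l : ℝ) (f : algA) (p : ℝ × ℝ) : MemLp (kernel l f p) 2 := by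
  obtain ⟨C, -, h⟩ := kernel_bound l f
  refine (memLp_planeWeight.const_mul (C * ((1 + p.1 ^ 2) * (1 + p.2 ^ 2)))).of_le
    (Continuous.aestronglyMeasurable ?_) (ae_of_all _ fun k => (h p k).trans (le_abs_self _))
  exact (continuous_kernel l f).comp (by fun_prop : Continuous fun k : ℝ × ℝ => (p, k))

lemma kernel_bounded (l : ℝ) (f : algA) : ∃ C : ℝ, 0 ≤ C ∧ ∀ p k, ‖kernel l f p k‖ ≤ C := by
  obtain ⟨C, hC, hb⟩ := schwartz_bound (wave l f)
  refine ⟨‖(1 / (2 * Real.pi) : ℂ)‖ * C, by positivity, fun p k => ?_⟩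
  rw [kernel, norm_mul]
  refine mul_le_mul_of_nonneg_left ((hb _).trans ?_) (norm_nonneg _)
  exact mul_le_of_le_one_right hC (planeWeight_le_one _)

/-- A translation in the first coordinate and, over each value of it, a translation in the second.
The factorization of the Hilbert–Schmidt norm comes from this invariance. -/
lemma measurePreserving_shear (l : ℝ) (k : ℝ × ℝ) :
    MeasurePreserving fun p : ℝ × ℝ =>
      (p.1 - k.1, p.2 - Real.exp (l * (p.1 - k.1)) * k.2) := by
  rw [Measure.volume_eq_prod]
  exact MeasurePreserving.skew_product (g := fun a b => b - Real.exp (l * (a - k.1)) * k.2)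
    (measurePreserving_sub_right volume k.1) (by fun_prop)
    (ae_of_all _ fun a => (measurePreserving_sub_right volume _).map_eq)

lemma lintegral_kernel_sq (l : ℝ) (f : algA) (k : ℝ × ℝ) :
    ∫⁻ p, ‖kernel l f p k‖ₑ ^ 2 =
      ENNReal.ofReal (1 / (2 * Real.pi) ^ 2) * ∫⁻ p, ‖wave l f p‖ₑ ^ 2 := by
  have hc := (wave l f).continuous
  have hm : Continuous fun p : ℝ × ℝ =>
      ‖wave l f (p.1 - k.1, p.2 - Real.exp (l * (p.1 - k.1)) * k.2)‖ₑ ^ 2 := by fun_prop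
  rw [← (measurePreserving_shear l k).lintegral_comp (f := fun p => ‖wave l f p‖ₑ ^ 2)
    (by fun_prop), ← lintegral_const_mul _ hm.measurable]
  congr 1; funext p
  rw [kernel, enorm_mul, mul_pow]
  congr 1
  rw [show (1 / (2 * Real.pi) : ℂ) = ((1 / (2 * Real.pi) : ℝ) : ℂ) by push_cast; rfl,
    ← ofReal_norm, norm_real, Real.norm_of_nonneg (by positivity),
    ← ENNReal.ofReal_pow (by positivity), div_pow, one_pow]

lemma momentum_injective : Function.Injective (fun f : algA => momentum f.1) := fun f g h => by
  have h' : momentum f.1 = momentum g.1 := h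
  exact Subtype.ext (by rw [← fourierSchwartz_momentum f.1, h', fourierSchwartz_momentum])

lemma wave_injective (l : ℝ) : Function.Injective (wave l) := fun f g h => by
  refine momentum_injective (SchwartzMap.ext fun p => ?_)
  have := DFunLike.congr_fun h p
  rw [wave_apply, wave_apply] at this
  exact mul_left_cancel₀ (exp_ne_zero _) this

/-- Substitution `r = p₁ - e^{λq} k`; its Jacobian cancels the exponential in the integrand. -/
lemma integral_slice_twisted (l q p₀ p₁ : ℝ) (φ ψ : 𝓢(ℝ × ℝ, ℂ)) :
    ∫ r : ℝ, twistedIntegrand l φ ψ (p₀, p₁) (q, r) =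
      ∫ k : ℝ, φ (q, p₁ - Real.exp (l * q) * k) * ψ (p₀ - q, k) := by
  have h := Measure.integral_comp_mul_left (fun t : ℝ => φ (q, p₁ - t) *
    ψ (p₀ - q, Real.exp (-l * q) * t)) (Real.exp (l * q))
  have he : Real.exp (-l * q) * Real.exp (l * q) = 1 := by rw [← Real.exp_add]; simp
  simp only [← mul_assoc, he, one_mul] at h
  rw [h, abs_of_pos (by positivity), ← Real.exp_neg, real_smul, ← integral_const_mul,
    ← integral_sub_left_eq_self _ volume p₁]
  congr 1; funext r
  rw [twistedIntegrand, sub_sub_cancel]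
  push_cast
  simp only [neg_mul]
  ring

/-- The star product in terms of wave functions. -/
lemma wave_starProd (l : ℝ) (f g h : algA) (hh : ∀ p, momentum h.1 p =
      (1 / (2 * Real.pi)) * ∫ q, twistedIntegrand l (momentum f.1) (momentum g.1) p q)
    (p : ℝ × ℝ) : wave l h p = ∫ k, kernel l f p k * wave l g k := by
  obtain ⟨t, ht⟩ := exists_twistedIntegrand l (ψ := momentum g.1) (momentum_mem f)
  have h1 : Integrable fun q => twistedIntegrand l (momentum f.1) (momentum g.1) p q := by
    simp only [← ht]
    exact integrable_schwartz_slice volume t p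
  have h2 : Integrable fun k => kernel l f p k * wave l g k :=
    (memLp_kernel l f p).integrable_mul ((wave l g).memLp 2 volume)
  rw [wave_apply, hh]
  rw [Measure.volume_eq_prod] at h1 h2 ⊢
  rw [integral_prod _ h1, integral_prod _ h2]
  obtain ⟨p₀, p₁⟩ := p
  simp only [integral_slice_twisted]
  rw [← integral_sub_left_eq_self _ volume p₀, ← integral_const_mul, ← integral_const_mul]
  congr 1; funext q
  rw [← integral_const_mul, ← integral_const_mul]
  congr 1; funext k
  rw [kernel, wave_apply, wave_apply, sub_sub_cancel]
  -- The exponential is multiplicative along `p₀ = (p₀ - q) + q`, so it is used up by the two wave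
  -- functions and leaves no extra factor in the kernel.
  have he : exp (l * p₀ / 2) = exp (l * (p₀ - q : ℝ) / 2) * exp (l * q / 2) := by
    rw [← exp_add]; congr 1; push_cast; ring
  simp only [he]
  ring

/-- The star product as an operation on `𝒜`. -/
def star₀ (l : ℝ) (f g : algA) : algA := (exists_starProd l f g).choose

lemma star₀_apply (l : ℝ) (f g : algA) (x : ℝ × ℝ) : (star₀ l f g).1 x = starProd l f.1 g.1 x :=
  (exists_starProd l f g).choose_spec.1 x

lemma momentum_star₀ (l : ℝ) (f g : algA) (p : ℝ × ℝ) : momentum (star₀ l f g).1 p =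
    (1 / (2 * Real.pi)) * ∫ q, twistedIntegrand l (momentum f.1) (momentum g.1) p q :=
  (exists_starProd l f g).choose_spec.2 p

lemma wave_star₀ (l : ℝ) (f g : algA) (p : ℝ × ℝ) :
    wave l (star₀ l f g) p = ∫ k, kernel l f p k * wave l g k :=
  wave_starProd l f g _ (momentum_star₀ l f g) p

lemma integrable_kernel_mul (l : ℝ) (f g : algA) (p : ℝ × ℝ) :
    Integrable fun k => kernel l f p k * wave l g k :=
  (memLp_kernel l f p).integrable_mul ((wave l g).memLp 2 volume)

/-- Left multiplication by `f` on `𝒜`. -/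
def starMul (l : ℝ) (f : algA) : algA →ₗ[ℂ] algA where
  toFun := star₀ l f
  map_add' g h := wave_injective l <| SchwartzMap.ext fun p => by
    rw [map_add, _root_.add_apply, wave_star₀, wave_star₀, wave_star₀,
      ← integral_add (integrable_kernel_mul l f g p) (integrable_kernel_mul l f h p)]
    simp only [map_add, _root_.add_apply, mul_add]
  map_smul' c g := wave_injective l <| SchwartzMap.ext fun p => by
    rw [RingHom.id_apply, map_smul, _root_.smul_apply, wave_star₀, wave_star₀, smul_eq_mul,
      ← integral_const_mul]
    simp only [map_smul, _root_.smul_apply, smul_eq_mul, mul_left_comm]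

lemma starMul_apply (l : ℝ) (f g : algA) : starMul l f g = star₀ l f g := rfl

/-- Exhibits left multiplication as a superposition, with coefficients `momentum f`, of isometries
of `L²` (see `lintegral_translate_sq`). This form gives boundedness. -/
lemma wave_star₀_eq (l : ℝ) (f g : algA) (p : ℝ × ℝ) :
    wave l (star₀ l f g) p = (1 / (2 * Real.pi)) * ∫ q : ℝ × ℝ, momentum f.1 q *
      (exp (-l * q.1 / 2) * wave l g (p.1 - q.1, Real.exp (-l * q.1) * (p.2 - q.2))) := by
  rw [wave_apply, momentum_star₀, mul_left_comm, ← integral_const_mul]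
  congr 2; funext q
  rw [twistedIntegrand, wave_apply]
  have he : exp (l * p.1 / 2) * exp (-l * q.1) =
      exp (-l * q.1 / 2) * exp (l * (p.1 - q.1 : ℝ) / 2) := by
    rw [← exp_add, ← exp_add]; congr 1; push_cast; ring
  linear_combination (momentum f.1 q * momentum g.1 (p.1 - q.1, Real.exp (-l * q.1) * (p.2 - q.2))) * he

/-- Cauchy–Schwarz for the measure `a dμ`, applied to `1` and `b`. -/
lemma lintegral_mul_sq_le {α : Type} [MeasurableSpace α] (μ : Measure α) {a b : α → ℝ≥0∞}
    (ha : Measurable a) (hb : Measurable b) :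
    (∫⁻ q, a q * b q ∂μ) ^ 2 ≤ (∫⁻ q, a q ∂μ) * ∫⁻ q, a q * b q ^ 2 ∂μ := by
  have hs : ∀ x : ℝ≥0∞, x ^ (1 / 2 : ℝ) * x ^ (1 / 2 : ℝ) = x := fun x => by
    rw [← ENNReal.rpow_add_of_nonneg _ _ (by norm_num) (by norm_num)]; norm_num
  have h := ENNReal.lintegral_mul_le_Lp_mul_Lq μ (Real.HolderConjugate.two_two)
    (f := fun q => a q ^ (1 / 2 : ℝ)) (g := fun q => a q ^ (1 / 2 : ℝ) * b q)
    (ha.pow_const _).aemeasurable ((ha.pow_const _).mul hb).aemeasurable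
  have h1 : ∀ q, a q ^ (1 / 2 : ℝ) * b q * (a q ^ (1 / 2 : ℝ) * b q) = a q * (b q * b q) :=
    fun q => by rw [mul_mul_mul_comm, hs]
  simp only [Pi.mul_apply, ← mul_assoc (_ ^ (1 / 2 : ℝ)) (_ ^ (1 / 2 : ℝ)), hs, ENNReal.rpow_two,
    sq, h1] at h
  calc (∫⁻ q, a q * b q ∂μ) ^ 2 ≤ ((∫⁻ q, a q ∂μ) ^ (1 / 2 : ℝ) *
        (∫⁻ q, a q * (b q * b q) ∂μ) ^ (1 / 2 : ℝ)) ^ 2 := by gcongr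
    _ = _ := by rw [mul_pow, sq, sq, hs, hs]; simp only [sq]

lemma eLpNorm_two_sq {α : Type} [MeasurableSpace α] {E : Type} [NormedAddCommGroup E]
    (μ : Measure α) (u : α → E) : eLpNorm u 2 μ ^ 2 = ∫⁻ p, ‖u p‖ₑ ^ 2 ∂μ := by
  have h := eLpNorm_nnreal_pow_eq_lintegral (f := u) (μ := μ) (p := 2) (by norm_num)
  simpa using h

lemma enorm_sq_L2 (u : L2Plane) : ‖u‖ₑ ^ 2 = ∫⁻ p, ‖u p‖ₑ ^ 2 := by
  rw [Lp.enorm_def, eLpNorm_two_sq]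

lemma enorm_sq_waveLp (l : ℝ) (f : algA) : ‖waveLp l f‖ₑ ^ 2 = ∫⁻ p, ‖wave l f p‖ₑ ^ 2 := by
  rw [enorm_sq_L2]
  refine lintegral_congr_ae ?_
  filter_upwards [coeFn_waveLp l f] with p h
  rw [h]

lemma lintegral_translate_sq (l : ℝ) {u : ℝ × ℝ → ℂ} (hu : Continuous u) (q : ℝ × ℝ) :
    ∫⁻ p : ℝ × ℝ, ‖exp (-l * q.1 / 2) *
      u (p.1 - q.1, Real.exp (-l * q.1) * (p.2 - q.2))‖ₑ ^ 2 = ∫⁻ p, ‖u p‖ₑ ^ 2 := by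
  have h := lintegral_map (μ := volume) (f := fun p : ℝ × ℝ => ‖u p‖ₑ ^ 2)
    (g := fun p : ℝ × ℝ => (p.1 - q.1, Real.exp (-l * q.1) * (p.2 - q.2))) (by fun_prop)
    (by fun_prop)
  rw [map_affine q (Real.exp_pos _), lintegral_smul_measure, ← Real.exp_neg] at h
  have he : ‖exp (-l * q.1 / 2)‖ₑ ^ 2 = ENNReal.ofReal (Real.exp (-l * q.1)) := by
    rw [← ofReal_norm, norm_exp, ← ENNReal.ofReal_pow (Real.exp_pos _).le, ← Real.exp_nat_mul]
    congr 2
    rw [show (-l * q.1 / 2 : ℂ) = ((-l * q.1 / 2 : ℝ) : ℂ) by push_cast; rfl, ofReal_re]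
    push_cast; ring
  simp only [enorm_mul, mul_pow, he]
  rw [lintegral_const_mul _ (Continuous.measurable (by fun_prop)), ← h, smul_eq_mul, ← mul_assoc,
    ← ENNReal.ofReal_mul (Real.exp_pos _).le, ← Real.exp_add, add_neg_cancel, Real.exp_zero,
    ENNReal.ofReal_one, one_mul]

/-- Left multiplication is bounded. -/
lemma exists_norm_starMul_le (l : ℝ) (f : algA) :
    ∃ C : ℝ, ∀ g, ‖waveLp l (starMul l f g)‖ ≤ C * ‖waveLp l g‖ := by
  -- The bound is the `L¹` norm of the momentum function, as for ordinary convolution; the factor `1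
  -- / 2π ≤ 1` is dropped.
  let A := ∫⁻ q, ‖momentum f.1 q‖ₑ
  have hA : A ≠ ⊤ := (momentum f.1).integrable.2.ne
  have hcf := (momentum f.1).continuous
  refine ⟨A.toReal, fun g => ?_⟩
  have hcg := (wave l g).continuous
  let B : ℝ × ℝ → ℝ × ℝ → ℂ := fun p q =>
    exp (-l * q.1 / 2) * wave l g (p.1 - q.1, Real.exp (-l * q.1) * (p.2 - q.2))
  have hB : Continuous (Function.uncurry B) := by simp only [B, Function.uncurry_def]; fun_prop
  have hB1 : ∀ p, Continuous (B p) := fun p => hB.comp (Continuous.prodMk_right p)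
  have h2pi : ‖(1 / (2 * Real.pi) : ℂ)‖ₑ ≤ 1 := by
    rw [show (1 / (2 * Real.pi) : ℂ) = ((1 / (2 * Real.pi) : ℝ) : ℂ) by push_cast; rfl,
      ← ofReal_norm, norm_real, Real.norm_of_nonneg (by positivity), ENNReal.ofReal_le_one,
      div_le_one (by positivity)]
    linarith [Real.pi_gt_three]
  have h1 : ∀ p, ‖wave l (starMul l f g) p‖ₑ ^ 2 ≤
      A * ∫⁻ q, ‖momentum f.1 q‖ₑ * ‖B p q‖ₑ ^ 2 := fun p => by
    have hb := hB1 p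
    refine le_trans ?_ (lintegral_mul_sq_le volume hcf.enorm.measurable hb.enorm.measurable)
    gcongr
    rw [starMul_apply, wave_star₀_eq, enorm_mul]
    refine (mul_le_of_le_one_left zero_le h2pi).trans ?_
    refine (enorm_integral_le_lintegral_enorm _).trans (le_of_eq ?_)
    simp only [enorm_mul, B]
  have h2 : ‖waveLp l (starMul l f g)‖ₑ ^ 2 ≤ (A * ‖waveLp l g‖ₑ) ^ 2 := by
    rw [mul_pow, enorm_sq_waveLp, enorm_sq_waveLp]
    refine (lintegral_mono h1).trans ?_
    have hc : Measurable fun z : (ℝ × ℝ) × (ℝ × ℝ) => ‖momentum f.1 z.2‖ₑ * ‖B z.1 z.2‖ₑ ^ 2 :=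
      (hcf.enorm.measurable.comp measurable_snd).mul (hB.enorm.measurable.pow_const 2)
    have hc' : Measurable fun p => ∫⁻ q, ‖momentum f.1 q‖ₑ * ‖B p q‖ₑ ^ 2 :=
      hc.lintegral_prod_right'
    rw [lintegral_const_mul _ hc', lintegral_lintegral_swap hc.aemeasurable, sq, mul_assoc]
    gcongr
    rw [← lintegral_mul_const _ hcf.enorm.measurable]
    refine lintegral_mono fun q => ?_
    have hB2 : Continuous fun p => B p q := hB.comp (Continuous.prodMk_left q)
    rw [lintegral_const_mul _ (hB2.enorm.measurable.pow_const 2)]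
    exact mul_le_mul' le_rfl (lintegral_translate_sq l hcg q).le
  have h3 := (ENNReal.pow_le_pow_left_iff two_ne_zero).1 h2
  have h4 := ENNReal.toReal_mono (ENNReal.mul_ne_top hA enorm_ne_top) h3
  simpa [ENNReal.toReal_mul] using h4

lemma exists_bounded_extension {A H : Type} [AddCommGroup A] [Module ℂ A]
    [NormedAddCommGroup H] [NormedSpace ℂ H] [CompleteSpace H] (e : A →ₗ[ℂ] H) (he : DenseRange e)
    (S : A →ₗ[ℂ] A) (C : ℝ) (h : ∀ a, ‖e (S a)‖ ≤ C * ‖e a‖) :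
    ∃ T : H →L[ℂ] H, ∀ a, T (e a) = e (S a) :=
  ⟨(e ∘ₗ S).extendOfNorm e, fun a => LinearMap.extendOfNorm_eq (f := e ∘ₗ S) he ⟨C, h⟩ a⟩

lemma isLeftMul_leftMul (l : ℝ) (f : algA) : IsLeftMul l f (leftMul l f) := by
  have h : ∃ T, IsLeftMul l f T := by
    obtain ⟨C, hC⟩ := exists_norm_starMul_le l f
    obtain ⟨T, hT⟩ := exists_bounded_extension (toHilbertₗ l) (denseRange_toHilbert l)
      (starMul l f) C fun g => by
        rw [toHilbertₗ_apply, toHilbertₗ_apply, ← norm_waveLp, ← norm_waveLp]; exact hC g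
    exact ⟨T, fun ψ => ⟨star₀ l f ψ, star₀_apply l f ψ, hT ψ⟩⟩
  rw [leftMul, dif_pos h]
  exact h.choose_spec

lemma leftMul_toHilbert (l : ℝ) (f g : algA) :
    leftMul l f (toHilbert l g) = toHilbert l (star₀ l f g) := by
  obtain ⟨h, h1, h2⟩ := isLeftMul_leftMul l f g
  have : h = star₀ l f g := Subtype.ext (SchwartzMap.ext fun x => by rw [h1, star₀_apply])
  rw [h2, this]

/-! ### Integral operators and their Hilbert–Schmidt norms. -/

/-- The vector that represents the kernel of left multiplication by `f` at `p`. -/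
def kernelVec (l : ℝ) (f : algA) (p : ℝ × ℝ) : L2Plane :=
  (memLp_kernel l f p).star.toLp

lemma coeFn_kernelVec (l : ℝ) (f : algA) (p : ℝ × ℝ) :
    kernelVec l f p =ᵐ[volume] fun k => conj (kernel l f p k) :=
  (memLp_kernel l f p).star.coeFn_toLp

lemma inner_kernelVec (l : ℝ) (f g : algA) (p : ℝ × ℝ) :
    inner ℂ (kernelVec l f p) (waveLp l g) = wave l (star₀ l f g) p := by
  rw [L2.inner_def, wave_star₀]
  refine integral_congr_ae ?_
  filter_upwards [coeFn_kernelVec l f p, coeFn_waveLp l g] with k h1 h2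
  rw [h1, h2, RCLike.inner_apply', conj_conj]

/-- A bounded operator into `L²` that is given by pairing with vectors `κ p` on a dense set is given
by this pairing everywhere. -/
lemma ae_eq_inner_of_dense {H : Type} [NormedAddCommGroup H] [InnerProductSpace ℂ H]
    (T : H →L[ℂ] L2Plane) (κ : ℝ × ℝ → H) {S : Set H} (hS : Dense S)
    (h : ∀ ξ ∈ S, T ξ =ᵐ[volume] fun p => inner ℂ (κ p) ξ) (ξ : H) :
    T ξ =ᵐ[volume] fun p => inner ℂ (κ p) ξ := by
  obtain ⟨u, hu, hlim⟩ := mem_closure_iff_seq_limit.1 (hS ξ)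
  have h1 : Filter.Tendsto (fun n => T (u n)) Filter.atTop (nhds (T ξ)) :=
    (T.continuous.tendsto ξ).comp hlim
  -- Convergence in `L²` is pointwise almost everywhere only along a subsequence, which is enough to
  -- identify the limit.
  obtain ⟨ns, hns, hae⟩ := (tendstoInMeasure_of_tendsto_Lp h1).exists_seq_tendsto_ae
  have h2 : ∀ᵐ p, ∀ n, T (u n) p = inner ℂ (κ p) (u n) := ae_all_iff.2 fun n => h _ (hu n)
  filter_upwards [hae, h2] with p h3 h4
  refine tendsto_nhds_unique h3 ?_
  simp only [h4]
  exact (tendsto_const_nhds.inner hlim).comp hns.tendsto_atTop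

/-- `leftMul` is the integral operator with kernel `kernel`. -/
lemma toL2_leftMul (l : ℝ) (f : algA) (ξ : ReducedHilbert l) :
    toL2 l (leftMul l f ξ) =ᵐ[volume] fun p => inner ℂ ((toL2 l).symm (kernelVec l f p)) ξ := by
  refine ae_eq_inner_of_dense (((toL2 l).toContinuousLinearEquiv : ReducedHilbert l →L[ℂ] L2Plane)
    ∘L leftMul l f) _ (denseRange_toHilbert l) ?_ ξ
  rintro _ ⟨g, rfl⟩
  change toL2 l (leftMul l f (toHilbert l g)) =ᵐ[volume] fun p =>
    inner ℂ ((toL2 l).symm (kernelVec l f p)) (toHilbert l g)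
  rw [leftMul_toHilbert, toL2_toHilbert]
  filter_upwards [coeFn_waveLp l (star₀ l f g)] with p hp
  rw [hp, ← inner_kernelVec, ← toL2_toHilbert, ← (toL2 l).inner_map_map,
    LinearIsometryEquiv.apply_symm_apply]

/-- Orthonormal vectors are `√2` apart, so balls of radius `1/2` around them are disjoint.
Countability is what allows summing identities that hold almost everywhere for each basis vector. -/
lemma countable_of_hilbertBasis {ι H : Type} [NormedAddCommGroup H] [InnerProductSpace ℂ H]
    [TopologicalSpace.SeparableSpace H] (b : HilbertBasis ι ℂ H) : Countable ι := by
  refine Pairwise.countable_of_isOpen_disjoint (s := fun i => Metric.ball (b i) (1 / 2)) ?_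
    (fun i => Metric.isOpen_ball) fun i => ⟨b i, Metric.mem_ball_self (by norm_num)⟩
  intro i j hij
  refine Metric.ball_disjoint_ball ?_
  have h1 : inner ℂ (b i) (b j) = 0 := b.orthonormal.2 hij
  have h2 := norm_sub_sq (𝕜 := ℂ) (b i) (b j)
  rw [h1, b.orthonormal.1, b.orthonormal.1] at h2
  rw [dist_eq_norm]
  simp at h2
  nlinarith [norm_nonneg (b i - b j)]

/-- The Hilbert–Schmidt norm of an operator given by a kernel. -/
lemma tsum_enorm_sq_eq {ι H : Type} [Countable ι] [NormedAddCommGroup H] [InnerProductSpace ℂ H]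
    (b : HilbertBasis ι ℂ H) (T : H →L[ℂ] L2Plane) (κ : ℝ × ℝ → H)
    (h : ∀ ξ, T ξ =ᵐ[volume] fun p => inner ℂ (κ p) ξ) :
    ∑' i, ‖T (b i)‖ₑ ^ 2 = ∫⁻ p, ‖κ p‖ₑ ^ 2 := by
  have parseval : ∀ v : H, ∑' i, ‖inner ℂ v (b i)‖ₑ ^ 2 = ‖v‖ₑ ^ 2 := fun v => by
    have h1 := b.hasSum_inner_mul_inner v v
    have h2 : HasSum (fun i => ‖inner ℂ v (b i)‖ ^ 2) (‖v‖ ^ 2) := by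
      rw [← Complex.hasSum_ofReal]
      have h3 : ∀ i, inner ℂ v (b i) * inner ℂ (b i) v = ((‖inner ℂ v (b i)‖ ^ 2 : ℝ) : ℂ) :=
        fun i => by rw [← inner_conj_symm (b i) v, Complex.mul_conj, Complex.normSq_eq_norm_sq]
      have h4 : inner ℂ v v = ((‖v‖ ^ 2 : ℝ) : ℂ) := by rw [inner_self_eq_norm_sq_to_K]; simp
      rw [h4] at h1
      simpa only [h3] using h1
    have h3 := ENNReal.ofReal_tsum_of_nonneg (fun i => by positivity) h2.summable
    rw [h2.tsum_eq] at h3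
    simp only [ENNReal.ofReal_pow (norm_nonneg _), ofReal_norm] at h3
    exact h3.symm
  simp only [enorm_sq_L2]
  -- Exchange sum and integral; for almost every `p` the sum is then Parseval's identity for `κ p`.
  rw [← lintegral_tsum fun i => ((Lp.aestronglyMeasurable _).enorm.pow_const 2)]
  refine lintegral_congr_ae ?_
  filter_upwards [ae_all_iff.2 fun i => h (b i)] with p hp
  simp only [hp, parseval]

instance (l : ℝ) : SecondCountableTopology (ReducedHilbert l) :=
  have : Fact ((2 : ℝ≥0∞) ≠ ⊤) := ⟨ENNReal.ofNat_ne_top⟩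
  have : SecondCountableTopology L2Plane := Lp.SecondCountableTopology
  (toL2 l).toHomeomorph.isEmbedding.secondCountableTopology

instance (l : ℝ) : TopologicalSpace.SeparableSpace (SpinorHilbert l) :=
  have := (PiLp.homeomorph 2 fun _ : Fin 2 => ReducedHilbert l).isEmbedding.secondCountableTopology
  inferInstance

/-! ### Multiplication operators in momentum space and their powers. -/

open scoped BoundedContinuousFunction NNReal

lemma memLp_bcf_mul (g : ℝ × ℝ →ᵇ ℂ) (u : L2Plane) : MemLp (fun p => g p * u p) 2 :=
  (Lp.memLp u).of_le_mul (c := ‖g‖) (g.continuous.aestronglyMeasurable.mul (Lp.aestronglyMeasurable u))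
    (ae_of_all _ fun p => by rw [norm_mul]; gcongr; exact g.norm_coe_le_norm p)

/-- Multiplication by a bounded continuous function on `L²`. -/
def mulL2 (g : ℝ × ℝ →ᵇ ℂ) : L2Plane →L[ℂ] L2Plane :=
  LinearMap.mkContinuous
    { toFun := fun u => (memLp_bcf_mul g u).toLp
      map_add' := fun u v => Lp.ext <| by
        filter_upwards [(memLp_bcf_mul g (u + v)).coeFn_toLp, (memLp_bcf_mul g u).coeFn_toLp,
          (memLp_bcf_mul g v).coeFn_toLp, Lp.coeFn_add u v,
          Lp.coeFn_add (memLp_bcf_mul g u).toLp (memLp_bcf_mul g v).toLp] with p h1 h2 h3 h4 h5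
        rw [h1, h5, Pi.add_apply, h2, h3, h4, Pi.add_apply, mul_add]
      map_smul' := fun c u => Lp.ext <| by
        filter_upwards [(memLp_bcf_mul g (c • u)).coeFn_toLp, (memLp_bcf_mul g u).coeFn_toLp,
          Lp.coeFn_smul c u, Lp.coeFn_smul c (memLp_bcf_mul g u).toLp] with p h1 h2 h3 h4
        rw [h1, RingHom.id_apply, h4, Pi.smul_apply, h2, h3, Pi.smul_apply, smul_eq_mul,
          smul_eq_mul, mul_left_comm] } ‖g‖ fun u => by
      refine Lp.norm_le_mul_norm_of_ae_le_mul ?_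
      filter_upwards [(memLp_bcf_mul g u).coeFn_toLp] with p h
      simp only [LinearMap.coe_mk, AddHom.coe_mk, h]
      rw [norm_mul]; gcongr; exact g.norm_coe_le_norm p

lemma coeFn_mulL2 (g : ℝ × ℝ →ᵇ ℂ) (u : L2Plane) : mulL2 g u =ᵐ[volume] fun p => g p * u p :=
  (memLp_bcf_mul g u).coeFn_toLp

/-- Multiplication by a bounded continuous function in momentum space, on both components of a
spinor. -/
def mulSpinor (l : ℝ) (g : ℝ × ℝ →ᵇ ℂ) : SpinorHilbert l →L[ℂ] SpinorHilbert l :=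
  ((PiLp.continuousLinearEquiv 2 ℂ (fun _ : Fin 2 => ReducedHilbert l)).symm :
      (Fin 2 → ReducedHilbert l) →L[ℂ] SpinorHilbert l) ∘L
    ContinuousLinearMap.piMap (fun _ : Fin 2 =>
      ((toL2 l).symm.toContinuousLinearEquiv : L2Plane →L[ℂ] ReducedHilbert l) ∘L mulL2 g ∘L
        ((toL2 l).toContinuousLinearEquiv : ReducedHilbert l →L[ℂ] L2Plane)) ∘L
    (PiLp.continuousLinearEquiv 2 ℂ (fun _ : Fin 2 => ReducedHilbert l) :
      SpinorHilbert l →L[ℂ] (Fin 2 → ReducedHilbert l))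

lemma toL2_mulSpinor (l : ℝ) (g : ℝ × ℝ →ᵇ ℂ) (ξ : SpinorHilbert l) (a : Fin 2) :
    toL2 l (mulSpinor l g ξ a) = mulL2 g (toL2 l (ξ a)) :=
  (toL2 l).apply_symm_apply _

lemma coeFn_mulSpinor (l : ℝ) (g : ℝ × ℝ →ᵇ ℂ) (ξ : SpinorHilbert l) (a : Fin 2) :
    toL2 l (mulSpinor l g ξ a) =ᵐ[volume] fun p => g p * toL2 l (ξ a) p := by
  rw [toL2_mulSpinor]; exact coeFn_mulL2 g _

lemma spinor_ext {l : ℝ} {ξ η : SpinorHilbert l}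
    (h : ∀ a, toL2 l (ξ a) =ᵐ[volume] toL2 l (η a)) : ξ = η :=
  PiLp.ext fun a => (toL2 l).injective (Lp.ext (h a))

lemma inner_spinor (l : ℝ) (ξ η : SpinorHilbert l) :
    inner ℂ ξ η = ∑ a, ∫ p, conj (toL2 l (ξ a) p) * toL2 l (η a) p := by
  rw [PiLp.inner_apply]
  refine Finset.sum_congr rfl fun a _ => ?_
  rw [← (toL2 l).inner_map_map, L2.inner_def]
  simp only [RCLike.inner_apply']

/-- `mulSpinor` as a homomorphism of `*`-algebras. -/
def mulSpinorHom (l : ℝ) : (ℝ × ℝ →ᵇ ℂ) →⋆ₐ[ℂ] (SpinorHilbert l →L[ℂ] SpinorHilbert l) where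
  toFun := mulSpinor l
  map_one' := ContinuousLinearMap.ext fun ξ => spinor_ext fun a => by
    filter_upwards [coeFn_mulSpinor l 1 ξ a] with p h
    rw [h]; simp
  map_mul' g h := ContinuousLinearMap.ext fun ξ => spinor_ext fun a => by
    filter_upwards [coeFn_mulSpinor l (g * h) ξ a, coeFn_mulSpinor l g (mulSpinor l h ξ) a,
      coeFn_mulSpinor l h ξ a] with p h1 h2 h3
    rw [h1, mul_apply_eq_comp, h2, h3, BoundedContinuousFunction.mul_apply, mul_assoc]
  map_zero' := ContinuousLinearMap.ext fun ξ => spinor_ext fun a => by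
    have h0 : toL2 l ((0 : SpinorHilbert l →L[ℂ] SpinorHilbert l) ξ a) = 0 := (toL2 l).map_zero
    rw [h0]
    filter_upwards [coeFn_mulSpinor l 0 ξ a, Lp.coeFn_zero ℂ 2 (volume : Measure (ℝ × ℝ))]
      with p h h2
    rw [h, h2]; simp
  map_add' g h := ContinuousLinearMap.ext fun ξ => spinor_ext fun a => by
    have h0 : toL2 l ((mulSpinor l g + mulSpinor l h) ξ a) =
        toL2 l (mulSpinor l g ξ a) + toL2 l (mulSpinor l h ξ a) := (toL2 l).map_add _ _
    rw [h0]
    filter_upwards [coeFn_mulSpinor l (g + h) ξ a, coeFn_mulSpinor l g ξ a,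
      coeFn_mulSpinor l h ξ a,
      Lp.coeFn_add (toL2 l (mulSpinor l g ξ a)) (toL2 l (mulSpinor l h ξ a))] with p h1 h2 h3 h4
    rw [h1, h4, Pi.add_apply, h2, h3, BoundedContinuousFunction.add_apply, add_mul]
  commutes' c := ContinuousLinearMap.ext fun ξ => spinor_ext fun a => by
    have h0 : toL2 l ((algebraMap ℂ (SpinorHilbert l →L[ℂ] SpinorHilbert l) c) ξ a) =
        c • toL2 l (ξ a) := (toL2 l).map_smul _ _
    rw [h0]
    filter_upwards [coeFn_mulSpinor l (algebraMap ℂ _ c) ξ a, Lp.coeFn_smul c (toL2 l (ξ a))]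
      with p h1 h2
    rw [h1, h2]; simp [Algebra.algebraMap_eq_smul_one]
  map_star' g := by
    rw [ContinuousLinearMap.star_eq_adjoint, ContinuousLinearMap.eq_adjoint_iff]
    intro ξ η
    rw [inner_spinor, inner_spinor]
    refine Finset.sum_congr rfl fun a _ => integral_congr_ae ?_
    filter_upwards [coeFn_mulSpinor l (star g) ξ a, coeFn_mulSpinor l g η a] with p h1 h2
    rw [h1, h2, BoundedContinuousFunction.star_apply]
    simp; ring

/-- The symbol of `𝒟² + 1`. -/
def diracSymbol (l : ℝ) (p : ℝ × ℝ) : ℝ :=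
  l⁻¹ ^ 2 * (1 - Real.exp (l * p.1)) ^ 2 + p.2 ^ 2 + 1

lemma one_le_diracSymbol (l : ℝ) (p : ℝ × ℝ) : 1 ≤ diracSymbol l p := by
  unfold diracSymbol
  nlinarith [sq_nonneg (l⁻¹ * (1 - Real.exp (l * p.1))), sq_nonneg p.2]

lemma contDiff_diracSymbol (l : ℝ) : ContDiff ℝ ∞ (diracSymbol l) := by
  unfold diracSymbol; fun_prop

/-- The negative powers of the symbol of `𝒟² + 1`. -/
def symbolPow (l : ℝ) (t : ℝ≥0) : ℝ × ℝ →ᵇ ℂ :=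
  .ofNormedAddCommGroup (fun p => ((diracSymbol l p ^ (-(t : ℝ)) : ℝ) : ℂ))
    (continuous_ofReal.comp ((contDiff_diracSymbol l).continuous.rpow_const fun p =>
      Or.inl (zero_lt_one.trans_le (one_le_diracSymbol l p)).ne')) 1 fun p => by
    have h := zero_lt_one.trans_le (one_le_diracSymbol l p)
    rw [norm_real, Real.norm_of_nonneg (by positivity)]
    exact Real.rpow_le_one_of_one_le_of_nonpos (one_le_diracSymbol l p) (by simp)

lemma symbolPow_apply (l : ℝ) (t : ℝ≥0) (p : ℝ × ℝ) :
    symbolPow l t p = ((diracSymbol l p ^ (-(t : ℝ)) : ℝ) : ℂ) := rfl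

lemma star_symbolPow (l : ℝ) (t : ℝ≥0) : star (symbolPow l t) = symbolPow l t := by
  ext p; simp [symbolPow_apply]

lemma symbolPow_mul_self (l : ℝ) (t : ℝ≥0) : symbolPow l t * symbolPow l t = symbolPow l (t + t) := by
  ext p
  have h := zero_lt_one.trans_le (one_le_diracSymbol l p)
  simp only [symbolPow_apply, BoundedContinuousFunction.mul_apply]
  rw [← ofReal_mul, ← Real.rpow_add h]
  push_cast
  congr 3; ring

/-- Evaluation of bounded continuous functions at a point. -/
def evalHom (p : ℝ × ℝ) : (ℝ × ℝ →ᵇ ℂ) →⋆ₐ[ℂ] ℂ where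
  toFun g := g p
  map_one' := rfl
  map_mul' _ _ := rfl
  map_zero' := rfl
  map_add' _ _ := rfl
  commutes' c := by simp [Algebra.algebraMap_eq_smul_one]
  map_star' _ := rfl

/-- Powers of a positive element in the image of a commutative algebra can be computed pointwise. -/
lemma rpow_map_eq {A B X : Type} [CStarAlgebra A] [CStarAlgebra B] [PartialOrder B]
    [StarOrderedRing B] (φ : A →⋆ₐ[ℂ] B) (ev : X → A →⋆ₐ[ℂ] ℂ)
    (sep : ∀ a b, (∀ x, ev x a = ev x b) → a = b) {a b : A} (ha : IsSelfAdjoint a)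
    (h0 : 0 ≤ φ a) {t : ℝ} (ht : 0 ≤ t) (r : X → ℝ) (h1 : ∀ x, ev x a = r x)
    (h2 : ∀ x, ev x b = ((r x ^ t : ℝ) : ℂ)) : CFC.rpow (φ a) t = φ b := by
  have hc : Continuous fun x : ℝ => x ^ t := Real.continuous_rpow_const ht
  -- Functional calculus commutes with continuous `*`-homomorphisms. Applied to the evaluations this
  -- identifies `b` as the `t`-th power of `a`; applied to `φ` it carries the power over to `B`,
  -- without computing a spectrum.
  have hb : b = cfc (fun x : ℝ => x ^ t) a := sep _ _ fun x => by
    have h3 : ev x a = algebraMap ℝ ℂ (r x) := h1 x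
    rw [StarAlgHom.map_cfc (R := ℝ) (ev x) (fun x : ℝ => x ^ t) a hc.continuousOn
      (map_continuous _) ha (ha.map (ev x)), h3, cfc_algebraMap, h2]
    rfl
  have hφ : Continuous φ := AddMonoidHomClass.continuous_of_bound φ 1 fun x => by
    rw [one_mul]; exact NonUnitalStarAlgHom.norm_apply_le φ x
  rw [hb, StarAlgHom.map_cfc (R := ℝ) φ (fun x : ℝ => x ^ t) a hc.continuousOn hφ ha (ha.map φ)]
  exact CFC.rpow_eq_cfc_real h0

lemma opPow_mulSpinor (l : ℝ) (t : ℝ≥0) :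
    opPow (mulSpinor l (symbolPow l 1)) t = mulSpinor l (symbolPow l t) := by
  have h0 : 0 ≤ mulSpinorHom l (symbolPow l 1) := by
    -- Positivity, needed for the power in the target algebra: the operator is the square of the
    -- self-adjoint multiplication by the inverse square root of the symbol.
    have h := star_mul_self_nonneg (mulSpinorHom l (symbolPow l (1 / 2)))
    rwa [← map_star, ← map_mul, star_symbolPow, symbolPow_mul_self, add_halves] at h
  refine rpow_map_eq (mulSpinorHom l) evalHom (fun a b h => BoundedContinuousFunction.ext h)
    (star_symbolPow l 1) h0 t.2 (fun p => diracSymbol l p ^ (-(1 : ℝ))) (fun p => rfl) fun p => ?_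
  change symbolPow l t p = _
  rw [symbolPow_apply, ← Real.rpow_mul (zero_le_one.trans (one_le_diracSymbol l p))]
  simp

/-! ### The Dirac operator in momentum space and its resolvent. -/

/-- The analytic continuation of an element of `𝒜` in the first variable. -/
def continuation (f : algA) (z : ℂ) (x : ℝ) : ℂ :=
  (1 / (2 * Real.pi)) * ∫ p : ℝ × ℝ, exp (-I * (p.1 * z + p.2 * x)) * momentum f.1 p

lemma norm_exp_continuation (p : ℝ × ℝ) (z : ℂ) (x : ℝ) :
    ‖exp (-I * (p.1 * z + p.2 * x))‖ = Real.exp (p.1 * z.im) := by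
  rw [norm_exp]; simp

/-- The factor `e^{p₀ Im z}` is bounded on horizontal strips because `p₀` ranges over a compact set;
this permits differentiation under the integral everywhere. -/
lemma differentiable_continuation (f : algA) (x : ℝ) :
    Differentiable ℂ fun z => continuation f z x := by
  obtain ⟨R, hR0, hR⟩ := (mem_schwartzCompact_iff _).1 (momentum_mem f)
  have hc := (momentum f.1).continuous
  have hbound : ∀ (M : ℝ) (z : ℂ), |z.im| ≤ M → ∀ p : ℝ × ℝ,
      ‖exp (-I * (p.1 * z + p.2 * x)) * momentum f.1 p‖ ≤
        Real.exp (R * M) * ‖momentum f.1 p‖ := fun M z hz p => by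
    rcases lt_or_ge R |p.1| with h | h
    · simp [hR p h]
    · rw [norm_mul, norm_exp_continuation]
      refine mul_le_mul_of_nonneg_right (Real.exp_le_exp.2 ?_) (norm_nonneg _)
      calc p.1 * z.im ≤ |p.1 * z.im| := le_abs_self _
        _ = |p.1| * |z.im| := abs_mul _ _
        _ ≤ R * M := by gcongr
  intro z
  refine DifferentiableAt.const_mul ?_ _
  refine (hasDerivAt_integral_of_dominated_loc_of_deriv_le (μ := volume)
    (F := fun z p => exp (-I * (p.1 * z + p.2 * x)) * momentum f.1 p)
    (F' := fun z p => (-I * p.1) * (exp (-I * (p.1 * z + p.2 * x)) * momentum f.1 p))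
    (bound := fun p => R * (Real.exp (R * (|z.im| + 1)) * ‖momentum f.1 p‖))
    (Metric.ball_mem_nhds z one_pos) ?_ ?_ ?_ ?_ ?_ ?_).2.differentiableAt
  · exact Filter.Eventually.of_forall fun w => Continuous.aestronglyMeasurable (by fun_prop)
  · exact ((momentum f.1).integrable.norm.const_mul _).mono'
      (Continuous.aestronglyMeasurable (by fun_prop)) (ae_of_all _ (hbound _ z le_rfl))
  · exact Continuous.aestronglyMeasurable (by fun_prop)
  · refine ae_of_all _ fun p w hw => ?_
    have hw' : |w.im| ≤ |z.im| + 1 := by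
      have h1 : |w.im - z.im| ≤ ‖w - z‖ := by rw [← sub_im]; exact abs_im_le_norm _
      have h2 : ‖w - z‖ < 1 := by rwa [← dist_eq_norm]
      have h3 := abs_sub_abs_le_abs_sub w.im z.im
      linarith
    rcases lt_or_ge R |p.1| with h | h
    · rw [hR p h]; simp
    · rw [norm_mul]
      refine mul_le_mul ?_ (hbound _ w hw' p) (norm_nonneg _) hR0
      simpa using h
  · exact ((momentum f.1).integrable.norm.const_mul _).const_mul _
  · refine ae_of_all _ fun p w _ => ?_
    have h1 : HasDerivAt (fun w : ℂ => -I * (p.1 * w + p.2 * x)) (-I * p.1) w := by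
      simpa using (((hasDerivAt_id w).const_mul (p.1 : ℂ)).add_const (p.2 * x : ℂ)).const_mul (-I)
    refine (h1.cexp.mul_const (momentum f.1 p)).congr_deriv ?_
    ring

lemma continuation_ofReal (f : algA) (x : ℝ × ℝ) : continuation f x.1 x.2 = f.1 x :=
  (algA_apply f x).symm

/-- Entire functions that agree on the real line are equal. -/
lemma eq_of_eq_ofReal {F G : ℂ → ℂ} (hF : Differentiable ℂ F) (hG : Differentiable ℂ G)
    (h : ∀ t : ℝ, F t = G t) : F = G := by
  refine AnalyticOnNhd.eq_of_frequently_eq (z₀ := 0) (fun z _ => hF.analyticAt z)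
    (fun z _ => hG.analyticAt z) ?_
  have ht : Filter.Tendsto ((↑) : ℝ → ℂ) (nhdsWithin 0 {0}ᶜ) (nhdsWithin 0 {0}ᶜ) := by
    refine tendsto_nhdsWithin_iff.2 ⟨?_, ?_⟩
    · exact (continuous_ofReal.tendsto' 0 0 rfl).mono_left nhdsWithin_le_nhds
    · filter_upwards [self_mem_nhdsWithin] with t ht using by simpa using ht
  exact ht.frequently (Filter.Frequently.of_forall h)

lemma exists_shift (l : ℝ) (f : algA) :
    ∃ φ ∈ schwartzCompact, ∀ p, φ p = exp (l * p.1) * momentum f.1 p :=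
  exists_mul_fst (m := fun p => exp (l * p)) (contDiff_const.mul ofRealCLM.contDiff).cexp
    (momentum_mem f)

/-- The translation `ℰ` by `i λ` in the first variable. -/
def shift (l : ℝ) (f : algA) : algA :=
  ofMomentum (exists_shift l f).choose (exists_shift l f).choose_spec.1

lemma momentum_shift (l : ℝ) (f : algA) (p : ℝ × ℝ) :
    momentum (shift l f).1 p = exp (l * p.1) * momentum f.1 p := by
  rw [shift, momentum_ofMomentum]; exact (exists_shift l f).choose_spec.2 p

lemma continuation_shift (l : ℝ) (f : algA) (x : ℝ × ℝ) :
    continuation f (x.1 + I * l) x.2 = (shift l f).1 x := by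
  rw [algA_apply, continuation, fourier₂]
  congr 2; funext p
  rw [momentum_shift, ← mul_assoc, ← exp_add]
  congr 2
  linear_combination -(p.1 * l : ℂ) * I_sq

/-- By the identity theorem every admissible continuation is `continuation f`, and shifting by `iλ`
multiplies the momentum function by `e^{λp₀}`. -/
lemma isShift_iff (l : ℝ) (f : algA) (e : ℝ × ℝ → ℂ) :
    IsShift l f.1 e ↔ ∀ x, e x = (shift l f).1 x := by
  constructor
  · rintro ⟨F, hF, h1, h2⟩ x
    have h3 : (fun z => F z x.2) = fun z => continuation f z x.2 :=
      eq_of_eq_ofReal (hF x.2) (differentiable_continuation f x.2) fun t => by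
        rw [h1 (t, x.2), continuation_ofReal f (t, x.2)]
    rw [h2, ← continuation_shift]
    exact congrFun h3 _
  · intro h
    exact ⟨continuation f, differentiable_continuation f, continuation_ofReal f, fun x => by
      rw [h, continuation_shift]⟩

lemma exists_mul_snd {φ : 𝓢(ℝ × ℝ, ℂ)} (hφ : φ ∈ schwartzCompact) :
    ∃ ψ ∈ schwartzCompact, ∀ p : ℝ × ℝ, ψ p = -I * p.2 * φ p := by
  have tg : (fun x : ℝ × ℝ => (-I * (x.2 : ℂ))).HasTemperateGrowth := by
    have h := (ContinuousLinearMap.smulRightL ℝ (ℝ × ℝ) ℂ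
      (ContinuousLinearMap.snd ℝ ℝ ℝ) (-I)).hasTemperateGrowth
    convert h using 2 with x
    simp [mul_comm]
  have hψ : ∀ p, SchwartzMap.smulLeftCLM ℂ (fun x : ℝ × ℝ => (-I * (x.2 : ℂ))) φ p =
      -I * p.2 * φ p := fun p => by
    simp only [SchwartzMap.smulLeftCLM_apply_apply tg, smul_eq_mul]
  obtain ⟨R, h0, hR⟩ := (mem_schwartzCompact_iff _).1 hφ
  exact ⟨_, (mem_schwartzCompact_iff _).2 ⟨R, h0, fun p hp => by rw [hψ, hR p hp, mul_zero]⟩, hψ⟩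

/-- The derivative in the second variable. -/
def derivSnd (f : algA) : algA :=
  ofMomentum (exists_mul_snd (momentum_mem f)).choose (exists_mul_snd (momentum_mem f)).choose_spec.1

lemma momentum_derivSnd (f : algA) (p : ℝ × ℝ) :
    momentum (derivSnd f).1 p = -I * p.2 * momentum f.1 p := by
  rw [derivSnd, momentum_ofMomentum]; exact (exists_mul_snd (momentum_mem f)).choose_spec.2 p

lemma deriv_snd_eq (f : algA) (x : ℝ × ℝ) :
    deriv (fun t : ℝ => f.1 (x.1, t)) x.2 = (derivSnd f).1 x := by
  have hc := (momentum f.1).continuous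
  have hn : ∀ (t : ℝ) (p : ℝ × ℝ) , ‖exp (-I * (p.1 * x.1 + p.2 * t))‖ = 1 := fun t p => by
    rw [norm_exp]; simp
  have h := (hasDerivAt_integral_of_dominated_loc_of_deriv_le (μ := volume)
    (F := fun (t : ℝ) (p : ℝ × ℝ) => exp (-I * (p.1 * x.1 + p.2 * t)) * momentum f.1 p)
    (F' := fun t p => exp (-I * (p.1 * x.1 + p.2 * t)) * momentum (derivSnd f).1 p)
    (bound := fun p => ‖momentum (derivSnd f).1 p‖)
    (Metric.ball_mem_nhds x.2 one_pos)
    (Filter.Eventually.of_forall fun w => Continuous.aestronglyMeasurable (by fun_prop))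
    (integrable_fourier₂ _ _) (integrable_fourier₂ _ _).aestronglyMeasurable
    (ae_of_all _ fun p t _ => by rw [norm_mul, hn, one_mul])
    (momentum (derivSnd f).1).integrable.norm (ae_of_all _ fun p t _ => by
      have h1 : HasDerivAt (fun w : ℝ => -I * (p.1 * x.1 + p.2 * w)) (-I * p.2) t := by
        simpa using (((hasDerivAt_id t).ofReal_comp.const_mul (p.2 : ℂ)).const_add
          (p.1 * x.1 : ℂ)).const_mul (-I)
      refine (h1.cexp.mul_const (momentum f.1 p)).congr_deriv ?_
      rw [momentum_derivSnd]; ring)).2.const_mul (1 / (2 * Real.pi) : ℂ)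
  have h2 : (fun t : ℝ => f.1 (x.1, t)) = fun t : ℝ => (1 / (2 * Real.pi) : ℂ) *
      ∫ p : ℝ × ℝ, exp (-I * (p.1 * x.1 + p.2 * t)) * momentum f.1 p :=
    funext fun t => algA_apply f (x.1, t)
  rw [h2, h.deriv, algA_apply]
  rfl

/-- The Dirac operator on `𝒜 ⊗ ℂ²`. -/
def dirac (l : ℝ) (ψ : Fin 2 → algA) (a : Fin 2) : algA :=
  ∑ b : Fin 2, (gamma₀ a b • ((1 / l : ℂ) • (ψ b - shift l (ψ b))) +
    gamma₁ a b • (-I • derivSnd (ψ b)))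

lemma isDiracPair_iff (l : ℝ) (ψ χ : Fin 2 → algA) : IsDiracPair l ψ χ ↔ χ = dirac l ψ := by
  have h0 : ∀ a x, (dirac l ψ a).1 x = ∑ b : Fin 2,
      (gamma₀ a b * ((1 / l) * ((ψ b).1 x - (shift l (ψ b)).1 x)) +
        gamma₁ a b * (-I * deriv (fun t : ℝ => (ψ b).1 (x.1, t)) x.2)) := fun a x => by
    simp only [deriv_snd_eq]
    simp [dirac, Fin.sum_univ_two]
  constructor
  · rintro ⟨e, h1, h2⟩
    refine funext fun a => Subtype.ext (SchwartzMap.ext fun x => ?_)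
    rw [h2, h0]
    simp only [(isShift_iff l _ _).1 (h1 _)]
  · rintro rfl
    exact ⟨fun b => (shift l (ψ b)).1, fun b => (isShift_iff l _ _).2 fun x => rfl, h0⟩

/-- The two off-diagonal symbols, here and in `wave_dirac_one`, are complex conjugates. Hence the
operator is symmetric, and its square acts on both components by the same real function. -/
lemma wave_dirac_zero (l : ℝ) (ψ : Fin 2 → algA) (p : ℝ × ℝ) : wave l (dirac l ψ 0) p =
    (l⁻¹ * (1 - exp (l * p.1)) + I * p.2) * wave l (ψ 1) p := by
  simp only [wave_apply, dirac, Fin.sum_univ_two, gamma₀, gamma₁]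
  simp [momentum_shift, momentum_derivSnd]
  linear_combination (-exp (l * p.1 / 2) * I * p.2 * momentum (ψ 1).1 p) * I_sq

lemma wave_dirac_one (l : ℝ) (ψ : Fin 2 → algA) (p : ℝ × ℝ) : wave l (dirac l ψ 1) p =
    (l⁻¹ * (1 - exp (l * p.1)) - I * p.2) * wave l (ψ 0) p := by
  simp only [wave_apply, dirac, Fin.sum_univ_two, gamma₀, gamma₁]
  simp [momentum_shift, momentum_derivSnd]
  linear_combination (exp (l * p.1 / 2) * I * p.2 * momentum (ψ 0).1 p) * I_sq

lemma wave_dirac_dirac (l : ℝ) (ψ : Fin 2 → algA) (a : Fin 2) (p : ℝ × ℝ) :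
    wave l (dirac l (dirac l ψ) a) p = (diracSymbol l p - 1 : ℝ) * wave l (ψ a) p := by
  have h : ((diracSymbol l p - 1 : ℝ) : ℂ) =
      (l⁻¹ * (1 - exp (l * p.1))) ^ 2 + p.2 ^ 2 := by
    rw [diracSymbol]; push_cast; ring
  fin_cases a
  · change wave l (dirac l (dirac l ψ) 0) p = _ * wave l (ψ 0) p
    rw [wave_dirac_zero, wave_dirac_one, h]
    linear_combination (-p.2 ^ 2 * wave l (ψ 0) p) * I_sq
  · change wave l (dirac l (dirac l ψ) 1) p = _ * wave l (ψ 1) p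
    rw [wave_dirac_one, wave_dirac_zero, h]
    linear_combination (-p.2 ^ 2 * wave l (ψ 1) p) * I_sq

lemma diracGraph_eq (l : ℝ) : diracGraph l =
    closure (Set.range fun ψ : Fin 2 → algA => (toSpinor l ψ, toSpinor l (dirac l ψ))) := by
  rw [diracGraph]
  congr 1
  ext z
  simp only [isDiracPair_iff, Set.mem_ofPred_eq, Set.mem_range]
  exact ⟨fun ⟨ψ, χ, h1, h2⟩ => ⟨ψ, by rw [h2, h1]⟩, fun ⟨ψ, h⟩ => ⟨ψ, _, rfl, h.symm⟩⟩

lemma inner_toSpinor (l : ℝ) (ψ χ : Fin 2 → algA) :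
    inner ℂ (toSpinor l ψ) (toSpinor l χ) = ∑ a, ∫ p, conj (wave l (ψ a) p) * wave l (χ a) p := by
  rw [inner_spinor]
  refine Finset.sum_congr rfl fun a _ => integral_congr_ae ?_
  have h : ∀ ψ : Fin 2 → algA, toL2 l (toSpinor l ψ a) = waveLp l (ψ a) := fun ψ =>
    toL2_toHilbert l (ψ a)
  simp only [h]
  filter_upwards [coeFn_waveLp l (ψ a), coeFn_waveLp l (χ a)] with p h1 h2
  rw [h1, h2]

lemma inner_dirac (l : ℝ) (ψ χ : Fin 2 → algA) :
    inner ℂ (toSpinor l (dirac l ψ)) (toSpinor l χ) =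
      inner ℂ (toSpinor l ψ) (toSpinor l (dirac l χ)) := by
  rw [inner_toSpinor, inner_toSpinor, Fin.sum_univ_two, Fin.sum_univ_two, add_comm]
  congr 2
  all_goals
    funext p
    rw [wave_dirac_zero, wave_dirac_one, map_mul]
    simp [← exp_conj]
    ring

lemma inner_closure_symm {H : Type} [NormedAddCommGroup H] [InnerProductSpace ℂ H] {S : Set (H × H)}
    (hS : ∀ z ∈ S, ∀ w ∈ S, inner ℂ z.2 w.1 = inner ℂ z.1 w.2) :
    ∀ z ∈ closure S, ∀ w ∈ closure S, inner ℂ z.2 w.1 = inner ℂ z.1 w.2 := by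
  intro z hz w hw
  have h : (z, w) ∈ closure (S ×ˢ S) := by rw [closure_prod_eq]; exact ⟨hz, hw⟩
  refine closure_minimal (t := {x : (H × H) × (H × H) | inner ℂ x.1.2 x.2.1 = inner ℂ x.1.1 x.2.2})
    (fun x hx => hS _ hx.1 _ hx.2) (isClosed_eq (by fun_prop) (by fun_prop)) h

lemma inner_diracGraph {l : ℝ} {z w : SpinorHilbert l × SpinorHilbert l} (hz : z ∈ diracGraph l)
    (hw : w ∈ diracGraph l) : inner ℂ z.2 w.1 = inner ℂ z.1 w.2 := by
  rw [diracGraph_eq] at hz hw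
  refine inner_closure_symm (H := SpinorHilbert l) ?_ z hz w hw
  rintro _ ⟨ψ, rfl⟩ _ ⟨χ, rfl⟩
  exact inner_dirac l ψ χ

/-- Symmetry in the form `‖𝒟δ‖² = ⟨δ, 𝒟²δ⟩` for a difference `δ = r - r'`, expanded into four
pairings so that linearity of the closed graph is not needed. It yields both uniqueness and
existence of the resolvent. -/
lemma inner_sub_diracGraph {l : ℝ} {r η ζ r' η' ζ' : SpinorHilbert l}
    (h1 : (r, η) ∈ diracGraph l) (h2 : (η, ζ) ∈ diracGraph l)
    (h1' : (r', η') ∈ diracGraph l) (h2' : (η', ζ') ∈ diracGraph l) :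
    inner ℂ (η - η') (η - η') = inner ℂ (r - r') (ζ - ζ') := by
  have e1 := inner_diracGraph h1 h2
  have e2 := inner_diracGraph h1 h2'
  have e3 := inner_diracGraph h1' h2
  have e4 := inner_diracGraph h1' h2'
  simp only [inner_sub_left, inner_sub_right]
  rw [e1, e2, e3, e4]

/-- The difference `δ` of two candidates at `ξ` satisfies `𝒟²δ = -δ`, so `‖𝒟δ‖² = -‖δ‖²` and `δ =
0`. -/
lemma IsInvSqAddOne.eq {l : ℝ} {R R' : SpinorHilbert l →L[ℂ] SpinorHilbert l}
    (h : IsInvSqAddOne l R) (h' : IsInvSqAddOne l R') : R = R' := by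
  ext1 ξ
  obtain ⟨η, h1, h2⟩ := h ξ
  obtain ⟨η', h1', h2'⟩ := h' ξ
  have e := congrArg re (inner_sub_diracGraph h1 h2 h1' h2')
  rw [show ξ - R ξ - (ξ - R' ξ) = -(R ξ - R' ξ) by abel, inner_neg_right, neg_re] at e
  have e1 := inner_self_eq_norm_sq (𝕜 := ℂ) (η - η')
  have e2 := inner_self_eq_norm_sq (𝕜 := ℂ) (R ξ - R' ξ)
  rw [RCLike.re_to_complex] at e1 e2
  rw [e1, e2] at e
  have : ‖R ξ - R' ξ‖ = 0 := by nlinarith [sq_nonneg ‖η - η'‖, sq_nonneg ‖R ξ - R' ξ‖]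
  exact sub_eq_zero.1 (norm_eq_zero.1 this)

lemma dense_toSpinor_algCompact (l : ℝ) :
    Dense (toSpinor l '' {ψ | ∀ a, ψ a ∈ algCompact}) := by
  have h1 : Dense (Set.univ.pi fun _ : Fin 2 => toHilbert l '' algCompact) :=
    dense_pi Set.univ fun _ _ => dense_toHilbert_algCompact l
  have h2 := (PiLp.homeomorph 2 fun _ : Fin 2 => ReducedHilbert l).symm.surjective.denseRange.dense_image
    (PiLp.homeomorph 2 fun _ : Fin 2 => ReducedHilbert l).symm.continuous h1
  refine h2.mono ?_
  rintro _ ⟨v, hv, rfl⟩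
  choose ψ hψ hv' using fun a => hv a trivial
  exact ⟨ψ, hψ, by rw [toSpinor, funext hv']; rfl⟩

/-- With compact support in both momenta, smoothness of the reciprocal symbol suffices and no growth
of its derivatives has to be estimated. -/
lemma exists_resolvent (l : ℝ) {f : algA} (hf : f ∈ algCompact) :
    ∃ g : algA, ∀ p, wave l g p = symbolPow l 1 p * wave l f p := by
  have hs : HasCompactSupport fun p => ((diracSymbol l p)⁻¹ : ℂ) * wave l f p := by
    refine hf.mono fun p hp => ?_
    contrapose! hp
    rw [Function.notMem_support] at hp ⊢
    rw [wave_apply, hp, mul_zero, mul_zero]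
  have hc : ContDiff ℝ ∞ fun p => ((diracSymbol l p)⁻¹ : ℂ) * wave l f p := by
    refine ContDiff.mul (ContDiff.inv (ofRealCLM.contDiff.comp (contDiff_diracSymbol l)) fun p => ?_)
      ((wave l f).smooth _)
    exact_mod_cast (zero_lt_one.trans_le (one_le_diracSymbol l p)).ne'
  obtain ⟨g, -, hg⟩ := exists_waveLp_eq l hs hc
  exact ⟨g, fun p => by rw [hg, symbolPow_apply]; simp [Real.rpow_neg_one]⟩

/-- On compactly supported spinors this is an identity of symbols. For general `ξ`, approximate and
use that the graph is closed; the one sequence whose convergence is not immediate is `𝒟 R uₙ`. -/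
lemma isInvSqAddOne_mulSpinor (l : ℝ) : IsInvSqAddOne l (mulSpinor l (symbolPow l 1)) := by
  set R := mulSpinor l (symbolPow l 1)
  have hcl : IsClosed (diracGraph l) := isClosed_closure
  have hd : ∀ ψ : Fin 2 → algA, (toSpinor l ψ, toSpinor l (dirac l ψ)) ∈ diracGraph l := fun ψ => by
    rw [diracGraph_eq]; exact subset_closure ⟨ψ, rfl⟩
  have hdense : ∀ ξ ∈ toSpinor l '' {ψ | ∀ a, ψ a ∈ algCompact},
      ∃ η, (R ξ, η) ∈ diracGraph l ∧ (η, ξ - R ξ) ∈ diracGraph l := by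
    rintro _ ⟨ψ, hψ, rfl⟩
    choose ρ hρ using fun a => exists_resolvent l (hψ a)
    have h1 : R (toSpinor l ψ) = toSpinor l ρ := spinor_ext fun a => by
      have h3 : ∀ ψ : Fin 2 → algA, toL2 l (toSpinor l ψ a) = waveLp l (ψ a) := fun ψ =>
        toL2_toHilbert l (ψ a)
      filter_upwards [coeFn_mulSpinor l (symbolPow l 1) (toSpinor l ψ) a, coeFn_waveLp l (ψ a),
        coeFn_waveLp l (ρ a)] with p h4 h5 h6
      rw [h4, h3, h3, h5, h6, hρ]
    have h2 : toSpinor l ψ - toSpinor l ρ = toSpinor l (dirac l (dirac l ρ)) := by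
      have h3 : dirac l (dirac l ρ) = ψ - ρ := funext fun a => wave_injective l <|
        SchwartzMap.ext fun p => by
          have h4 := zero_lt_one.trans_le (one_le_diracSymbol l p)
          have h5 : (diracSymbol l p : ℂ) ≠ 0 := by exact_mod_cast h4.ne'
          rw [wave_dirac_dirac, hρ, Pi.sub_apply, map_sub, _root_.sub_apply, hρ, symbolPow_apply]
          simp [Real.rpow_neg_one]
          field_simp
      rw [h3]
      exact PiLp.ext fun a => ((toHilbertₗ l).map_sub (ψ a) (ρ a)).symm
    exact ⟨toSpinor l (dirac l ρ), by rw [h1]; exact hd ρ, by rw [h1, h2]; exact hd _⟩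
  intro ξ
  obtain ⟨u, hu, hlim⟩ := mem_closure_iff_seq_limit.1 (dense_toSpinor_algCompact l ξ)
  choose η h1 h2 using fun n => hdense (u n) (hu n)
  have hr : Filter.Tendsto (fun n => R (u n)) Filter.atTop (nhds (R ξ)) :=
    (R.continuous.tendsto ξ).comp hlim
  have hz := hlim.sub hr
  have hη : CauchySeq η := by
    rw [Metric.cauchySeq_iff]
    intro ε hε
    obtain ⟨N1, hN1⟩ := Metric.cauchySeq_iff.1 hr.cauchySeq ε hε
    obtain ⟨N2, hN2⟩ := Metric.cauchySeq_iff.1 hz.cauchySeq ε hε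
    refine ⟨max N1 N2, fun m hm n hn => ?_⟩
    have e1 := hN1 m (le_of_max_le_left hm) n (le_of_max_le_left hn)
    have e2 := hN2 m (le_of_max_le_right hm) n (le_of_max_le_right hn)
    rw [dist_eq_norm] at e1 e2 ⊢
    have e3 := inner_sub_diracGraph (h1 m) (h2 m) (h1 n) (h2 n)
    have e4 := inner_self_eq_norm_sq_to_K (𝕜 := ℂ) (η m - η n)
    -- Interpolation: `𝒟 R uₙ` is controlled by `R uₙ` and `𝒟² R uₙ = uₙ - R uₙ`, which both
    -- converge.
    have e5 : ‖η m - η n‖ ^ 2 ≤ ‖R (u m) - R (u n)‖ * ‖(u m - R (u m)) - (u n - R (u n))‖ := by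
      refine le_trans (le_of_eq ?_) (norm_inner_le_norm (𝕜 := ℂ) _ _)
      rw [← e3, e4]; simp
    refine lt_of_pow_lt_pow_left₀ 2 hε.le (e5.trans_lt ?_)
    rw [sq]
    exact mul_lt_mul'' e1 e2 (norm_nonneg _) (norm_nonneg _)
  obtain ⟨η₀, hη₀⟩ := cauchySeq_tendsto_of_complete hη
  exact ⟨η₀, hcl.mem_of_tendsto (hr.prodMk_nhds hη₀) (Filter.Eventually.of_forall h1),
    hcl.mem_of_tendsto (hη₀.prodMk_nhds hz) (Filter.Eventually.of_forall h2)⟩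

lemma invSqAddOne_eq (l : ℝ) : invSqAddOne l = mulSpinor l (symbolPow l 1) := by
  have h : ∃ R, IsInvSqAddOne l R := ⟨_, isInvSqAddOne_mulSpinor l⟩
  rw [invSqAddOne, dif_pos h]
  exact h.choose_spec.eq (isInvSqAddOne_mulSpinor l)

lemma diracPow_eq (l : ℝ) (t : ℝ≥0) : diracPow l (2 * t) = mulSpinor l (symbolPow l t) := by
  rw [diracPow, invSqAddOne_eq, mul_div_cancel_left₀ _ two_ne_zero, opPow_mulSpinor]


/-! ### The Hilbert–Schmidt norm of `π(f) g(P)`. -/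

lemma inner_mulL2 (g : ℝ × ℝ →ᵇ ℂ) (u v : L2Plane) :
    inner ℂ u (mulL2 g v) = inner ℂ (mulL2 (star g) u) v := by
  rw [L2.inner_def, L2.inner_def]
  refine integral_congr_ae ?_
  filter_upwards [coeFn_mulL2 g v, coeFn_mulL2 (star g) u] with p h1 h2
  rw [h1, h2, RCLike.inner_apply', RCLike.inner_apply', BoundedContinuousFunction.star_apply]
  simp; ring

/-- The vector that represents the component `a` of `π(f) g(P)` at `p`. -/
def spinorKernelVec (l : ℝ) (f : algA) (g : ℝ × ℝ →ᵇ ℂ) (a : Fin 2) (p : ℝ × ℝ) : SpinorHilbert l :=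
  PiLp.single 2 a ((toL2 l).symm (mulL2 (star g) (kernelVec l f p)))

lemma inner_piLp_single {H : Type} [NormedAddCommGroup H] [InnerProductSpace ℂ H] (a : Fin 2)
    (v : H) (ξ : PiLp 2 (fun _ : Fin 2 => H)) :
    inner ℂ (PiLp.single 2 a v : PiLp 2 (fun _ : Fin 2 => H)) ξ = inner ℂ v (ξ a) := by
  rw [PiLp.inner_apply, Finset.sum_eq_single a]
  · simp
  · intro b _ hb; simp [hb]
  · simp

/-- The component `a` of an operator on spinors, as an operator into `L²`. -/
def spinorComponent (l : ℝ) (T : SpinorHilbert l →L[ℂ] SpinorHilbert l) (a : Fin 2) :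
    SpinorHilbert l →L[ℂ] L2Plane :=
  ((toL2 l).toContinuousLinearEquiv : ReducedHilbert l →L[ℂ] L2Plane) ∘L
    PiLp.proj 2 (fun _ : Fin 2 => ReducedHilbert l) a ∘L T

/-- The multiplication operator is moved onto the kernel vector as its adjoint, so each component is
an integral operator with kernel `K_f(p, k) g(k)`. -/
lemma spinorComponent_eq (l : ℝ) (f : algA) (g : ℝ × ℝ →ᵇ ℂ) (a : Fin 2) (ξ : SpinorHilbert l) :
    spinorComponent l (spinorRep l f ∘L mulSpinor l g) a ξ =ᵐ[volume] fun p =>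
      inner ℂ (spinorKernelVec l f g a p) ξ := by
  have h : ∀ p, inner ℂ (spinorKernelVec l f g a p) ξ =
      inner ℂ ((toL2 l).symm (kernelVec l f p)) (mulSpinor l g ξ a) := fun p => by
    rw [spinorKernelVec, inner_piLp_single, ← (toL2 l).inner_map_map, ← (toL2 l).inner_map_map
      ((toL2 l).symm (kernelVec l f p)), LinearIsometryEquiv.apply_symm_apply,
      LinearIsometryEquiv.apply_symm_apply, toL2_mulSpinor, inner_mulL2]
  simp only [h]
  exact toL2_leftMul l f (mulSpinor l g ξ a)

lemma enorm_sq_spinorKernelVec (l : ℝ) (f : algA) (g : ℝ × ℝ →ᵇ ℂ) (a : Fin 2) (p : ℝ × ℝ) :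
    ‖spinorKernelVec l f g a p‖ₑ ^ 2 = ∫⁻ k, ‖g k‖ₑ ^ 2 * ‖kernel l f p k‖ₑ ^ 2 := by
  have h : ‖spinorKernelVec l f g a p‖ₑ = ‖mulL2 (star g) (kernelVec l f p)‖ₑ := by
    rw [← ofReal_norm, ← ofReal_norm, spinorKernelVec, PiLp.norm_single,
      LinearIsometryEquiv.norm_map]
  rw [h, enorm_sq_L2]
  refine lintegral_congr_ae ?_
  filter_upwards [coeFn_mulL2 (star g) (kernelVec l f p), coeFn_kernelVec l f p] with k h1 h2
  rw [h1, h2, enorm_mul, mul_pow]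
  simp

lemma enorm_sq_spinor (l : ℝ) (T : SpinorHilbert l →L[ℂ] SpinorHilbert l) (ξ : SpinorHilbert l) :
    ‖T ξ‖ₑ ^ 2 = ‖spinorComponent l T 0 ξ‖ₑ ^ 2 + ‖spinorComponent l T 1 ξ‖ₑ ^ 2 := by
  have h : ∀ a, ‖spinorComponent l T a ξ‖ₑ = ‖T ξ a‖ₑ := fun a => by
    rw [← ofReal_norm, ← ofReal_norm]; exact congrArg _ ((toL2 l).norm_map _)
  have h2 := PiLp.norm_sq_eq_of_L2 (fun _ : Fin 2 => ReducedHilbert l) (T ξ)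
  rw [Fin.sum_univ_two] at h2
  rw [h, h, ← ofReal_norm, ← ofReal_norm, ← ofReal_norm, ← ENNReal.ofReal_pow (norm_nonneg _),
    ← ENNReal.ofReal_pow (norm_nonneg _), ← ENNReal.ofReal_pow (norm_nonneg _),
    ← ENNReal.ofReal_add (by positivity) (by positivity), h2]

/-- Integrate `|g(k)|² |K_f(p, k)|²` over `p` first: by `lintegral_kernel_sq` the result is a
constant times `|g(k)|²`. The two spinor components contribute equally, whence the factor `2`. -/
lemma hilbertSchmidtNormSq_eq (l : ℝ) (f : algA) (g : ℝ × ℝ →ᵇ ℂ) {ι : Type}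
    (b : HilbertBasis ι ℂ (SpinorHilbert l)) :
    hilbertSchmidtNormSq b (spinorRep l f ∘L mulSpinor l g) =
      ENNReal.ofReal (2 / (2 * Real.pi) ^ 2) * ‖waveLp l f‖ₑ ^ 2 * ∫⁻ k, ‖g k‖ₑ ^ 2 := by
  have := countable_of_hilbertBasis b
  have hk := continuous_kernel l f
  have hg := g.continuous
  have hint : ∀ a, ∑' i, ‖spinorComponent l (spinorRep l f ∘L mulSpinor l g) a (b i)‖ₑ ^ 2 =
      ENNReal.ofReal (1 / (2 * Real.pi) ^ 2) * ‖waveLp l f‖ₑ ^ 2 * ∫⁻ k, ‖g k‖ₑ ^ 2 := fun a => by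
    rw [tsum_enorm_sq_eq b _ _ (spinorComponent_eq l f g a)]
    simp only [enorm_sq_spinorKernelVec]
    rw [lintegral_lintegral_swap]
    · have h1 : ∀ k, ∫⁻ p, ‖g k‖ₑ ^ 2 * ‖kernel l f p k‖ₑ ^ 2 = ‖g k‖ₑ ^ 2 *
          (ENNReal.ofReal (1 / (2 * Real.pi) ^ 2) * ‖waveLp l f‖ₑ ^ 2) := fun k => by
        have hk' : Continuous fun p => kernel l f p k := hk.comp (Continuous.prodMk_left k)
        rw [lintegral_const_mul _ (hk'.enorm.measurable.pow_const 2), lintegral_kernel_sq,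
          enorm_sq_waveLp]
      simp only [h1]
      rw [lintegral_mul_const _ (hg.enorm.measurable.pow_const 2), mul_comm]
    · exact (((hg.comp continuous_snd).enorm.measurable.pow_const 2).mul
        (hk.enorm.measurable.pow_const 2)).aemeasurable
  simp only [hilbertSchmidtNormSq, enorm_sq_spinor]
  rw [ENNReal.tsum_add, hint, hint, ← two_mul, ← mul_assoc, ← mul_assoc]
  congr 2
  rw [← ENNReal.ofReal_ofNat, ← ENNReal.ofReal_mul (by norm_num)]
  congr 1; ring

lemma resolventSymbol_eq (l s : ℝ) (p : ℝ × ℝ) :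
    resolventSymbol l s p = diracSymbol l (-p) ^ (-s / 4) := by
  simp [resolventSymbol, diracSymbol]

/-- The reflection `p ↦ -p` reconciles `e^{λp₀}` in the symbol of `𝒟² + 1` with `e^{-λp₀}` in `G_s`;
the exponents agree for `s = 4t`. -/
lemma lintegral_symbolPow (l : ℝ) (t : ℝ≥0) :
    ∫⁻ k, ‖symbolPow l t k‖ₑ ^ 2 = eLpNorm (resolventSymbol l (4 * t)) 2 volume ^ 2 := by
  rw [eLpNorm_two_sq, ← (Measure.measurePreserving_neg (volume : Measure (ℝ × ℝ))).lintegral_comp_emb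
    (MeasurableEquiv.neg _).measurableEmbedding]
  refine lintegral_congr fun p => ?_
  rw [resolventSymbol_eq, symbolPow_apply]
  rw [← ofReal_norm, ← ofReal_norm, norm_real, neg_div, mul_div_cancel_left₀ _ four_ne_zero]

/-- Where `λp₀ ≥ 0` the term `(1 - e^{-λp₀})²` is at most `1`. On the half strip with `0 ≤ p₁ ≤ 1`
the base is thus at most `M = λ⁻² + 2`, and `G_s ≥ M^{-s/4}` on a set of infinite measure, whatever
`s` is. -/
lemma eLpNorm_resolventSymbol (l : ℝ) {s : ℝ} (hs : 0 < s) :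
    eLpNorm (resolventSymbol l s) 2 volume = ⊤ := by
  let E : Set (ℝ × ℝ) := {t : ℝ | 0 ≤ l * t} ×ˢ Set.Icc 0 1
  have hE : volume E = ⊤ := by
    have h1 : volume {t : ℝ | 0 ≤ l * t} = ⊤ := by
      refine top_le_iff.1 ?_
      rcases le_total 0 l with h | h
      · rw [← Real.volume_Ici (a := 0)]
        exact measure_mono fun t ht => mul_nonneg h ht
      · rw [← Real.volume_Iic (a := 0)]
        exact measure_mono fun t ht => mul_nonneg_of_nonpos_of_nonpos h ht
    rw [Measure.volume_eq_prod, Measure.prod_prod, h1]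
    simp
  have hm : MeasurableSet E :=
    (measurableSet_le measurable_const (measurable_const_mul l)).prod measurableSet_Icc
  let M : ℝ := l⁻¹ ^ 2 + 2
  have hM : 0 < M := by positivity
  have hb : ∀ p ∈ E, M ^ (-s / 4) ≤ resolventSymbol l s p := fun p hp => by
    have h1 : Real.exp (-l * p.1) ≤ 1 := Real.exp_le_one_iff.2 (by
      have : 0 ≤ l * p.1 := hp.1
      linarith)
    have h2 := Real.exp_pos (-l * p.1)
    have h3 : (1 - Real.exp (-l * p.1)) ^ 2 ≤ 1 := by nlinarith
    have h4 : p.2 ^ 2 ≤ 1 := by nlinarith [hp.2.1, hp.2.2]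
    refine Real.rpow_le_rpow_of_nonpos (by positivity) ?_ (by linarith)
    have h5 := mul_le_of_le_one_right (sq_nonneg l⁻¹) h3
    simp only [M]
    linarith
  have hc : ENNReal.ofReal (M ^ (-s / 4)) ^ 2 ≠ 0 :=
    pow_ne_zero _ (ENNReal.ofReal_pos.2 (Real.rpow_pos_of_pos hM _)).ne'
  have h : eLpNorm (resolventSymbol l s) 2 volume ^ 2 = ⊤ := by
    rw [eLpNorm_two_sq, ← top_le_iff]
    calc ⊤ = ∫⁻ p in E, ENNReal.ofReal (M ^ (-s / 4)) ^ 2 := by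
          rw [setLIntegral_const, hE, ENNReal.mul_top hc]
      _ ≤ ∫⁻ p in E, ‖resolventSymbol l s p‖ₑ ^ 2 := by
          refine setLIntegral_mono' hm fun p hp => ?_
          gcongr
          rw [← ofReal_norm]
          exact ENNReal.ofReal_le_ofReal ((hb p hp).trans (le_abs_self _))
      _ ≤ _ := setLIntegral_le_lintegral _ _
  by_contra h0
  exact ENNReal.pow_ne_top h0 h

/-! ### The isometry `U`. -/

lemma lintegral_plancherel (u : 𝓢(ℝ, ℂ)) :
    ∫⁻ x : ℝ, ‖∫ y : ℝ, exp (-I * x * y) * u y‖ₑ ^ 2 =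
      ENNReal.ofReal (2 * Real.pi) * ∫⁻ y, ‖u y‖ₑ ^ 2 := by
  have h0 : ∀ w : ℝ → ℂ, MemLp w 2 → ∫⁻ x, ‖w x‖ₑ ^ 2 = ENNReal.ofReal (∫ x, conj (w x) * w x).re ∧
      0 ≤ (∫ x, conj (w x) * w x).re := fun w hw => by
    have h2 : ∀ x, conj (w x) * w x = ((‖w x‖ ^ 2 : ℝ) : ℂ) := fun x => by
      rw [← Complex.normSq_eq_conj_mul_self, Complex.normSq_eq_norm_sq]
    simp only [h2]
    rw [integral_complex_ofReal, ofReal_re,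
      ofReal_integral_eq_lintegral_ofReal hw.norm.integrable_sq (ae_of_all _ fun x => by positivity)]
    refine ⟨lintegral_congr fun x => ?_, integral_nonneg fun x => by positivity⟩
    rw [ENNReal.ofReal_pow (norm_nonneg _), ofReal_norm]
  have h1 : ∀ (x : ℝ), ∫ y : ℝ, exp (-I * x * y) * u y =
      FourierTransform.fourier u (x / (2 * Real.pi)) := fun x => by
    rw [SchwartzMap.fourier_coe, Real.fourier_eq']
    congr 1; funext q
    simp only [smul_eq_mul]
    congr 2
    have : (Real.pi : ℂ) ≠ 0 := by exact_mod_cast Real.pi_ne_zero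
    simp; field_simp
  have hm : MemLp (fun x : ℝ => ∫ y : ℝ, exp (-I * x * y) * u y) 2 := by
    simp only [h1]
    have hc : Continuous fun x : ℝ => FourierTransform.fourier u (x / (2 * Real.pi)) :=
      (FourierTransform.fourier u).continuous.comp (by fun_prop)
    refine (memLp_two_iff_integrable_sq_norm hc.aestronglyMeasurable).2 ?_
    exact ((FourierTransform.fourier u).memLp 2 volume).norm.integrable_sq.comp_div (by positivity)
  rw [(h0 _ hm).1, (h0 _ (u.memLp 2 volume)).1, plancherel, ← ENNReal.ofReal_mul (by positivity)]
  congr 1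
  simp

lemma continuous_partialFourier (f : algA) :
    Continuous fun q : ℝ × ℝ => partialFourier f.1 q.1 q.2 :=
  (contDiff_partialFourier 0 f.1).continuous

/-- For fixed `x`, `U f` is `(2π)⁻¹` times the Fourier transform of a smooth compactly supported
function, so Plancherel in the first variable applies. -/
lemma lintegral_unitaryU_slice (l : ℝ) (f : algA) (x : ℝ) :
    ∫⁻ t : ℝ, ‖unitaryU l f.1 (t, x)‖ₑ ^ 2 = ENNReal.ofReal (1 / (2 * Real.pi)) *
      ∫⁻ y : ℝ, ‖partialFourier f.1 (-y) (Real.exp (-(l * y)) * x)‖ₑ ^ 2 := by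
  obtain ⟨R, hR⟩ := partialFourier_support f
  have hk : ContDiff ℝ ∞ fun q : ℝ => partialFourier f.1 (-q) (Real.exp (-(l * q)) * x) := by
    have h : ContDiff ℝ ∞ (fun q : ℝ × ℝ => partialFourier f.1 q.1 q.2) :=
      contDiff_infty.2 fun n => contDiff_partialFourier n f.1
    exact h.comp (by fun_prop : ContDiff ℝ ∞ fun q : ℝ => (-q, Real.exp (-(l * q)) * x))
  have hs : HasCompactSupport fun q : ℝ => partialFourier f.1 (-q) (Real.exp (-(l * q)) * x) := by
    refine HasCompactSupport.of_support_subset_isCompact (isCompact_closedBall (0 : ℝ) R) ?_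
    intro q hq
    rw [mem_closedBall_zero_iff, Real.norm_eq_abs]
    by_contra h
    exact hq (hR (-q) _ (by rw [abs_neg]; exact not_le.1 h))
  have h1 : ∀ t : ℝ, unitaryU l f.1 (t, x) = (1 / (2 * Real.pi)) *
      ∫ y : ℝ, exp (-I * t * y) * hs.toSchwartzMap hk y := fun t => by
    rw [unitaryU, ← integral_neg_eq_self]
    congr 2; funext y
    change _ = exp (-I * t * y) * partialFourier f.1 (-y) (Real.exp (-(l * y)) * x)
    rw [mul_neg]
    congr 2
    push_cast; ring
  have h2 : ‖(1 / (2 * Real.pi) : ℂ)‖ₑ = ENNReal.ofReal (1 / (2 * Real.pi)) := by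
    rw [show (1 / (2 * Real.pi) : ℂ) = ((1 / (2 * Real.pi) : ℝ) : ℂ) by push_cast; rfl,
      ← ofReal_norm, norm_real, Real.norm_of_nonneg (by positivity)]
  simp only [h1, enorm_mul, mul_pow, h2]
  rw [lintegral_const_mul' _ _ (by finiteness), lintegral_plancherel, ← mul_assoc]
  congr 1
  rw [← ENNReal.ofReal_pow (by positivity), ← ENNReal.ofReal_mul (by positivity)]
  congr 1
  field_simp

/-- The Jacobian `e^{λy}` of the dilation turns the momentum function into the wave function; the
rest is Plancherel in the second variable. -/
lemma lintegral_partialFourier_slice (l : ℝ) (f : algA) (y : ℝ) :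
    ∫⁻ x : ℝ, ‖partialFourier f.1 (-y) (Real.exp (-(l * y)) * x)‖ₑ ^ 2 =
      ENNReal.ofReal (2 * Real.pi) * ∫⁻ k : ℝ, ‖wave l f (y, k)‖ₑ ^ 2 := by
  obtain ⟨u, hu⟩ := exists_slice (momentum f.1) y
  have hc : Continuous fun x => partialFourier f.1 (-y) x :=
    (continuous_partialFourier f).comp (Continuous.prodMk_right (-y))
  have h1 := lintegral_map (μ := volume) (f := fun x => ‖partialFourier f.1 (-y) x‖ₑ ^ 2)
    (g := fun x => Real.exp (-(l * y)) * x) (by fun_prop) (by fun_prop)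
  rw [← h1, Real.map_volume_mul_left (Real.exp_ne_zero _), lintegral_smul_measure, ← Real.exp_neg,
    neg_neg, abs_of_pos (Real.exp_pos _)]
  simp only [partialFourier_eq, neg_neg, ← hu]
  have hn : ∀ k, ‖wave l f (y, k)‖ₑ ^ 2 = ENNReal.ofReal (Real.exp (l * y)) * ‖u k‖ₑ ^ 2 := fun k => by
    rw [wave_apply, hu, enorm_mul, mul_pow]
    congr 1
    rw [← ofReal_norm, norm_exp, ← ENNReal.ofReal_pow (by positivity), ← Real.exp_nat_mul]
    congr 2
    simp
    ring
  simp only [hn]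
  rw [lintegral_const_mul' _ _ (by finiteness), lintegral_plancherel, smul_eq_mul, mul_left_comm]

/-- The map `U` is isometric from `ℋ_r` to `L²`. -/
lemma eLpNorm_unitaryU (l : ℝ) (f : algA) :
    eLpNorm (unitaryU l f.1) 2 volume ^ 2 = ‖waveLp l f‖ₑ ^ 2 := by
  have hc := continuous_partialFourier f
  have hw := (wave l f).continuous
  have hm : Measurable (unitaryU l f.1) := by
    have h : StronglyMeasurable fun z : (ℝ × ℝ) × ℝ =>
        exp (I * z.2 * z.1.1) * partialFourier f.1 z.2 (Real.exp (l * z.2) * z.1.2) := by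
      refine Continuous.stronglyMeasurable (Continuous.mul (by fun_prop) ?_)
      exact hc.comp (by fun_prop : Continuous fun z : (ℝ × ℝ) × ℝ =>
        (z.2, Real.exp (l * z.2) * z.1.2))
    exact (h.integral_prod_right'.measurable).const_mul _
  have hc2 : Continuous fun z : ℝ × ℝ =>
      partialFourier f.1 (-z.2) (Real.exp (-(l * z.2)) * z.1) :=
    hc.comp (by fun_prop : Continuous fun z : ℝ × ℝ => (-z.2, Real.exp (-(l * z.2)) * z.1))
  rw [eLpNorm_two_sq, enorm_sq_waveLp, Measure.volume_eq_prod,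
    lintegral_prod_symm _ (hm.enorm.pow_const 2).aemeasurable,
    lintegral_prod _ (hw.enorm.measurable.pow_const 2).aemeasurable]
  simp only [lintegral_unitaryU_slice]
  rw [lintegral_const_mul' _ _ (by finiteness), lintegral_lintegral_swap
    (hc2.enorm.measurable.pow_const 2).aemeasurable]
  simp only [lintegral_partialFourier_slice]
  rw [lintegral_const_mul' _ _ (by finiteness), ← mul_assoc, ← ENNReal.ofReal_mul (by positivity),
    one_div_mul_cancel (by positivity), ENNReal.ofReal_one, one_mul]

/-- The Hilbert–Schmidt norm of `π(f) (𝒟² + 1)^{-s/4}`. -/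
lemma hilbertSchmidtNormSq_diracPow (l : ℝ) (f : algA) {s : ℝ} (hs : 0 < s) {ι : Type}
    (b : HilbertBasis ι ℂ (SpinorHilbert l)) :
    hilbertSchmidtNormSq b (spinorRep l f ∘L diracPow l (s / 2)) =
      ENNReal.ofReal (2 / (2 * Real.pi) ^ 2) * eLpNorm (unitaryU l f.1) 2 volume ^ 2 *
        eLpNorm (resolventSymbol l s) 2 volume ^ 2 := by
  lift s to NNReal using hs.le
  -- Both `diracPow l (s / 2)` and `G_s` carry the power `-s/4` of the symbol.
  have h1 : (s / 2 : ℝ) = 2 * (s / 4 : NNReal) := by push_cast; ring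
  have h2 : (s : ℝ) = 4 * (s / 4 : NNReal) := by push_cast; ring
  rw [h1, diracPow_eq, hilbertSchmidtNormSq_eq, lintegral_symbolPow, eLpNorm_unitaryU, ← h2]

/-! ### Trace class operators are Hilbert–Schmidt. -/

section Trace
variable {H : Type} [NormedAddCommGroup H] [InnerProductSpace ℂ H] [CompleteSpace H]

lemma norm_abs_apply (T : H →L[ℂ] H) (v : H) : ‖CFC.abs T v‖ = ‖T v‖ := by
  have h1 : star (CFC.abs T) * CFC.abs T = star T * T := by
    rw [(CFC.abs_nonneg T).isSelfAdjoint.star_eq, CFC.abs_mul_abs]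
  have h2 : ∀ S : H →L[ℂ] H, inner ℂ (S v) (S v) = inner ℂ v ((star S * S) v) := fun S => by
    rw [ContinuousLinearMap.star_eq_adjoint, mul_apply_eq_comp,
      ContinuousLinearMap.adjoint_inner_right]
  rw [@norm_eq_sqrt_re_inner ℂ, @norm_eq_sqrt_re_inner ℂ, h2, h2, h1]

/-- With `B = √A` one has `‖A v‖² ≤ ‖B‖² ‖B v‖²`, where `‖B‖² = ‖A‖` and `‖B v‖² = ⟨v, A v⟩`. -/
lemma norm_sq_apply_le_of_nonneg {A : H →L[ℂ] H} (hA : 0 ≤ A) (v : H) :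
    ‖A v‖ ^ 2 ≤ ‖A‖ * (inner ℂ v (A v)).re := by
  have hs : 0 ≤ CFC.sqrt A := CFC.sqrt_nonneg A
  have h1 : CFC.sqrt A * CFC.sqrt A = A := CFC.sqrt_mul_sqrt_self A
  have h2 : star (CFC.sqrt A) = CFC.sqrt A := hs.isSelfAdjoint.star_eq
  have h3 : ‖CFC.sqrt A‖ ^ 2 = ‖A‖ := by
    rw [sq, ← CStarRing.norm_star_mul_self, h2, h1]
  have h4 : ‖CFC.sqrt A v‖ ^ 2 = (inner ℂ v (A v)).re := by
    conv_rhs => rw [← h1, mul_apply_eq_comp]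
    rw [← inner_self_eq_norm_sq (𝕜 := ℂ), ← ContinuousLinearMap.adjoint_inner_right,
      ← ContinuousLinearMap.star_eq_adjoint, h2]
    rfl
  calc ‖A v‖ ^ 2 = ‖CFC.sqrt A (CFC.sqrt A v)‖ ^ 2 := by rw [← mul_apply_eq_comp, h1]
    _ ≤ (‖CFC.sqrt A‖ * ‖CFC.sqrt A v‖) ^ 2 := by gcongr; exact ContinuousLinearMap.le_opNorm _ _
    _ = _ := by rw [mul_pow, h3, h4]

/-- A trace class operator is a Hilbert–Schmidt operator. -/
lemma IsTraceClass.hilbertSchmidt {T : H →L[ℂ] H} (h : IsTraceClass T) :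
    ∃ (ι : Type) (b : HilbertBasis ι ℂ H), hilbertSchmidtNormSq b T ≠ ⊤ := by
  obtain ⟨ι, b, hb⟩ := h
  refine ⟨ι, b, ?_⟩
  have h1 : Summable fun i => ‖T (b i)‖ ^ 2 := by
    refine Summable.of_nonneg_of_le (fun i => by positivity) (fun i => ?_)
      (hb.mul_left ‖CFC.abs T‖)
    rw [← norm_abs_apply]
    exact norm_sq_apply_le_of_nonneg (CFC.abs_nonneg T) _
  have h2 := h1.tsum_ofReal_ne_top
  simpa only [hilbertSchmidtNormSq, ENNReal.ofReal_pow (norm_nonneg _), ofReal_norm] using h2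

end Trace

/-- If `π(f) (𝒟² + 1)^{-s/2}` is trace class, then `f = 0` in `ℋ_r`. -/
lemma waveLp_eq_zero_of_isTraceClass (l : ℝ) (f : algA) {s : ℝ} (hs : 0 < s)
    (h : IsTraceClass (spinorRep l f ∘L diracPow l s)) : waveLp l f = 0 := by
  obtain ⟨ι, b, hb⟩ := h.hilbertSchmidt
  -- The power `-s/2` is `-(2s)/4`, hence the exponent `2 * s`.
  have h1 := hilbertSchmidtNormSq_diracPow l f (by positivity : 0 < 2 * s) b
  rw [mul_div_cancel_left₀ _ two_ne_zero, eLpNorm_resolventSymbol l (by positivity),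
    eLpNorm_unitaryU] at h1
  by_contra h0
  refine hb (h1.trans ?_)
  have h2 : ‖waveLp l f‖ₑ ^ 2 ≠ 0 := pow_ne_zero _ (by simpa using h0)
  have h3 : ENNReal.ofReal (2 / (2 * Real.pi) ^ 2) ≠ 0 :=
    (ENNReal.ofReal_pos.2 (by positivity)).ne'
  rw [ENNReal.top_pow two_ne_zero, ENNReal.mul_top (mul_ne_zero h3 h2)]

/-! ### Squares in `𝒜`: nonvanishing and positivity. -/

lemma waveLp_injective (l : ℝ) : Function.Injective (waveLp l) := fun f g h => by
  refine wave_injective l (DFunLike.coe_injective ?_)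
  refine Continuous.ae_eq_iff_eq volume (wave l f).continuous (wave l g).continuous |>.1 ?_
  filter_upwards [coeFn_waveLp l f, coeFn_waveLp l g] with p h1 h2
  rw [← h1, ← h2, h]

lemma integrable_conj_kernel_mul (l : ℝ) (f : algA) (u v : 𝓢(ℝ × ℝ, ℂ)) :
    Integrable fun z : (ℝ × ℝ) × (ℝ × ℝ) => conj (u z.1) * (kernel l f z.1 z.2 * v z.2) := by
  obtain ⟨C, -, hC⟩ := kernel_bounded l f
  have hu := u.continuous
  have hv := v.continuous
  have hk := continuous_kernel l f
  refine ((u.integrable.norm.mul_prod v.integrable.norm).const_mul C).mono'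
    (Continuous.aestronglyMeasurable ?_) (ae_of_all _ fun z => ?_)
  · exact (continuous_conj.comp (hu.comp continuous_fst)).mul (hk.mul (hv.comp continuous_snd))
  · rw [norm_mul, norm_mul, RCLike.norm_conj]
    calc _ ≤ ‖u z.1‖ * (C * ‖v z.2‖) := by gcongr; exact hC _ _
      _ = _ := by ring

lemma integral_conj_mul_kernel (l : ℝ) (f : algA) (u v : 𝓢(ℝ × ℝ, ℂ)) :
    ∫ p, conj (u p) * ∫ k, kernel l f p k * v k =
      ∫ k, (∫ p, conj (u p) * kernel l f p k) * v k := by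
  simp only [← integral_const_mul, ← integral_mul_const]
  rw [integral_integral_swap (integrable_conj_kernel_mul l f u v)]
  simp only [mul_assoc]

lemma inner_waveLp_eq (l : ℝ) (f g : algA) :
    inner ℂ (waveLp l f) (waveLp l g) = ∫ p, conj (wave l f p) * wave l g p := by
  rw [L2.inner_def]
  refine integral_congr_ae ?_
  filter_upwards [coeFn_waveLp l f, coeFn_waveLp l g] with p h1 h2
  rw [h1, h2, RCLike.inner_apply']

lemma inner_leftMul (l : ℝ) (f u v : algA) :
    inner ℂ (toHilbert l u) (leftMul l f (toHilbert l v)) =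
      ∫ k, (∫ p, conj (wave l u p) * kernel l f p k) * wave l v k := by
  rw [leftMul_toHilbert, ← inner_waveLp, inner_waveLp_eq]
  simp only [wave_star₀]
  exact integral_conj_mul_kernel l f _ _

/-- For selfadjoint `f`, the square `f ⋆ f` does not vanish unless `f` does. -/
lemma eq_zero_of_star₀_self (l : ℝ) {f : algA}
    (hf : ∀ u v : ReducedHilbert l, inner ℂ (leftMul l f u) v = inner ℂ u (leftMul l f v))
    (h : waveLp l (star₀ l f f) = 0) : f = 0 := by
  have h0 : leftMul l f (toHilbert l f) = 0 := by
    rw [leftMul_toHilbert]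
    apply (toL2 l).injective
    rw [toL2_toHilbert, h, map_zero]
  -- This function represents the functional `v ↦ ⟨f, f ⋆ v⟩ = ⟨f ⋆ f, v⟩ = 0`.
  let c : ℝ × ℝ → ℂ := fun k => ∫ p, conj (wave l f p) * kernel l f p k
  have hw := (wave l f).continuous
  have hk := continuous_kernel l f
  have hc : Continuous c := by
    obtain ⟨C, -, hC⟩ := kernel_bounded l f
    refine continuous_of_dominated (bound := fun p => ‖wave l f p‖ * C) (fun k => ?_)
      (fun k => ae_of_all _ fun p => ?_) ((wave l f).integrable.norm.mul_const C)
      (ae_of_all _ fun p => ?_)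
    · exact ((continuous_conj.comp hw).mul
        (hk.comp (Continuous.prodMk_left k))).aestronglyMeasurable
    · rw [norm_mul, RCLike.norm_conj]
      gcongr
      exact hC _ _
    · exact continuous_const.mul (hk.comp (Continuous.prodMk_right p))
  have hz : ∀ᵐ k, c k = 0 := by
    refine ae_eq_zero_of_integral_contDiff_smul_eq_zero hc.locallyIntegrable fun g hg hs => ?_
    obtain ⟨v, -, hv⟩ := exists_waveLp_eq l (g := fun p => (g p : ℂ))
      (hs.comp_left (g := ((↑) : ℝ → ℂ)) rfl) (ofRealCLM.contDiff.comp hg)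
    have h1 := inner_leftMul l f f v
    rw [← hf, h0, inner_zero_left] at h1
    rw [h1]
    refine integral_congr_ae (ae_of_all _ fun k => ?_)
    simp only [hv, Complex.real_smul, c]
    ring
  -- Continuity upgrades vanishing almost everywhere to vanishing at the single point `k = 0`, where
  -- `c` is `‖w_f‖² / 2π`.
  have hz' : c = fun _ => 0 :=
    (Continuous.ae_eq_iff_eq volume hc continuous_const).1 hz
  have h2 := congrFun hz' 0
  simp only [c, kernel_zero, mul_left_comm _ (1 / (2 * Real.pi) : ℂ)] at h2
  rw [integral_const_mul, ← inner_waveLp_eq] at h2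
  have h3 : inner ℂ (waveLp l f) (waveLp l f) = 0 :=
    (mul_eq_zero.1 h2).resolve_left (one_div_ne_zero two_pi_ne_zero')
  exact waveLp_injective l ((inner_self_eq_zero.1 h3).trans (map_zero _).symm)

lemma not_isTraceClass_of_star_self (l : ℝ) {f h : algA} (hf : IsNonneg l f) (hf0 : f ≠ 0)
    (hh : ∀ x, h.1 x = starProd l f.1 f.1 x) {s : ℝ} (hs : 0 < s) :
    ¬ IsTraceClass (spinorRep l h ∘L diracPow l s) := fun ht => by
  have h1 : h = star₀ l f f :=
    Subtype.ext (SchwartzMap.ext fun x => by rw [hh, star₀_apply])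
  have h2 := waveLp_eq_zero_of_isTraceClass l h hs ht
  rw [h1] at h2
  exact hf0 (eq_zero_of_star₀_self l (fun u v => hf.isSelfAdjoint.isSymmetric u v) h2)

lemma integral_comp_shear (l : ℝ) (k : ℝ × ℝ) {u : ℝ × ℝ → ℂ} (hu : Continuous u) :
    ∫ r : ℝ × ℝ, u (r.1 - k.1, r.2 - Real.exp (l * (r.1 - k.1)) * k.2) = ∫ r, u r := by
  have h := measurePreserving_shear l k
  conv_rhs => rw [← h.map_eq]
  rw [integral_map h.measurable.aemeasurable hu.aestronglyMeasurable]

/-- The kernels compose like the products. -/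
lemma kernel_star₀ (l : ℝ) (f g : algA) (p k : ℝ × ℝ) :
    kernel l (star₀ l f g) p k = ∫ r, kernel l f p r * kernel l g r k := by
  have hc : Continuous fun r => kernel l f
      (p.1 - k.1, p.2 - Real.exp (l * (p.1 - k.1)) * k.2) r * wave l g r :=
    ((continuous_kernel l f).comp (Continuous.prodMk_right _)).mul (wave l g).continuous
  rw [kernel, wave_star₀, ← integral_comp_shear l k hc, ← integral_const_mul]
  congr 1; funext r
  have he : Real.exp (l * (p.1 - r.1)) * Real.exp (l * (r.1 - k.1)) = Real.exp (l * (p.1 - k.1)) := by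
    rw [← Real.exp_add]; congr 1; ring
  -- The kernel is invariant under shearing both of its arguments by the same `k`, because the
  -- exponential is multiplicative.
  have h1 : kernel l f (p.1 - k.1, p.2 - Real.exp (l * (p.1 - k.1)) * k.2)
      (r.1 - k.1, r.2 - Real.exp (l * (r.1 - k.1)) * k.2) = kernel l f p r := by
    simp only [kernel, sub_sub_sub_cancel_right]
    congr 3
    rw [← he]; ring
  rw [h1, kernel, kernel]
  ring

/-- On `𝒜` this is `kernel_star₀` and Fubini, justified by the decay of the first kernel in its
second argument and the boundedness of the other. It makes `π(f ⋆ f)` a square. -/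
lemma leftMul_star₀ (l : ℝ) (f g : algA) :
    leftMul l (star₀ l f g) = leftMul l f ∘L leftMul l g := by
  refine ContinuousLinearMap.ext fun ξ => congrFun ((denseRange_toHilbert l).equalizer
    (leftMul l (star₀ l f g)).continuous (leftMul l f ∘L leftMul l g).continuous ?_) ξ
  funext u
  change leftMul l (star₀ l f g) (toHilbert l u) = leftMul l f (leftMul l g (toHilbert l u))
  rw [leftMul_toHilbert, leftMul_toHilbert, leftMul_toHilbert]
  congr 1
  refine wave_injective l (SchwartzMap.ext fun p => ?_)
  simp only [wave_star₀, kernel_star₀, ← integral_const_mul, ← integral_mul_const]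
  rw [integral_integral_swap]
  · simp only [mul_assoc]
  obtain ⟨C, hC, hf⟩ := kernel_bound l f
  obtain ⟨D, hD, hg⟩ := kernel_bounded l g
  have hkf := continuous_kernel l f
  have hkg := continuous_kernel l g
  have hu := (wave l u).continuous
  refine (((wave l u).integrable.norm.const_mul D).mul_prod (integrable_planeWeight.const_mul
    (C * ((1 + p.1 ^ 2) * (1 + p.2 ^ 2))))).mono' (Continuous.aestronglyMeasurable ?_)
    (ae_of_all _ fun z => ?_)
  · exact ((hkf.comp (continuous_const.prodMk continuous_snd)).mul
      (hkg.comp continuous_swap)).mul (hu.comp continuous_fst)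
  · change ‖kernel l f p z.2 * kernel l g z.2 z.1 * wave l u z.1‖ ≤ _
    rw [norm_mul, norm_mul]
    calc _ ≤ (C * ((1 + p.1 ^ 2) * (1 + p.2 ^ 2)) * planeWeight z.2) * D * ‖wave l u z.1‖ := by
          have h1 := planeWeight_pos z.2
          gcongr
          · exact hf _ _
          · exact hg _ _
      _ = _ := by ring

lemma inner_symm_of_denseRange {A H : Type} [NormedAddCommGroup H] [InnerProductSpace ℂ H]
    {e : A → H} (he : DenseRange e) (T : H →L[ℂ] H)
    (h : ∀ a b, inner ℂ (T (e a)) (e b) = inner ℂ (e a) (T (e b))) (u v : H) :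
    inner ℂ (T u) v = inner ℂ u (T v) :=
  DenseRange.induction_on₂ he (isClosed_eq (by fun_prop) (by fun_prop)) h u v

lemma inner_leftMul_symm (l : ℝ) {f : algA}
    (hf : ∀ p k, conj (kernel l f p k) = kernel l f k p) (u v : ReducedHilbert l) :
    inner ℂ (leftMul l f u) v = inner ℂ u (leftMul l f v) := by
  refine inner_symm_of_denseRange (denseRange_toHilbert l) _ (fun a b => ?_) u v
  change inner ℂ (leftMul l f (toHilbert l a)) (toHilbert l b) =
    inner ℂ (toHilbert l a) (leftMul l f (toHilbert l b))
  rw [inner_leftMul, leftMul_toHilbert, ← inner_waveLp, inner_waveLp_eq]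
  refine integral_congr_ae (ae_of_all _ fun k => ?_)
  simp only [wave_star₀]
  rw [← integral_conj]
  simp only [map_mul, hf, mul_comm]

lemma isNonneg_star₀_self (l : ℝ) {f : algA}
    (hf : ∀ u v : ReducedHilbert l, inner ℂ (leftMul l f u) v = inner ℂ u (leftMul l f v)) :
    IsNonneg l (star₀ l f f) := by
  have h1 : leftMul l f = ContinuousLinearMap.adjoint (leftMul l f) :=
    (ContinuousLinearMap.eq_adjoint_iff _ _).2 hf
  have h2 := ContinuousLinearMap.isPositive_adjoint_comp_self (leftMul l f)
  rwa [← h1, ← leftMul_star₀] at h2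

/-- There is a nonzero element of `𝒜` with a hermitian kernel. -/
lemma exists_hermitian (l : ℝ) :
    ∃ f : algA, f ≠ 0 ∧ ∀ p k, conj (kernel l f p k) = kernel l f k p := by
  let χ : ContDiffBump (0 : ℝ × ℝ) := ⟨1, 2, one_pos, one_lt_two⟩
  -- The involution that exchanging `p` and `k` induces on the argument of the wave function in the
  -- kernel. A real `τ`-invariant wave function has a hermitian kernel; a symmetrized bump is one,
  -- and its value at the fixed point `0` is `2`.
  let τ : ℝ × ℝ ≃ₜ ℝ × ℝ :=
    { toFun := fun q => (-q.1, -(Real.exp (-(l * q.1)) * q.2))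
      invFun := fun q => (-q.1, -(Real.exp (-(l * q.1)) * q.2))
      left_inv := fun q => by
        ext
        · simp
        · simp [← mul_assoc, ← Real.exp_add]
      right_inv := fun q => by
        ext
        · simp
        · simp [← mul_assoc, ← Real.exp_add]
      continuous_toFun := by fun_prop
      continuous_invFun := by fun_prop }
  have hτ : ∀ q, τ q = (-q.1, -(Real.exp (-(l * q.1)) * q.2)) := fun q => rfl
  have hττ : ∀ q, τ (τ q) = q := τ.left_inv
  have hτd : ContDiff ℝ ∞ τ := by
    change ContDiff ℝ ∞ fun q : ℝ × ℝ => (-q.1, -(Real.exp (-(l * q.1)) * q.2))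
    fun_prop
  let w : ℝ × ℝ → ℂ := fun q => ((χ q + χ (τ q) : ℝ) : ℂ)
  have hs : HasCompactSupport w :=
    HasCompactSupport.comp_left (g := ((↑) : ℝ → ℂ))
      (χ.hasCompactSupport.add (χ.hasCompactSupport.comp_homeomorph τ)) rfl
  have hw : ContDiff ℝ ∞ w := ofRealCLM.contDiff.comp (χ.contDiff.add (χ.contDiff.comp hτd))
  obtain ⟨f, -, hf⟩ := exists_waveLp_eq l hs hw
  refine ⟨f, ?_, fun p k => ?_⟩
  · rintro rfl
    have h1 : (0 : ℂ) = w 0 := by rw [← hf, (wave l).map_zero]; rfl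
    have h2 : χ 0 = 1 := χ.one_of_mem_closedBall (by simpa using χ.rIn_pos.le)
    have h3 : τ 0 = 0 := by simp [hτ]
    simp only [w, h3, h2] at h1
    norm_num at h1
  · have h1 : τ (p.1 - k.1, p.2 - Real.exp (l * (p.1 - k.1)) * k.2) =
        (k.1 - p.1, k.2 - Real.exp (l * (k.1 - p.1)) * p.2) := by
      rw [hτ]
      ext
      · simp
      · have h2 : Real.exp (-(l * (p.1 - k.1))) * Real.exp (l * (p.1 - k.1)) = 1 := by
          rw [← Real.exp_add]; simp
        have h3 : l * (k.1 - p.1) = -(l * (p.1 - k.1)) := by ring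
        simp only [h3]
        linear_combination k.2 * h2
    rw [kernel, kernel, hf, hf, ← h1]
    simp only [w, hττ, map_mul, conj_ofReal, add_comm]
    simp [map_ofNat]

lemma not_finitelySummable (l : ℝ) : ¬ FinitelySummable l := by
  rintro ⟨s, hs, h⟩
  obtain ⟨f, hf, hk⟩ := exists_hermitian l
  have hsymm := inner_leftMul_symm l hk
  exact hf (eq_zero_of_star₀_self l hsymm
    (waveLp_eq_zero_of_isTraceClass l _ hs (h _ (isNonneg_star₀_self l hsymm))))

end KMinkowski

end

open MeasureTheory KMinkowski

theorem mainTheorem4 (l : ℝ) (hl : l ≠ 0) :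
    -- for `h = f ⋆ f` with `0 ≠ f ≥ 0`, no `π(h) (𝒟² + 1)^{-s/2}` is trace class
    (∀ f h : algA, IsNonneg l f → f ≠ 0 → (∀ x, h.1 x = starProd l f.1 f.1 x) →
      ∀ s : ℝ, 0 < s → ¬ IsTraceClass (spinorRep l h ∘L diracPow l s)) ∧
    -- the Hilbert–Schmidt norm of `π(f) (𝒟² + 1)^{-s/4}` factorizes
    (∀ f : algA, ∀ s : ℝ, 0 < s → ∀ (ι : Type) (b : HilbertBasis ι ℂ (SpinorHilbert l)),
      hilbertSchmidtNormSq b (spinorRep l f ∘L diracPow l (s / 2)) =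
        ENNReal.ofReal (2 / (2 * Real.pi) ^ 2) * eLpNorm (unitaryU l f.1) 2 volume ^ 2 *
          eLpNorm (resolventSymbol l s) 2 volume ^ 2) ∧
    (∀ s : ℝ, 0 < s → eLpNorm (resolventSymbol l s) 2 volume = ⊤) ∧
    ¬ FinitelySummable l := by
  exact ⟨fun f h hf hf0 hh s hs => not_isTraceClass_of_star_self l hf hf0 hh hs,
    fun f s hs ι b => hilbertSchmidtNormSq_diracPow l f hs b,
    fun s hs => eLpNorm_resolventSymbol l hs, not_finitelySummable l⟩
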